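/- **Setting.** A network of $n\ge 1$ agents takes decisions in $\mathbb R^p$, $p\ge1$ (Euclidean norm $\|\cdot\|$). At iteration $t\in\{1,2,\dots\}$ agent $i$ has a loss $f_{i,t}:\mathbb D\to\mathbb R$ (possibly nonconvex) and a constraint function $g_{i,t}:\mathbb D\to\mathbb R^{m_i}$ with convex components, where $\mathbb D\subseteq\mathbb R^p$ is a closed convex set containing the decision set $\mathbb X$ (for instance $\mathbb D=\mathbb X$). Write $f_t=\frac1n\sum_j f_{j,t}$, $g_t=\mathrm{col}(g_{1,t},\dots,g_{n,t})$ and $\mathcal X_T=\{x\in\mathbb X: g_t(x)\le 0\ \ \forall t\le T\}$, which is assumed nonempty for every $T\ge1$. Let $[\cdot]_+$ be the componentwise positive part and $\mathcal P_K$ the Euclidean projection onto $K$. **Assumptions.** There are constants $0<r$, $R$, $G_1,G_2,L$, $w\in(0,1)$, an integer $B>0$ and $C\ge0$ such that: * $\mathbb X$ is closed and convex and $r\mathbb B^p\subseteq\mathbb X\subseteq R\mathbb B^p$, where $\mathbb B^p$ is the closed unit ball. * On $\mathbb D$, each $f_{i,t}$ is differentiable with $\|\nabla f_{i,t}\|\le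 G_1$, and each $g_{i,t}$ has at every point a matrix of subgradients of norm at most $G_2$. * Each $\nabla f_{i,t}$ is $L$-Lipschitz on $\mathbb D$. * The directed graphs $([n],\mathcal E_t)$ and the mixing matrices $W_t$ satisfy: $[W_t]_{ij}\ge w$ if $(j,i)\in\mathcal E_t$ or $i=j$, and $[W_t]_{ij}=0$ otherwise; $W_t$ is doubly stochastic; for every $t\ge1$ the graph $([n],\bigcup_{l=0}^{B-1}\mathcal E_{t+l})$ is strongly connected. * The (random) compressor $\mathcal C$ satisfies $\mathbf E_{\mathcal C}\|\mathcal C(y)-y\|^2\le C$ for every $y$ in its domain $\mathbb Y\subseteq\mathbb R^p$. **Algorithm.** Start with $\hat z_{j,0}=0$ and arbitrary $z_{i,1}\in(1-\xi_1)\mathbb X$. At iteration $t=1,2,\dots$ every agent $i$ computes $$\hat z_{j,t}=\hat z_{j,t-1}+s_t\,\mathcal C\big((z_{j,t}-\hat z_{j,t-1})/s_t\big),\qquad x_{i,t}=\sum_{j=1}^n[W_t]_{ij}\hat z_{j,t},$$ draws $u_{i,t}$ uniformly from the unit sphere of $\mathbb R^p$, and sets $$v_{i,t+1}=\gamma_t[g_{i,t}(x_{i,t})]_+,\qquad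 z_{i,t+1}=\mathcal P_{(1-\xi_{t+1})\mathbb X}\big(x_{i,t}-\alpha_t b_{i,t+1}\big),$$ $$b_{i,t+1}=\tfrac p{\delta_t}\big(f_{i,t}(x_{i,t}+\delta_tu_{i,t})-f_{i,t}(x_{i,t})\big)u_{i,t}+\tfrac p{\delta_t}\big\langle g_{i,t}(x_{i,t}+\delta_tu_{i,t})-g_{i,t}(x_{i,t}),\,v_{i,t+1}\big\rangle u_{i,t}.$$ All directions $u_{i,t}$ and all internal randomness of the compressor, over agents and iterations, are independent. The execution is assumed well defined: almost surely all compressor inputs lie in $\mathbb Y$ and all query points $x_{i,t}$ and $x_{i,t}+\delta_tu_{i,t}$ lie in $\mathbb D$. **Parameters.** $\alpha_t=\alpha_0/t^{\theta_1}$, $\gamma_t=\gamma_0/\alpha_t$, $\xi_t=\alpha_t$, $\delta_t=r\alpha_t$, $s_t=s_0/t^{\theta_2}$ with $\alpha_0\in(0,1)$, $\theta_1\in(0,1)$, $\gamma_0>0$, $4(p^2+1)G_2^2\gamma_0\le1$, $s_0>0$, $\theta_2\ge1$. **Theorem.** Let $$\mathrm{Net\text{-}Reg}(T)=\frac1n\sum_{i=1}^n\Big(\sum_{t=1}^T\langle\nabla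 f_t(x_{i,t}),x_{i,t}\rangle-\inf_{x\in\mathcal X_T}\Big\langle\sum_{t=1}^T\nabla f_t(x_{i,t}),x\Big\rangle\Big),\qquad \mathrm{Net\text{-}CCV}(T)=\frac1n\sum_{i=1}^n\sum_{t=1}^T\big\|[g_t(x_{i,t})]_+\big\|.$$ Both are integrable, and for all $T\ge1$ $$\mathbf E[\mathrm{Net\text{-}Reg}(T)]=\mathcal O\big(T^{\max\{1-\theta_1,\theta_1\}}\big),\qquad \mathbf E[\mathrm{Net\text{-}CCV}(T)]=\mathcal O\big(T^{1-\theta_1/2}\big).$$ If moreover Slater's condition holds, i.e. there are $x_s\in\mathbb X$ and $\varsigma_s>0$ with every component of $g_t(x_s)$ at most $-\varsigma_s$ for all $t\ge1$, then $$\mathbf E[\mathrm{Net\text{-}CCV}(T)]=\mathcal O\big(T^{1-\theta_1}\big)$$ (so for $\theta_1=1/2$ regret and violation are both $\mathcal O(\sqrt T)$). The constants in $\mathcal O(\cdot)$ depend only on $n,p,r,R,G_1,G_2,L,w,B,C,\alpha_0,\gamma_0,s_0,\theta_1,\theta_2$ and, in the last bound, on $\varsigma_s$. -/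

import Mathlib

open MeasureTheory ProbabilityTheory
open scoped Pointwise

namespace BanditCompressed

/-- `ℝ^p` with the Euclidean norm. -/
abbrev Vec (p : ℕ) := EuclideanSpace ℝ (Fin p)

/-- The uniform probability distribution on the Euclidean unit sphere of `ℝ^p`
(for `p ≥ 1`): normalized surface measure. -/
noncomputable def uniformSphere (p : ℕ) : Measure (Metric.sphere (0 : Vec p) 1) :=
  ((volume : Measure (Vec p)).toSphere Set.univ)⁻¹ • (volume : Measure (Vec p)).toSphere

/-- A Euclidean projection of `x` onto `K`: a point of `K` nearest to `x`
(it exists and is unique when `K` is nonempty, closed and convex). -/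
noncomputable def proj {p : ℕ} (K : Set (Vec p)) (x : Vec p) : Vec p :=
  Classical.epsilon fun y => y ∈ K ∧ ∀ y' ∈ K, ‖x - y‖ ≤ ‖x - y'‖

/-- `[v]_+`: the projection onto the nonnegative orthant, i.e. the componentwise positive part. -/
noncomputable def posPart {ι : Type} (v : EuclideanSpace ℝ ι) :
    EuclideanSpace ℝ ι :=
  WithLp.toLp 2 fun k => max (v k) 0

/-! ### The optimization problem -/

/-- The data of a distributed online problem with `n` agents in `ℝ^p`. The functions of iteration
`t ≥ 1` are `f i t` and `g i t`; they are regarded as functions on `dom` (their values elsewhere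
are irrelevant). -/
structure Problem (n p : ℕ) where
  /-- the decision set `𝕏` -/
  X : Set (Vec p)
  /-- the common domain of the loss and constraint functions -/
  dom : Set (Vec p)
  /-- the number of constraints of each agent -/
  m : Fin n → ℕ
  /-- local loss functions -/
  f : Fin n → ℕ → Vec p → ℝ
  /-- local constraint functions -/
  g : (i : Fin n) → ℕ → Vec p → EuclideanSpace ℝ (Fin (m i))

namespace Problem

variable {n p : ℕ}

/-- `𝕏` is closed, convex, and lies between two balls. -/
structure SetAssumption (P : Problem n p) (r R : ℝ) : Prop where
  isClosed : IsClosed P.X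
  convex : Convex ℝ P.X
  ball_subset : Metric.closedBall 0 r ⊆ P.X
  subset_ball : P.X ⊆ Metric.closedBall 0 R

/-- The functions live on a closed convex set containing `𝕏`, and the constraint functions
are convex. -/
structure DomainAssumption (P : Problem n p) : Prop where
  isClosed : IsClosed P.dom
  convex : Convex ℝ P.dom
  X_subset : P.X ⊆ P.dom
  g_convex : ∀ i t, 1 ≤ t → ∀ k, ConvexOn ℝ P.dom fun x => P.g i t x k

/-- The losses are differentiable with gradients bounded by `G₁`; the constraint functions have
at every point a matrix of (componentwise) subgradients of operator norm at most `G₂`. -/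
structure GradientAssumption (P : Problem n p) (G₁ G₂ : ℝ) : Prop where
  f_diff : ∀ i t, 1 ≤ t → DifferentiableOn ℝ (P.f i t) P.dom
  f_bound : ∀ i t, 1 ≤ t → ∀ x ∈ P.dom, ‖gradientWithin (P.f i t) P.dom x‖ ≤ G₁
  g_bound : ∀ i t, 1 ≤ t → ∀ x ∈ P.dom,
    ∃ J : Vec p →L[ℝ] EuclideanSpace ℝ (Fin (P.m i)),
      (∀ y ∈ P.dom, ∀ k, P.g i t x k + J (y - x) k ≤ P.g i t y k) ∧ ‖J‖ ≤ G₂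

/-- The gradients of the losses are `L`-Lipschitz. -/
def SmoothAssumption (P : Problem n p) (L : ℝ) : Prop :=
  ∀ i t, 1 ≤ t → ∀ x ∈ P.dom, ∀ y ∈ P.dom,
    ‖gradientWithin (P.f i t) P.dom x - gradientWithin (P.f i t) P.dom y‖ ≤ L * ‖x - y‖

/-- The global loss `f_t = (1/n) ∑_j f_{j,t}`. -/
noncomputable def globalLoss (P : Problem n p) (t : ℕ) (x : Vec p) : ℝ :=
  (1 / (n : ℝ)) * ∑ j, P.f j t x

/-- The global constraint function `g_t = col(g_{1,t}, …, g_{n,t})`. -/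
noncomputable def globalConstraint (P : Problem n p) (t : ℕ) (x : Vec p) :
    EuclideanSpace ℝ (Σ i : Fin n, Fin (P.m i)) :=
  WithLp.toLp 2 fun k => P.g k.1 t x k.2

/-- The feasible set `𝒳_T`. -/
def feasible (P : Problem n p) (T : ℕ) : Set (Vec p) :=
  {x | x ∈ P.X ∧ ∀ t ∈ Finset.Icc 1 T, ∀ k, P.globalConstraint t x k ≤ 0}

/-- Slater's condition with margin `ς`. -/
def Slater (P : Problem n p) (ς : ℝ) : Prop :=
  ∃ xs ∈ P.X, ∀ t, 1 ≤ t → ∀ k, P.globalConstraint t xs k ≤ -ς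

/-- Network regret of the decisions `x i t`. -/
noncomputable def netReg (P : Problem n p) (T : ℕ) (x : Fin n → ℕ → Vec p) : ℝ :=
  (1 / (n : ℝ)) * ∑ i,
    ((∑ t ∈ Finset.Icc 1 T, inner ℝ (gradientWithin (P.globalLoss t) P.dom (x i t)) (x i t))
      - sInf ((fun y => inner ℝ
          (∑ t ∈ Finset.Icc 1 T, gradientWithin (P.globalLoss t) P.dom (x i t)) y) ''
            P.feasible T))

/-- Network cumulative constraint violation of the decisions `x i t`. -/
noncomputable def netCCV (P : Problem n p) (T : ℕ) (x : Fin n → ℕ → Vec p) : ℝ :=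
  (1 / (n : ℝ)) * ∑ i, ∑ t ∈ Finset.Icc 1 T, ‖posPart (P.globalConstraint t (x i t))‖

end Problem

/-! ### The network -/

/-- The assumption on the time-varying digraphs (`E t j i` says that `(j, i)` is an edge at
iteration `t`) and on their mixing matrices. -/
structure NetworkAssumption {n : ℕ} (E : ℕ → Fin n → Fin n → Prop)
    (W : ℕ → Matrix (Fin n) (Fin n) ℝ) (w : ℝ) (B : ℕ) : Prop where
  weight_ge : ∀ t, 1 ≤ t → ∀ i j, (E t j i ∨ i = j) → w ≤ W t i j
  weight_zero : ∀ t, 1 ≤ t → ∀ i j, ¬(E t j i ∨ i = j) → W t i j = 0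
  row_sum : ∀ t, 1 ≤ t → ∀ i, ∑ j, W t i j = 1
  col_sum : ∀ t, 1 ≤ t → ∀ j, ∑ i, W t i j = 1
  strongly_connected : ∀ t, 1 ≤ t → ∀ a b,
    Relation.ReflTransGen (fun a b => ∃ l < B, E (t + l) a b) a b

/-! ### The algorithm -/

/-- The parameter sequences of the algorithm, used at indices `t ≥ 1`. -/
structure Schedule where
  /-- stepsize -/
  α : ℕ → ℝ
  /-- regularization parameter -/
  γ : ℕ → ℝ
  /-- shrinkage coefficient -/
  ξ : ℕ → ℝ
  /-- exploration parameter -/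
  δ : ℕ → ℝ
  /-- scaling parameter of the compression -/
  s : ℕ → ℝ

/-- `α_t = α₀ / t^θ₁`, `γ_t = γ₀ / α_t`, `ξ_t = α_t`, `δ_t = r α_t`, `s_t = s₀ / t^θ₂`. -/
noncomputable def powerSchedule (r α₀ γ₀ s₀ θ₁ θ₂ : ℝ) : Schedule where
  α t := α₀ / (t : ℝ) ^ θ₁
  γ t := γ₀ / (α₀ / (t : ℝ) ^ θ₁)
  ξ t := α₀ / (t : ℝ) ^ θ₁
  δ t := r * (α₀ / (t : ℝ) ^ θ₁)
  s t := s₀ / (t : ℝ) ^ θ₂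

/-- The two-point gradient estimator of a scalar function. -/
noncomputable def twoPointGrad {p : ℕ} (δ : ℝ) (φ : Vec p → ℝ) (x u : Vec p) : Vec p :=
  ((p : ℝ) / δ * (φ (x + δ • u) - φ x)) • u

/-- The two-point estimator `(p/δ) (ψ(x + δ u) - ψ(x))ᵀ ⊗ u`, a `p × m` matrix. -/
noncomputable def twoPointJac {p m : ℕ} (δ : ℝ) (ψ : Vec p → EuclideanSpace ℝ (Fin m))
    (x u : Vec p) : Matrix (Fin p) (Fin m) ℝ :=
  Matrix.of fun a k => (p : ℝ) / δ * (ψ (x + δ • u) k - ψ x k) * u a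

/-- The internal state at the beginning of an iteration `t`: all `z_{i,t}` and `ẑ_{i,t-1}`. -/
structure AlgState (n p : ℕ) where
  /-- the variables `z_{i,t}` -/
  z : Fin n → Vec p
  /-- the variables `ẑ_{i,t-1}` -/
  zhat : Fin n → Vec p

/-- One execution environment of the algorithm: the problem, the network, the random compressor
(`compress a` is the compressor for the value `a` of its internal randomness, which has law `ν`),
the random draws on `Ω`, and the initial points. -/
structure Model (n p : ℕ) (Ω Ξ : Type*) [MeasurableSpace Ξ] extends Problem n p where
  /-- the edge relation at iteration `t` -/
  E : ℕ → Fin n → Fin n → Prop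
  /-- the mixing matrices -/
  W : ℕ → Matrix (Fin n) (Fin n) ℝ
  /-- the domain of the compressor -/
  Y : Set (Vec p)
  /-- the compressor, depending on its internal randomness -/
  compress : Ξ → Vec p → Vec p
  /-- the law of the internal randomness -/
  ν : Measure Ξ
  /-- the internal randomness used by agent `i` at iteration `t` -/
  c : Fin n → ℕ → Ω → Ξ
  /-- the perturbation direction of agent `i` at iteration `t` -/
  u : Fin n → ℕ → Ω → Metric.sphere (0 : Vec p) 1
  /-- the initial points `z_{i,1}` -/
  z₁ : Fin n → Vec p

namespace Model

variable {n p : ℕ} {Ω Ξ : Type*} [MeasurableSpace Ξ]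

/-- The input `(z_{j,t} - ẑ_{j,t-1}) / s_t` of the compressor in state `q`. -/
noncomputable def compInput (S : Schedule) (t : ℕ) (q : AlgState n p) (j : Fin n) : Vec p :=
  (S.s t)⁻¹ • (q.z j - q.zhat j)

/-- `ẑ_{j,t}`, computed at iteration `t` from the state `q`. -/
noncomputable def newZhat (M : Model n p Ω Ξ) (S : Schedule) (ω : Ω) (t : ℕ) (q : AlgState n p)
    (j : Fin n) : Vec p :=
  q.zhat j + S.s t • M.compress (M.c j t ω) (compInput S t q j)

/-- `x_{i,t}`, computed at iteration `t` from the state `q`. -/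
noncomputable def newX (M : Model n p Ω Ξ) (S : Schedule) (ω : Ω) (t : ℕ) (q : AlgState n p)
    (i : Fin n) : Vec p :=
  ∑ j, M.W t i j • M.newZhat S ω t q j

/-- The dual variable `v_{i,t+1}` for the decision `x`. -/
noncomputable def dual (M : Model n p Ω Ξ) (S : Schedule) (t : ℕ) (i : Fin n) (x : Vec p) :
    EuclideanSpace ℝ (Fin (M.m i)) :=
  S.γ t • posPart (M.g i t x)

/-- The update direction `b_{i,t+1}` for the decision `x`. -/
noncomputable def direction (M : Model n p Ω Ξ) (S : Schedule) (ω : Ω) (t : ℕ) (i : Fin n)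
    (x : Vec p) : Vec p :=
  twoPointGrad (S.δ t) (M.f i t) x (M.u i t ω)
    + WithLp.toLp 2
        ((twoPointJac (S.δ t) (M.g i t) x (M.u i t ω)).mulVec fun k => M.dual S t i x k)

/-- One iteration `t` of the algorithm, applied to the state `q`. -/
noncomputable def step (M : Model n p Ω Ξ) (S : Schedule) (ω : Ω) (t : ℕ) (q : AlgState n p) :
    AlgState n p where
  z i := proj ((1 - S.ξ (t + 1)) • M.X)
    (M.newX S ω t q i - S.α t • M.direction S ω t i (M.newX S ω t q i))
  zhat j := M.newZhat S ω t q j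

/-- The state at the beginning of iteration `k + 1`. -/
noncomputable def stateAux (M : Model n p Ω Ξ) (S : Schedule) (ω : Ω) : ℕ → AlgState n p
  | 0 => ⟨M.z₁, fun _ => 0⟩
  | k + 1 => M.step S ω (k + 1) (M.stateAux S ω k)

/-- The state `(z_{·,t}, ẑ_{·,t-1})` at the beginning of iteration `t ≥ 1`. -/
noncomputable def state (M : Model n p Ω Ξ) (S : Schedule) (ω : Ω) (t : ℕ) : AlgState n p :=
  M.stateAux S ω (t - 1)

/-- The decision `x_{i,t}` produced by the algorithm, `t ≥ 1`. -/
noncomputable def x (M : Model n p Ω Ξ) (S : Schedule) (ω : Ω) (i : Fin n) (t : ℕ) : Vec p :=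
  M.newX S ω t (M.state S ω t) i

/-- The compressor has mean-square error at most `C` on its domain. -/
structure CompressorAssumption (M : Model n p Ω Ξ) (C : ℝ) : Prop where
  prob : IsProbabilityMeasure M.ν
  meas : Measurable (Function.uncurry M.compress)
  error : ∀ y ∈ M.Y, Integrable (fun a => ‖M.compress a y - y‖ ^ 2) M.ν ∧
    ∫ a, ‖M.compress a y - y‖ ^ 2 ∂M.ν ≤ C

/-- The internal randomness of the compressor and the uniform directions, over all agents and
iterations, are mutually independent. -/
structure SamplingAssumption [MeasurableSpace Ω] (M : Model n p Ω Ξ) (μ : Measure Ω) : Prop where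
  meas_c : ∀ i t, Measurable (M.c i t)
  meas_u : ∀ i t, Measurable (M.u i t)
  law : ∀ i t, 1 ≤ t →
    μ.map (fun ω => (M.c i t ω, M.u i t ω)) = M.ν.prod (uniformSphere p)
  indep : iIndepFun
    (fun (k : Fin n × ℕ) ω => (M.c k.1 (k.2 + 1) ω, M.u k.1 (k.2 + 1) ω)) μ

/-- The execution is well defined: almost surely, the compressor is only applied to points of its
domain and the functions are only queried at points of theirs. -/
def WellDefined [MeasurableSpace Ω] (M : Model n p Ω Ξ) (S : Schedule) (μ : Measure Ω) : Prop :=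
  ∀ᵐ ω ∂μ, ∀ i t, 1 ≤ t →
    compInput S t (M.state S ω t) i ∈ M.Y ∧
    M.x S ω i t ∈ M.dom ∧
    M.x S ω i t + S.δ t • (M.u i t ω : Vec p) ∈ M.dom

/-- The standing assumptions with their constants, for a run with the parameter
sequences `S`. -/
structure Admissible [MeasurableSpace Ω] (M : Model n p Ω Ξ) (S : Schedule) (μ : Measure Ω)
    (r R G₁ G₂ L w : ℝ) (B : ℕ) (C : ℝ) : Prop where
  set : M.SetAssumption r R
  domain : M.DomainAssumption
  gradient : M.GradientAssumption G₁ G₂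
  smooth : M.SmoothAssumption L
  network : NetworkAssumption M.E M.W w B
  compressor : M.CompressorAssumption C
  sampling : M.SamplingAssumption μ
  feasible : ∀ T, 1 ≤ T → (M.feasible T).Nonempty
  init : ∀ i, M.z₁ i ∈ (1 - S.ξ 1) • M.X
  wellDefined : M.WellDefined S μ

end Model

end BanditCompressed

/-!
# Regret and violation of compressed distributed bandit optimization

The algorithm is a distributed projected subgradient method on the Lagrangians
`f_{i,t} + ⟨v, g_{i,t}⟩`, where the multiplier is `v = γ_t [g_{i,t}(x_{i,t})]_+`. Pairing `v` with
the constraint turns the violation into a *quadratic penalty*, and since `α_t γ_t = γ₀` this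
penalty enters the one-step analysis with the fixed weight `γ₀`. The smallness of
`γ₀ (p² + 1) G₂²` makes it dominate every other term that is quadratic in the violation: the
squared norm of the update direction, and the variance of the two-point estimators.

*Two-point estimators.* For a smooth loss the estimator is a gradient up to a bias of order `δ_t`
(`abs_integral_two_point_smooth_sub_le`). For the convex constraints, which need not be
differentiable, it behaves in expectation like a subgradient (`integral_two_point_convex_le`):
averaging `u` with its reflection in the hyperplane orthogonal to the direction of interest leaves
slopes along that direction, and these are bounded by convexity. No smoothed function on a larger
domain is needed, which matters because the functions are only queried inside `dom`.

*Drift.* `one_step` and `TunedRun.drift` bound the change of the squared distance to the shrunken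
comparator `(1 - α_t) y` by the linearized regret, the penalty, the noise of the estimators and
the compression errors. The compressor works at scale `s_t`, hence has error of order `s_t`
regardless of its input; its cost is of order `∑ s_t` for the violation and `∑ s_t / α_t` for the
regret. The direction `u_{i,t}` is independent of everything `x_{i,t}` depends on
(`indep_u`, `integral_inner_noise`), so the noise is centred.

*Violation.* Summing the expected drift with a feasible comparator bounds the expected squared
violations by a multiple of `T ^ (1 - θ₁)`, and the violations by `T ^ (1 - θ₁ / 2)` through Young's
inequality. A Slater point leaves in addition a term linear in the violation, so the violations
themselves are bounded by a multiple of `T ^ (1 - θ₁)`.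

*Regret.* The comparator that attains the infimum in the regret depends on the outcome, so the
noise may not be averaged against a fixed comparator. Instead the drift is divided by `2 α_t` and
summed by parts pathwise, and the noise is collected in the vectors
`noiseSum j T = ∑ (1 - α_t) N_{j,t}`, which meet the comparator only through
`⟨noiseSum j T, y⟩ ≤ 4 R² / α_T + α_T ‖noiseSum j T‖² / 16`. By orthogonality of the noise
over time, the expected square is the sum of the variances, and the penalty absorbs the part of the
variances that grows with `γ_t` (`integral_noiseBracket_le`). The resulting bound
`regretMajorant` does not depend on the comparator.

*Network.* The products of the mixing matrices over windows of `n B` iterations have entries at least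
`w ^ (n B)`, so the disagreement contracts over such windows up to the perturbations by gradient
steps and compression errors (`sum_spread_le`). This transfers local bounds to the global loss
(`inner_globalLoss_le`) and the global constraints (`violation_x_le`).
-/

namespace BanditCompressed

variable {p : ℕ}

/-! ### The uniform distribution on the sphere -/

theorem isProbabilityMeasure_uniformSphere (hp : 1 ≤ p) :
    IsProbabilityMeasure (uniformSphere p) := by
  have : Nonempty (Fin p) := ⟨⟨0, hp⟩⟩
  refine ⟨?_⟩
  rw [uniformSphere, Measure.smul_apply, smul_eq_mul]
  refine ENNReal.inv_mul_cancel ?_ (measure_ne_top _ _)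
  rw [Measure.measure_univ_ne_zero]
  exact Measure.toSphere_ne_zero _

/-- The self-map of the unit sphere induced by a linear isometry. -/
noncomputable def sphereMap (A : Vec p ≃ₗᵢ[ℝ] Vec p) (u : Metric.sphere (0 : Vec p) 1) :
    Metric.sphere (0 : Vec p) 1 :=
  ⟨A u, by simp⟩

theorem measurable_sphereMap (A : Vec p ≃ₗᵢ[ℝ] Vec p) : Measurable (sphereMap A) :=
  (Continuous.subtype_mk (A.continuous.comp continuous_subtype_val) _).measurable

theorem measurePreserving_sphereMap (A : Vec p ≃ₗᵢ[ℝ] Vec p) :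
    MeasurePreserving (sphereMap A) (uniformSphere p) (uniformSphere p) := by
  refine MeasurePreserving.smul_measure ⟨measurable_sphereMap A, ?_⟩ _
  ext s hs
  rw [Measure.map_apply (measurable_sphereMap A) hs,
    Measure.toSphere_apply' _ (measurable_sphereMap A hs), Measure.toSphere_apply' _ hs]
  congr 1
  have h1 : ((↑) '' (sphereMap A ⁻¹' s) : Set (Vec p)) = A ⁻¹' ((↑) '' s) := by
    ext x
    constructor
    · rintro ⟨u, hu, rfl⟩
      exact ⟨_, hu, rfl⟩
    · rintro ⟨v, hv, hvx⟩
      have hx : ‖x‖ = 1 := by rw [← A.norm_map, ← hvx]; simp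
      refine ⟨⟨x, by simpa using hx⟩, ?_, rfl⟩
      have : sphereMap A ⟨x, by simpa using hx⟩ = v := Subtype.ext hvx.symm
      rwa [Set.mem_preimage, this]
  have h2 : Set.Ioo (0 : ℝ) 1 • (A ⁻¹' ((↑) '' s) : Set (Vec p))
      = A ⁻¹' (Set.Ioo (0 : ℝ) 1 • ((↑) '' s)) := by
    ext x
    simp only [Set.mem_smul, Set.mem_preimage]
    constructor
    · rintro ⟨a, ha, y, hy, rfl⟩
      exact ⟨a, ha, A y, hy, by simp⟩
    · rintro ⟨a, ha, y, hy, hx⟩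
      exact ⟨a, ha, A.symm y, by simpa using hy, A.injective (by simp [hx])⟩
  rw [h1, h2]
  exact A.measurePreserving.measure_preimage_equiv (f := A.toMeasurableEquiv) _

theorem integral_comp_sphereMap (A : Vec p ≃ₗᵢ[ℝ] Vec p)
    (F : Metric.sphere (0 : Vec p) 1 → ℝ) (hF : AEStronglyMeasurable F (uniformSphere p)) :
    ∫ u, F (sphereMap A u) ∂uniformSphere p = ∫ u, F u ∂uniformSphere p := by
  have h := measurePreserving_sphereMap A
  rw [← integral_map h.measurable.aemeasurable (by rwa [h.map_eq]), h.map_eq]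

theorem integrable_inner_mul_inner (hp : 1 ≤ p) (a b : Vec p) :
    Integrable (fun u : Metric.sphere (0 : Vec p) 1 => inner ℝ (u : Vec p) a * inner ℝ (u : Vec p) b)
      (uniformSphere p) := by
  have := isProbabilityMeasure_uniformSphere hp
  refine Integrable.of_bound (Continuous.aestronglyMeasurable (by fun_prop)) (‖a‖ * ‖b‖) ?_
  filter_upwards with u
  rw [norm_mul]
  have h (c : Vec p) : ‖inner ℝ (u : Vec p) c‖ ≤ ‖c‖ := by
    simpa using norm_inner_le_norm (𝕜 := ℝ) (u : Vec p) c
  gcongr <;> exact h _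

/-- All unit directions have the same second moment, because a reflection exchanges any two of
them; the moments along an orthonormal basis add up to `1`. -/
theorem integral_inner_sq (hp : 1 ≤ p) (e : Vec p) :
    ∫ u, inner ℝ (u : Vec p) e ^ 2 ∂uniformSphere p = ‖e‖ ^ 2 / p := by
  have := isProbabilityMeasure_uniformSphere hp
  have hmeas (a : Vec p) : AEStronglyMeasurable
      (fun u : Metric.sphere (0 : Vec p) 1 => inner ℝ (u : Vec p) a ^ 2) (uniformSphere p) :=
    Continuous.aestronglyMeasurable (by fun_prop)
  have key (a b : Vec p) (hab : ‖a‖ = ‖b‖) :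
      ∫ u, inner ℝ (u : Vec p) a ^ 2 ∂uniformSphere p
        = ∫ u, inner ℝ (u : Vec p) b ^ 2 ∂uniformSphere p := by
    let A : Vec p ≃ₗᵢ[ℝ] Vec p := Submodule.reflection (ℝ ∙ (a - b))ᗮ
    have hA : A a = b := Submodule.reflection_sub hab
    rw [← integral_comp_sphereMap A _ (hmeas b)]
    congr 1 with u
    rw [← hA]
    simp [sphereMap]
  let i₀ : Fin p := ⟨0, hp⟩
  let c (i : Fin p) : Vec p := EuclideanSpace.single i (1 : ℝ)
  have hsum : ∑ i, ∫ u, inner ℝ (u : Vec p) (c i) ^ 2 ∂uniformSphere p = 1 := by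
    rw [← integral_finsetSum]
    · have : ∀ u : Metric.sphere (0 : Vec p) 1, ∑ i, inner ℝ (u : Vec p) (c i) ^ 2 = 1 := by
        intro u
        have hu : ‖(u : Vec p)‖ ^ 2 = 1 := by simp
        rw [EuclideanSpace.norm_sq_eq] at hu
        refine Eq.trans ?_ hu
        exact Finset.sum_congr rfl fun i _ => by simp [c, EuclideanSpace.inner_single_right]
      simp [this]
    · intro i _
      simpa [sq] using integrable_inner_mul_inner hp (c i) (c i)
  have hc : ∀ i, ∫ u, inner ℝ (u : Vec p) (c i) ^ 2 ∂uniformSphere p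
      = ∫ u, inner ℝ (u : Vec p) (c i₀) ^ 2 ∂uniformSphere p := fun i => key _ _ (by simp [c])
  have hp' : (p : ℝ) ≠ 0 := by positivity
  have h0 : ∫ u, inner ℝ (u : Vec p) (c i₀) ^ 2 ∂uniformSphere p = 1 / p := by
    rw [Finset.sum_congr rfl fun i _ => hc i] at hsum
    simp only [Finset.sum_const, Finset.card_univ, Fintype.card_fin, nsmul_eq_mul] at hsum
    field_simp
    linarith
  have he : ‖e‖ = ‖‖e‖ • c i₀‖ := by simp [norm_smul, c]
  rw [key _ _ he]
  simp only [inner_smul_right, mul_pow]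
  rw [integral_const_mul, h0]
  ring

theorem integral_inner_mul_inner (hp : 1 ≤ p) (a b : Vec p) :
    ∫ u, inner ℝ (u : Vec p) a * inner ℝ (u : Vec p) b ∂uniformSphere p = inner ℝ a b / p := by
  have h : ∀ u : Metric.sphere (0 : Vec p) 1, inner ℝ (u : Vec p) a * inner ℝ (u : Vec p) b
      = 1 / 4 * (inner ℝ (u : Vec p) (a + b) ^ 2 - inner ℝ (u : Vec p) (a - b) ^ 2) := by
    intro u
    rw [inner_add_right, inner_sub_right]
    ring
  have hint (e : Vec p) : Integrable
      (fun u : Metric.sphere (0 : Vec p) 1 => inner ℝ (u : Vec p) e ^ 2) (uniformSphere p) := by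
    simpa [sq] using integrable_inner_mul_inner hp e e
  simp_rw [h]
  rw [integral_const_mul, integral_sub (hint _) (hint _), integral_inner_sq hp,
    integral_inner_sq hp, @norm_add_sq_real, @norm_sub_sq_real]
  ring

end BanditCompressed

namespace BanditCompressed

variable {p : ℕ}

/-! ### Bias of the two-point estimator -/

/-- `φ` has at every point of `D` a subgradient (relative to `D`) of norm at most `Λ`. -/
def HasBoundedSubgradients (φ : Vec p → ℝ) (D : Set (Vec p)) (Λ : ℝ) : Prop :=
  ∀ x ∈ D, ∃ J : Vec p, (∀ y ∈ D, φ x + inner ℝ J (y - x) ≤ φ y) ∧ ‖J‖ ≤ Λ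

theorem HasBoundedSubgradients.abs_sub_le {φ : Vec p → ℝ} {D : Set (Vec p)} {Λ : ℝ}
    (h : HasBoundedSubgradients φ D Λ) {x y : Vec p} (hx : x ∈ D) (hy : y ∈ D) :
    |φ x - φ y| ≤ Λ * ‖x - y‖ := by
  have key : ∀ x ∈ D, ∀ y ∈ D, φ x - φ y ≤ Λ * ‖x - y‖ := by
    intro x hx y hy
    obtain ⟨J, hJ, hJn⟩ := h x hx
    have h1 := hJ y hy
    have h2 : -inner ℝ J (y - x) ≤ ‖J‖ * ‖y - x‖ :=
      (neg_le_abs _).trans (abs_real_inner_le_norm _ _)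
    rw [norm_sub_rev] at h2
    nlinarith [mul_le_mul_of_nonneg_right hJn (norm_nonneg (x - y))]
  rw [abs_le]
  constructor
  · have := key y hy x hx
    rw [norm_sub_rev] at this
    linarith
  · exact key x hx y hy

theorem continuousOn_of_abs_sub_le {φ : Vec p → ℝ} {D : Set (Vec p)} {Λ : ℝ}
    (h : ∀ x ∈ D, ∀ y ∈ D, |φ x - φ y| ≤ Λ * ‖x - y‖) : ContinuousOn φ D := by
  refine LipschitzOnWith.continuousOn (K := Λ.toNNReal) (.of_dist_le_mul fun x hx y hy => ?_)
  rw [Real.dist_eq, dist_eq_norm]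
  exact (h x hx y hy).trans (mul_le_mul_of_nonneg_right (Real.le_coe_toNNReal _) (norm_nonneg _))

theorem HasBoundedSubgradients.continuousOn {φ : Vec p → ℝ} {D : Set (Vec p)} {Λ : ℝ}
    (h : HasBoundedSubgradients φ D Λ) : ContinuousOn φ D :=
  continuousOn_of_abs_sub_le fun _ hx _ hy => h.abs_sub_le hx hy

theorem stronglyMeasurable_indicator_of_continuousOn {E F : Type*} [TopologicalSpace E]
    [MeasurableSpace E] [BorelSpace E] [NormedAddCommGroup F] [SecondCountableTopology F]
    {φ : E → F} {D : Set E} (hD : IsClosed D) (hφ : ContinuousOn φ D) :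
    StronglyMeasurable (D.indicator φ) := by
  classical
  borelize F
  rw [← Set.piecewise_eq_indicator]
  exact (hφ.measurable_piecewise continuousOn_const hD.measurableSet).stronglyMeasurable

/-- A function that is continuous on a closed set, evaluated at a random point of that set. -/
theorem aestronglyMeasurable_comp_of_continuousOn {Ω E F : Type*} {m m₀ : MeasurableSpace Ω}
    {μ : Measure[m₀] Ω} [TopologicalSpace E] [TopologicalSpace.PseudoMetrizableSpace E]
    [MeasurableSpace E] [BorelSpace E] [NormedAddCommGroup F] [SecondCountableTopology F]
    {φ : E → F} {D : Set E}
    (hD : IsClosed D) (hφ : ContinuousOn φ D) {X : Ω → E} (hX : AEStronglyMeasurable[m] X μ)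
    (hXD : ∀ᵐ ω ∂μ, X ω ∈ D) : AEStronglyMeasurable[m] (fun ω => φ (X ω)) μ := by
  have hφ' := stronglyMeasurable_indicator_of_continuousOn hD hφ
  refine ⟨fun ω => D.indicator φ (hX.mk X ω),
    hφ'.comp_measurable hX.stronglyMeasurable_mk.measurable, ?_⟩
  filter_upwards [hX.ae_eq_mk, hXD] with ω h1 h2
  rw [← h1, Set.indicator_of_mem h2]

theorem aestronglyMeasurable_two_point {φ : Vec p → ℝ} {D : Set (Vec p)} (hD : IsClosed D)
    (hφ : ContinuousOn φ D) {x : Vec p} {δ : ℝ}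
    (hxD : ∀ᵐ u : Metric.sphere (0 : Vec p) 1 ∂uniformSphere p, x + δ • (u : Vec p) ∈ D) :
    AEStronglyMeasurable (fun u : Metric.sphere (0 : Vec p) 1 => φ (x + δ • (u : Vec p)))
      (uniformSphere p) :=
  aestronglyMeasurable_comp_of_continuousOn hD hφ
    (Continuous.aestronglyMeasurable (by fun_prop)) hxD

theorem integrable_two_point (hp : 1 ≤ p) {φ : Vec p → ℝ} {D : Set (Vec p)} {Λ : ℝ}
    (hD : IsClosed D) (hφ : ∀ x ∈ D, ∀ y ∈ D, |φ x - φ y| ≤ Λ * ‖x - y‖) {x : Vec p} (hx : x ∈ D)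
    {δ : ℝ} (hδ : 0 < δ)
    (hxD : ∀ᵐ u : Metric.sphere (0 : Vec p) 1 ∂uniformSphere p, x + δ • (u : Vec p) ∈ D)
    (h : Vec p) :
    Integrable (fun u : Metric.sphere (0 : Vec p) 1 =>
      p / δ * (φ (x + δ • (u : Vec p)) - φ x) * inner ℝ (u : Vec p) h) (uniformSphere p) := by
  have := isProbabilityMeasure_uniformSphere hp
  refine Integrable.of_bound (C := p / δ * (Λ * δ) * ‖h‖) ?_ ?_
  · refine AEStronglyMeasurable.mul ?_ (Continuous.aestronglyMeasurable (by fun_prop))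
    refine AEStronglyMeasurable.const_mul ?_ _
    exact (aestronglyMeasurable_two_point hD (continuousOn_of_abs_sub_le hφ) hxD).sub
      aestronglyMeasurable_const
  · filter_upwards [hxD] with u hu
    have h1 := hφ _ hu _ hx
    have h2 : ‖inner ℝ (u : Vec p) h‖ ≤ ‖h‖ := by
      simpa using norm_inner_le_norm (𝕜 := ℝ) (u : Vec p) h
    have h3 : ‖x + δ • (u : Vec p) - x‖ = δ := by simp [norm_smul, abs_of_pos hδ]
    rw [h3] at h1
    rw [norm_mul, norm_mul, Real.norm_of_nonneg (by positivity : (0 : ℝ) ≤ p / δ), Real.norm_eq_abs]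
    have : 0 ≤ Λ * δ := (abs_nonneg _).trans h1
    gcongr

/-- For a convex function no smoothing is needed: pairing `u` with its mirror image in the
hyperplane orthogonal to `h` turns the estimator into an average of slopes in the direction `h`,
and slopes near `x` lie below the slope from `x` to `x + h`, up to the Lipschitz error. -/
theorem integral_two_point_convex_le (hp : 1 ≤ p) {φ : Vec p → ℝ} {D : Set (Vec p)} {Λ : ℝ}
    (hD : IsClosed D) (hφ : HasBoundedSubgradients φ D Λ) {x h : Vec p} (hx : x ∈ D)
    (hxh : x + h ∈ D) {δ : ℝ} (hδ : 0 < δ)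
    (hxD : ∀ᵐ u : Metric.sphere (0 : Vec p) 1 ∂uniformSphere p, x + δ • (u : Vec p) ∈ D) :
    ∫ u : Metric.sphere (0 : Vec p) 1,
        p / δ * (φ (x + δ • (u : Vec p)) - φ x) * inner ℝ (u : Vec p) h ∂uniformSphere p
      ≤ φ (x + h) - φ x + 2 * Λ * δ := by
  have := isProbabilityMeasure_uniformSphere hp
  have hΛ : 0 ≤ Λ := by
    obtain ⟨J, -, hJ⟩ := hφ x hx
    exact (norm_nonneg J).trans hJ
  rcases eq_or_ne h 0 with rfl | hne
  · simp only [inner_zero_right, mul_zero, integral_zero, add_zero, sub_self, zero_add]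
    positivity
  have hh : 0 < ‖h‖ ^ 2 := by positivity
  set c : ℝ := φ (x + h) - φ x + 2 * Λ * δ with hc
  set F : Metric.sphere (0 : Vec p) 1 → ℝ := fun u =>
    p / δ * (φ (x + δ • (u : Vec p)) - φ x) * inner ℝ (u : Vec p) h with hF
  have hFi : Integrable F (uniformSphere p) :=
    integrable_two_point hp hD (fun _ h1 _ h2 => hφ.abs_sub_le h1 h2) hx hδ hxD h
  let A : Vec p ≃ₗᵢ[ℝ] Vec p := Submodule.reflection (ℝ ∙ h)ᗮ
  have hA (u : Vec p) : A u = u - (2 * inner ℝ u h / ‖h‖ ^ 2) • h := by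
    simp only [A]
    rw [Submodule.reflection_orthogonal_apply, Submodule.reflection_singleton_apply,
      real_inner_comm, neg_sub, two_smul, ← add_smul]
    congr 2
    simp
    ring
  have hAh (u : Vec p) : inner ℝ (A u) h = -inner ℝ u h := by
    rw [hA, inner_sub_left, inner_smul_left, real_inner_self_eq_norm_sq]
    simp
    field_simp
    ring
  have hslope : ∀ u : Metric.sphere (0 : Vec p) 1, x + δ • (u : Vec p) ∈ D →
      ∃ J : Vec p, (∀ y ∈ D, φ (x + δ • (u : Vec p)) + inner ℝ J (y - (x + δ • (u : Vec p))) ≤ φ y)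
        ∧ inner ℝ J h ≤ c := by
    intro u hu
    obtain ⟨J, hJ, hJn⟩ := hφ _ hu
    refine ⟨J, hJ, ?_⟩
    have h1 := hJ _ hxh
    have h2 := (abs_le.1 (hφ.abs_sub_le hu hx)).1
    have h3 : ‖x + δ • (u : Vec p) - x‖ = δ := by simp [norm_smul, abs_of_pos hδ]
    have h4 : inner ℝ J (δ • (u : Vec p)) ≤ Λ * δ := by
      refine (real_inner_le_norm _ _).trans ?_
      have : ‖δ • (u : Vec p)‖ = δ := by simp [norm_smul, abs_of_pos hδ]
      rw [this]
      gcongr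
    have h5 : x + h - (x + δ • (u : Vec p)) = h - δ • (u : Vec p) := by abel
    rw [h5, inner_sub_right] at h1
    rw [h3] at h2
    rw [hc]
    linarith
  have hxD' : ∀ᵐ u : Metric.sphere (0 : Vec p) 1 ∂uniformSphere p,
      x + δ • (sphereMap A u : Vec p) ∈ D :=
    (measurePreserving_sphereMap A).quasiMeasurePreserving.ae hxD
  have hpt : ∀ᵐ u ∂uniformSphere p, F u + F (sphereMap A u)
      ≤ 2 * p * c / ‖h‖ ^ 2 * inner ℝ (u : Vec p) h ^ 2 := by
    filter_upwards [hxD, hxD'] with u hu hu'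
    have hAu : ((sphereMap A u : Metric.sphere (0 : Vec p) 1) : Vec p) = A u := rfl
    set a := inner ℝ (u : Vec p) h with ha
    have hdiff : (x + δ • (u : Vec p)) - (x + δ • (sphereMap A u : Vec p))
        = (2 * δ * a / ‖h‖ ^ 2) • h := by
      rw [hAu, hA, ← ha, smul_sub, smul_smul]
      have : δ * (2 * a / ‖h‖ ^ 2) = 2 * δ * a / ‖h‖ ^ 2 := by ring
      rw [this]
      abel
    have hmain : (φ (x + δ • (u : Vec p)) - φ (x + δ • (sphereMap A u : Vec p))) * a
        ≤ 2 * δ * a ^ 2 / ‖h‖ ^ 2 * c := by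
      rcases le_total 0 a with h0 | h0
      · obtain ⟨J, hJ, hJc⟩ := hslope u hu
        have h1 := hJ _ hu'
        rw [← neg_sub, hdiff, inner_neg_right, inner_smul_right] at h1
        have h2 : 2 * δ * a / ‖h‖ ^ 2 * inner ℝ J h ≤ 2 * δ * a / ‖h‖ ^ 2 * c := by gcongr
        calc _ ≤ (2 * δ * a / ‖h‖ ^ 2 * c) * a := by gcongr; linarith
          _ = _ := by ring
      · obtain ⟨J, hJ, hJc⟩ := hslope _ hu'
        have h1 := hJ _ hu
        rw [hdiff, inner_smul_right] at h1
        have h2 : 2 * δ * (-a) / ‖h‖ ^ 2 * inner ℝ J h ≤ 2 * δ * (-a) / ‖h‖ ^ 2 * c := by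
          have : 0 ≤ -a := by linarith
          gcongr
        have h3 : 2 * δ * (-a) / ‖h‖ ^ 2 * inner ℝ J h = -(2 * δ * a / ‖h‖ ^ 2 * inner ℝ J h) := by
          ring
        calc _ = (φ (x + δ • (sphereMap A u : Vec p)) - φ (x + δ • (u : Vec p))) * (-a) := by ring
          _ ≤ (2 * δ * (-a) / ‖h‖ ^ 2 * c) * (-a) := by
            have : 0 ≤ -a := by linarith
            gcongr
            linarith
          _ = _ := by ring
    calc F u + F (sphereMap A u)
        = p / δ * ((φ (x + δ • (u : Vec p)) - φ (x + δ • (sphereMap A u : Vec p))) * a) := by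
          simp only [hF, hAu, hAh, ← ha]
          ring
      _ ≤ p / δ * (2 * δ * a ^ 2 / ‖h‖ ^ 2 * c) := by gcongr
      _ = _ := by field_simp
  have hFi' : Integrable (fun u => F (sphereMap A u)) (uniformSphere p) :=
    (measurePreserving_sphereMap A).integrable_comp_of_integrable hFi
  have hint : Integrable (fun u : Metric.sphere (0 : Vec p) 1 => inner ℝ (u : Vec p) h ^ 2)
      (uniformSphere p) := by
    simpa [sq] using integrable_inner_mul_inner hp h h
  have h2 := integral_mono_ae (hFi.add hFi') (hint.const_mul _) hpt
  simp only [Pi.add_apply] at h2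
  rw [integral_add hFi hFi', integral_comp_sphereMap A F hFi.aestronglyMeasurable,
    integral_const_mul, integral_inner_sq hp] at h2
  have h3 : 2 * p * c / ‖h‖ ^ 2 * (‖h‖ ^ 2 / p) = 2 * c := by
    have : (p : ℝ) ≠ 0 := by positivity
    field_simp
  linarith

/-- First-order Taylor bound on a convex set for a function with `L`-Lipschitz gradient. -/
theorem abs_sub_sub_inner_gradientWithin_le {f : Vec p → ℝ} {D : Set (Vec p)} (hD : Convex ℝ D)
    (hf : DifferentiableOn ℝ f D) {L : ℝ}
    (hL : ∀ x ∈ D, ∀ y ∈ D, ‖gradientWithin f D x - gradientWithin f D y‖ ≤ L * ‖x - y‖)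
    {x y : Vec p} (hx : x ∈ D) (hy : y ∈ D) :
    |f y - f x - inner ℝ (gradientWithin f D x) (y - x)| ≤ L * ‖y - x‖ ^ 2 := by
  have hseg : segment ℝ x y ⊆ D := hD.segment_subset hx hy
  have h := (convex_segment x y).norm_image_sub_le_of_norm_hasFDerivWithin_le' (f := f)
    (f' := fun z => InnerProductSpace.toDual ℝ (Vec p) (gradientWithin f D z))
    (φ := InnerProductSpace.toDual ℝ (Vec p) (gradientWithin f D x)) (C := L * ‖y - x‖)
    (fun z hz => ((hf z (hseg hz)).hasGradientWithinAt.hasFDerivWithinAt).mono hseg)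
    (fun z hz => ?_) (left_mem_segment ℝ x y) (right_mem_segment ℝ x y)
  · rw [Real.norm_eq_abs, InnerProductSpace.toDual_apply_apply] at h
    rw [sq, ← mul_assoc]
    exact h
  · rw [← map_sub, LinearIsometryEquiv.norm_map]
    refine (hL z (hseg hz) x hx).trans ?_
    rcases (norm_nonneg (z - x)).eq_or_lt' with h0 | hpos
    · rcases (norm_nonneg (y - x)).eq_or_lt' with h1 | hpos'
      · rw [h0, h1]
      · have : 0 ≤ L := by
          have := (norm_nonneg _).trans (hL y hy x hx)
          exact nonneg_of_mul_nonneg_left this hpos'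
        rw [h0]; simp; positivity
    · have : 0 ≤ L := by
        have := (norm_nonneg _).trans (hL z (hseg hz) x hx)
        exact nonneg_of_mul_nonneg_left this hpos
      gcongr
      exact norm_sub_le_of_mem_segment hz

theorem abs_sub_le_of_norm_gradientWithin_le {f : Vec p → ℝ} {D : Set (Vec p)} (hD : Convex ℝ D)
    (hf : DifferentiableOn ℝ f D) {G : ℝ} (hG : ∀ x ∈ D, ‖gradientWithin f D x‖ ≤ G) :
    ∀ x ∈ D, ∀ y ∈ D, |f x - f y| ≤ G * ‖x - y‖ := by
  intro x hx y hy
  refine hD.norm_image_sub_le_of_norm_hasFDerivWithin_le (f := f)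
    (f' := fun z => InnerProductSpace.toDual ℝ (Vec p) (gradientWithin f D z))
    (fun z hz => (hf z hz).hasGradientWithinAt.hasFDerivWithinAt) (fun z hz => ?_) hy hx
  rw [LinearIsometryEquiv.norm_map]
  exact hG z hz

/-- For a smooth function the two-point estimator is unbiased up to order `δ`: it is exact on the
linear part of the Taylor expansion, by `integral_inner_mul_inner`. -/
theorem abs_integral_two_point_smooth_sub_le (hp : 1 ≤ p) {f : Vec p → ℝ} {D : Set (Vec p)}
    (hDc : IsClosed D) (hD : Convex ℝ D) (hf : DifferentiableOn ℝ f D) {G L : ℝ}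
    (hG : ∀ x ∈ D, ‖gradientWithin f D x‖ ≤ G)
    (hL : ∀ x ∈ D, ∀ y ∈ D, ‖gradientWithin f D x - gradientWithin f D y‖ ≤ L * ‖x - y‖)
    {x h : Vec p} (hx : x ∈ D) {δ : ℝ} (hδ : 0 < δ)
    (hxD : ∀ᵐ u : Metric.sphere (0 : Vec p) 1 ∂uniformSphere p, x + δ • (u : Vec p) ∈ D) :
    |∫ u : Metric.sphere (0 : Vec p) 1,
        p / δ * (f (x + δ • (u : Vec p)) - f x) * inner ℝ (u : Vec p) h ∂uniformSphere p
      - inner ℝ (gradientWithin f D x) h| ≤ p * L * δ * ‖h‖ := by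
  have := isProbabilityMeasure_uniformSphere hp
  have hp0 : (p : ℝ) ≠ 0 := by positivity
  have hI := integrable_two_point hp hDc (abs_sub_le_of_norm_gradientWithin_le hD hf hG) hx hδ hxD h
  have hI2 := (integrable_inner_mul_inner hp (gradientWithin f D x) h).const_mul (p : ℝ)
  have heq : inner ℝ (gradientWithin f D x) h = ∫ u : Metric.sphere (0 : Vec p) 1,
      p * (inner ℝ (u : Vec p) (gradientWithin f D x) * inner ℝ (u : Vec p) h)
        ∂uniformSphere p := by
    rw [integral_const_mul, integral_inner_mul_inner hp]
    field_simp
  rw [heq, ← integral_sub hI hI2, ← Real.norm_eq_abs]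
  refine (norm_integral_le_of_norm_le_const (C := p * L * δ * ‖h‖) ?_).trans (by simp)
  filter_upwards [hxD] with u hu
  have h1 := abs_sub_sub_inner_gradientWithin_le hD hf hL hx hu
  have h3 : x + δ • (u : Vec p) - x = δ • (u : Vec p) := by abel
  have h4 : ‖δ • (u : Vec p)‖ = δ := by simp [norm_smul, abs_of_pos hδ]
  rw [h3, h4, inner_smul_right, real_inner_comm] at h1
  have h2 : ‖inner ℝ (u : Vec p) h‖ ≤ ‖h‖ := by
    simpa using norm_inner_le_norm (𝕜 := ℝ) (u : Vec p) h
  have h5 : p / δ * (f (x + δ • (u : Vec p)) - f x) * inner ℝ (u : Vec p) h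
      - p * (inner ℝ (u : Vec p) (gradientWithin f D x) * inner ℝ (u : Vec p) h)
      = p / δ * (f (x + δ • (u : Vec p)) - f x
        - δ * inner ℝ (u : Vec p) (gradientWithin f D x)) * inner ℝ (u : Vec p) h := by
    field_simp
  rw [h5, norm_mul, norm_mul, Real.norm_of_nonneg (by positivity : (0 : ℝ) ≤ p / δ),
    Real.norm_eq_abs]
  have h6 : 0 ≤ L * δ ^ 2 := (abs_nonneg _).trans h1
  calc _ ≤ p / δ * (L * δ ^ 2) * ‖h‖ := by gcongr
    _ = _ := by field_simp

end BanditCompressed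

namespace BanditCompressed

/-! ### Mixing of the network -/

section Spread

variable {n : ℕ} {V : Type*} [NormedAddCommGroup V]

/-- The diameter of a finite family of vectors, which measures its disagreement. -/
noncomputable def spread (z : Fin n → V) : ℝ := Metric.diam (Set.range z)

theorem spread_nonneg (z : Fin n → V) : 0 ≤ spread z := Metric.diam_nonneg

theorem norm_sub_le_spread (z : Fin n → V) (i j : Fin n) : ‖z i - z j‖ ≤ spread z := by
  rw [← dist_eq_norm]
  exact Metric.dist_le_diam_of_mem (Set.finite_range z).isBounded ⟨i, rfl⟩ ⟨j, rfl⟩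

theorem spread_le {z : Fin n → V} {d : ℝ} (hd : 0 ≤ d) (h : ∀ i j, ‖z i - z j‖ ≤ d) :
    spread z ≤ d := by
  refine Metric.diam_le_of_forall_dist_le hd ?_
  rintro _ ⟨i, rfl⟩ _ ⟨j, rfl⟩
  rw [dist_eq_norm]
  exact h i j

theorem spread_add_le (z y : Fin n → V) : spread (fun i => z i + y i) ≤ spread z + spread y := by
  refine spread_le (add_nonneg (spread_nonneg _) (spread_nonneg _)) fun i j => ?_
  rw [add_sub_add_comm]
  exact (norm_add_le _ _).trans (add_le_add (norm_sub_le_spread _ _ _) (norm_sub_le_spread _ _ _))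

theorem spread_le_two_mul_sum (y : Fin n → V) : spread y ≤ 2 * ∑ i, ‖y i‖ := by
  refine spread_le (by positivity) fun i j => ?_
  have h (k : Fin n) : ‖y k‖ ≤ ∑ i, ‖y i‖ :=
    Finset.single_le_sum (f := fun i => ‖y i‖) (fun _ _ => norm_nonneg _) (Finset.mem_univ k)
  have := norm_sub_le (y i) (y j)
  linarith [h i, h j]

variable [NormedSpace ℝ V]

/-- Averaging with weights at least `η` contracts the spread by the factor `1 - n η`. -/
theorem spread_sum_smul_le {A : Matrix (Fin n) (Fin n) ℝ} {η : ℝ} (hA : ∀ i j, η ≤ A i j)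
    (hrow : ∀ i, ∑ j, A i j = 1) (z : Fin n → V) :
    spread (fun i => ∑ j, A i j • z j) ≤ (1 - n * η) * spread z := by
  rcases isEmpty_or_nonempty (Fin n) with hemp | ⟨⟨i₀⟩⟩
  · have : n = 0 := by
      by_contra h
      exact hemp.elim ⟨0, Nat.pos_of_ne_zero h⟩
    subst this
    simp [spread]
  set m : ℝ := 1 - n * η with hm
  have hsum : ∀ i, ∑ j, (A i j - η) = m := fun i => by
    rw [Finset.sum_sub_distrib, hrow]
    simp [hm]
  have hm0 : 0 ≤ m := by
    rw [← hsum i₀]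
    exact Finset.sum_nonneg fun j _ => sub_nonneg.2 (hA _ _)
  refine spread_le (mul_nonneg hm0 (spread_nonneg _)) fun i j => ?_
  have h1 : ∑ k, A i k • z k - ∑ k, A j k • z k
      = ∑ k, (A i k - η) • z k - ∑ k, (A j k - η) • z k := by
    simp only [sub_smul, Finset.sum_sub_distrib]
    abel
  have h2 : m • (∑ k, (A i k - η) • z k - ∑ k, (A j k - η) • z k)
      = ∑ k, ∑ l, ((A i k - η) * (A j l - η)) • (z k - z l) := by
    simp only [smul_sub, Finset.sum_sub_distrib]
    congr 1
    · rw [Finset.smul_sum]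
      refine Finset.sum_congr rfl fun k _ => ?_
      rw [← Finset.sum_smul, ← Finset.mul_sum, hsum j, smul_smul, mul_comm]
    · rw [Finset.sum_comm, Finset.smul_sum]
      refine Finset.sum_congr rfl fun k _ => ?_
      rw [← Finset.sum_smul, ← Finset.sum_mul, hsum i, smul_smul]
  have h3 : m * ‖∑ k, A i k • z k - ∑ k, A j k • z k‖ ≤ m * (m * spread z) := by
    calc m * ‖∑ k, A i k • z k - ∑ k, A j k • z k‖
        = ‖∑ k, ∑ l, ((A i k - η) * (A j l - η)) • (z k - z l)‖ := by
          rw [← h2, ← h1, norm_smul, Real.norm_of_nonneg hm0]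
      _ ≤ ∑ k, ∑ l, (A i k - η) * (A j l - η) * spread z := by
          refine (norm_sum_le _ _).trans (Finset.sum_le_sum fun k _ => ?_)
          refine (norm_sum_le _ _).trans (Finset.sum_le_sum fun l _ => ?_)
          have h4 : 0 ≤ (A i k - η) * (A j l - η) :=
            mul_nonneg (sub_nonneg.2 (hA _ _)) (sub_nonneg.2 (hA _ _))
          rw [norm_smul, Real.norm_of_nonneg h4]
          exact mul_le_mul_of_nonneg_left (norm_sub_le_spread _ _ _) h4
      _ = m * (m * spread z) := by
          simp only [← Finset.sum_mul, ← Finset.mul_sum, hsum]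
          ring
  rcases hm0.eq_or_lt' with h0 | hpos
  · have hz (i : Fin n) (k : Fin n) : A i k - η = 0 := by
      have := hsum i
      rw [h0, Finset.sum_eq_zero_iff_of_nonneg fun j _ => sub_nonneg.2 (hA _ _)] at this
      exact this k (Finset.mem_univ k)
    rw [h1]
    simp [hz, h0]
  · exact le_of_mul_le_mul_left h3 hpos

end Spread

section Transition

variable {n : ℕ}

/-- The product `W_{t+k-1} ⋯ W_{t+1} W_t` of `k` consecutive mixing matrices. -/
noncomputable def transition (W : ℕ → Matrix (Fin n) (Fin n) ℝ) (t : ℕ) :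
    ℕ → Matrix (Fin n) (Fin n) ℝ
  | 0 => 1
  | k + 1 => W (t + k) * transition W t k

variable {E : ℕ → Fin n → Fin n → Prop} {W : ℕ → Matrix (Fin n) (Fin n) ℝ} {w : ℝ} {B : ℕ}

theorem NetworkAssumption.weight_nonneg (h : NetworkAssumption E W w B) (hw : 0 < w) {t : ℕ}
    (ht : 1 ≤ t) (i j : Fin n) : 0 ≤ W t i j := by
  by_cases hE : E t j i ∨ i = j
  · exact hw.le.trans (h.weight_ge t ht i j hE)
  · exact (h.weight_zero t ht i j hE).ge

theorem NetworkAssumption.transition_nonneg (h : NetworkAssumption E W w B) (hw : 0 < w) {t : ℕ}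
    (ht : 1 ≤ t) (k : ℕ) (i j : Fin n) : 0 ≤ transition W t k i j := by
  induction k generalizing i with
  | zero => rw [transition, Matrix.one_apply]; split_ifs <;> simp
  | succ k ih =>
    rw [transition, Matrix.mul_apply]
    exact Finset.sum_nonneg fun l _ => mul_nonneg (h.weight_nonneg hw (by omega) _ _) (ih l)

theorem NetworkAssumption.transition_row_sum (h : NetworkAssumption E W w B) {t : ℕ}
    (ht : 1 ≤ t) (k : ℕ) (i : Fin n) : ∑ j, transition W t k i j = 1 := by
  induction k generalizing i with
  | zero => simp [transition, Matrix.one_apply]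
  | succ k ih =>
    simp only [transition, Matrix.mul_apply]
    rw [Finset.sum_comm]
    simp only [← Finset.mul_sum, ih, mul_one]
    exact h.row_sum _ (by omega) i

theorem NetworkAssumption.mul_transition_le (h : NetworkAssumption E W w B) (hw : 0 < w) {t : ℕ}
    (ht : 1 ≤ t) (k : ℕ) {i l : Fin n} (j : Fin n) (hE : E (t + k) l i ∨ i = l) :
    w * transition W t k l j ≤ transition W t (k + 1) i j := by
  rw [transition, Matrix.mul_apply]
  calc w * transition W t k l j ≤ W (t + k) i l * transition W t k l j :=
        mul_le_mul_of_nonneg_right (h.weight_ge _ (by omega) _ _ hE) (h.transition_nonneg hw ht _ _ _)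
    _ ≤ _ := Finset.single_le_sum (f := fun l => W (t + k) i l * transition W t k l j)
        (fun l _ => mul_nonneg (h.weight_nonneg hw (by omega) _ _)
          (h.transition_nonneg hw ht _ _ _)) (Finset.mem_univ l)

/-- The agents that, `k` iterations after `t`, weigh the value of agent `j` by at least `w ^ k`. -/
def influenced (W : ℕ → Matrix (Fin n) (Fin n) ℝ) (w : ℝ) (t : ℕ) (j : Fin n) (k : ℕ) :
    Set (Fin n) :=
  {i | w ^ k ≤ transition W t k i j}

theorem NetworkAssumption.mem_influenced_succ (h : NetworkAssumption E W w B) (hw : 0 < w) {t : ℕ}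
    (ht : 1 ≤ t) {k : ℕ} {i l j : Fin n} (hE : E (t + k) l i ∨ i = l)
    (hl : l ∈ influenced W w t j k) : i ∈ influenced W w t j (k + 1) := by
  refine le_trans ?_ (h.mul_transition_le hw ht k j hE)
  rw [pow_succ']
  exact mul_le_mul_of_nonneg_left hl hw.le

theorem NetworkAssumption.influenced_mono (h : NetworkAssumption E W w B) (hw : 0 < w) {t : ℕ}
    (ht : 1 ≤ t) (j : Fin n) : Monotone (influenced W w t j) :=
  monotone_nat_of_le_succ fun _ _ hi => h.mem_influenced_succ hw ht (.inr rfl) hi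

/-- Each window of `B` iterations adds an agent to the influenced set until it is everything,
because an edge of the strongly connected union graph leaves the set. -/
theorem NetworkAssumption.le_ncard_influenced (h : NetworkAssumption E W w B) (hw : 0 < w) {t : ℕ}
    (ht : 1 ≤ t) (j : Fin n) (m : ℕ) (hm : m < n) :
    m + 1 ≤ (influenced W w t j (m * B)).ncard := by
  have hj : ∀ k, j ∈ influenced W w t j k := by
    intro k
    refine h.influenced_mono hw ht j (Nat.zero_le k) ?_
    simp [influenced, transition]
  induction m with
  | zero =>
    exact (Set.ncard_pos (Set.toFinite _)).2 ⟨j, hj _⟩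
  | succ m ih =>
    have ih := ih (by omega)
    set A := influenced W w t j (m * B) with hA
    have hsub : A ⊆ influenced W w t j ((m + 1) * B) :=
      h.influenced_mono hw ht j (Nat.mul_le_mul_right B (Nat.le_succ m))
    by_cases hall : A = Set.univ
    · have h1 : influenced W w t j ((m + 1) * B) = Set.univ :=
        Set.eq_univ_of_univ_subset (hall ▸ hsub)
      rw [h1, Set.ncard_univ, Nat.card_eq_fintype_card, Fintype.card_fin]
      omega
    · obtain ⟨b, hb⟩ := (Set.ne_univ_iff_exists_notMem A).1 hall
      have hcross : ∃ x ∈ A, ∃ y ∉ A, ∃ l < B, E (t + m * B + l) x y := by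
        by_contra hno
        push Not at hno
        refine hb (Relation.ReflTransGen.head_induction_on
          (motive := fun x _ => x ∈ A → b ∈ A)
          (h.strongly_connected (t + m * B) (by omega) j b) (fun hx => hx) ?_ (hj _))
        rintro x y ⟨l, hl, hE⟩ - ih2 hx
        by_contra hbA
        exact hno x hx y (fun hy => hbA (ih2 hy)) l hl hE
      obtain ⟨x, hx, y, hy, l, hl, hE⟩ := hcross
      have hy' : y ∈ influenced W w t j ((m + 1) * B) := by
        refine h.influenced_mono hw ht j (show m * B + l + 1 ≤ (m + 1) * B by
          rw [Nat.succ_mul]; omega) ?_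
        refine h.mem_influenced_succ hw ht (l := x) (.inl ?_)
          (h.influenced_mono hw ht j (Nat.le_add_right _ _) hx)
        rwa [← Nat.add_assoc]
      have : A ⊂ influenced W w t j ((m + 1) * B) := ⟨hsub, fun hh => hy (hh hy')⟩
      have := Set.ncard_lt_ncard this (Set.toFinite _)
      omega

/-- After `n * B` iterations every agent has influenced every other one. -/
theorem NetworkAssumption.pow_le_transition (h : NetworkAssumption E W w B) (hw : 0 < w) {t : ℕ}
    (ht : 1 ≤ t) (i j : Fin n) : w ^ (n * B) ≤ transition W t (n * B) i j := by
  have hn : 0 < n := i.pos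
  have h1 := h.le_ncard_influenced hw ht j (n - 1) (by omega)
  have h2 : influenced W w t j ((n - 1) * B) = Set.univ := by
    refine Set.eq_of_subset_of_ncard_le (Set.subset_univ _) ?_ (Set.toFinite _)
    rw [Set.ncard_univ, Nat.card_eq_fintype_card, Fintype.card_fin]
    omega
  have h3 := h.influenced_mono hw ht j (Nat.mul_le_mul_right B (Nat.sub_le n 1))
  rw [h2] at h3
  exact h3 (Set.mem_univ i)

variable {V : Type*} [NormedAddCommGroup V] [NormedSpace ℝ V]

theorem NetworkAssumption.spread_mix_le (h : NetworkAssumption E W w B) (hw : 0 < w) {t : ℕ}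
    (ht : 1 ≤ t) (z : Fin n → V) : spread (fun i => ∑ j, W t i j • z j) ≤ spread z := by
  simpa using spread_sum_smul_le (η := 0) (fun i j => h.weight_nonneg hw ht i j)
    (h.row_sum t ht) z

/-- A perturbed averaging process stays close to the unperturbed one. -/
theorem NetworkAssumption.spread_sub_transition_le (h : NetworkAssumption E W w B) (hw : 0 < w)
    {z η : ℕ → Fin n → V} (hz : ∀ t, 1 ≤ t → ∀ i, z (t + 1) i = ∑ j, W t i j • z t j + η t i)
    {t : ℕ} (ht : 1 ≤ t) (k : ℕ) :
    spread (fun i => z (t + k) i - ∑ j, transition W t k i j • z t j)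
      ≤ ∑ s ∈ Finset.range k, 2 * ∑ i, ‖η (t + s) i‖ := by
  induction k with
  | zero => simp [transition, Matrix.one_apply, spread_le le_rfl]
  | succ k ih =>
    rw [Finset.sum_range_succ]
    have heq : (fun i => z (t + (k + 1)) i - ∑ j, transition W t (k + 1) i j • z t j)
        = fun i => (∑ l, W (t + k) i l • (z (t + k) l - ∑ j, transition W t k l j • z t j))
          + η (t + k) i := by
      ext1 i
      rw [← add_assoc, hz (t + k) (by omega)]
      simp only [transition, Matrix.mul_apply, smul_sub, Finset.sum_sub_distrib, Finset.sum_smul,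
        Finset.smul_sum, smul_smul]
      rw [Finset.sum_comm]
      abel
    rw [heq]
    refine (spread_add_le _ _).trans (add_le_add ?_ (spread_le_two_mul_sum _))
    exact (h.spread_mix_le hw (by omega) _).trans ih

/-- Over a window of `n * B` iterations the disagreement contracts, up to the perturbations. -/
theorem NetworkAssumption.spread_add_window_le (h : NetworkAssumption E W w B) (hw : 0 < w)
    {z η : ℕ → Fin n → V} (hz : ∀ t, 1 ≤ t → ∀ i, z (t + 1) i = ∑ j, W t i j • z t j + η t i)
    {t : ℕ} (ht : 1 ≤ t) :
    spread (z (t + n * B)) ≤ (1 - n * w ^ (n * B)) * spread (z t)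
      + ∑ s ∈ Finset.range (n * B), 2 * ∑ i, ‖η (t + s) i‖ := by
  have h1 := h.spread_sub_transition_le hw hz ht (n * B)
  have h2 := spread_sum_smul_le (fun i j => h.pow_le_transition hw ht i j)
    (h.transition_row_sum ht (n * B)) (z t)
  have h3 := spread_add_le (fun i => ∑ j, transition W t (n * B) i j • z t j)
    (fun i => z (t + n * B) i - ∑ j, transition W t (n * B) i j • z t j)
  simp only [add_sub_cancel] at h3
  have h4 : (fun i => z (t + n * B) i) = z (t + n * B) := rfl
  rw [h4] at h3
  linarith

theorem NetworkAssumption.spread_succ_le (h : NetworkAssumption E W w B) (hw : 0 < w)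
    {z η : ℕ → Fin n → V} (hz : ∀ t, 1 ≤ t → ∀ i, z (t + 1) i = ∑ j, W t i j • z t j + η t i)
    {t : ℕ} (ht : 1 ≤ t) :
    spread (z (t + 1)) ≤ spread (z t) + 2 * ∑ i, ‖η t i‖ := by
  have h1 : z (t + 1) = fun i => ∑ j, W t i j • z t j + η t i := funext fun i => hz t ht i
  rw [h1]
  exact (spread_add_le _ _).trans (add_le_add (h.spread_mix_le hw ht _) (spread_le_two_mul_sum _))

end Transition

/-- Summing a recursion that contracts by `1 - ρ` over windows of length `N`. The first `N` terms
are controlled by the one-step bound; truncating the sequences after `T` keeps the perturbations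
of later times out of the bound. -/
theorem sum_le_of_window_contraction {d q : ℕ → ℝ} {N : ℕ} {ρ : ℝ} (hρ : ρ ≤ 1)
    (hd : ∀ t, 0 ≤ d t) (hq : ∀ t, 0 ≤ q t) (h1 : ∀ t, 1 ≤ t → d (t + 1) ≤ d t + q t)
    (hN : ∀ t, 1 ≤ t → d (t + N) ≤ (1 - ρ) * d t + ∑ s ∈ Finset.range N, q (t + s)) (T : ℕ) :
    ρ * ∑ t ∈ Finset.Icc 1 T, d t ≤ N * d 1 + 2 * N * ∑ t ∈ Finset.Icc 1 T, q t := by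
  set D : ℕ → ℝ := fun t => if t ≤ T then d t else 0 with hD
  set Q : ℝ := ∑ t ∈ Finset.Icc 1 T, q t with hQ
  have hQ0 : 0 ≤ Q := Finset.sum_nonneg fun t _ => hq t
  have hdle : ∀ k, 1 + k ≤ T → d (1 + k) ≤ d 1 + ∑ t ∈ Finset.Icc 1 k, q t := by
    intro k
    induction k with
    | zero => simp
    | succ k ih =>
      intro hk
      rw [Finset.sum_Icc_succ_top (by omega)]
      have := h1 (1 + k) (by omega)
      have h2 := ih (by omega)
      rw [add_comm 1 k] at this
      rw [show 1 + (k + 1) = k + 1 + 1 by omega]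
      rw [add_comm 1 k] at h2
      linarith
  have hDle : ∀ k, D (1 + k) ≤ d 1 + Q := by
    intro k
    simp only [hD]
    split_ifs with hk
    · refine (hdle k hk).trans ?_
      gcongr
      exact Finset.sum_le_sum_of_subset_of_nonneg (Finset.Icc_subset_Icc le_rfl (by omega))
        fun t _ _ => hq t
    · linarith [hd 1]
  have hD0 : ∀ t, 0 ≤ D t := fun t => by
    simp only [hD]
    split_ifs
    exacts [hd t, le_rfl]
  have hstep : ∀ t ∈ Finset.Icc 1 T,
      ρ * d t ≤ D t - D (t + N) + ∑ s ∈ Finset.range N, if t + s ≤ T then q (t + s) else 0 := by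
    intro t ht
    rw [Finset.mem_Icc] at ht
    have hDt : D t = d t := if_pos ht.2
    by_cases h : t + N ≤ T
    · have h2 : D (t + N) = d (t + N) := if_pos h
      have h3 : ∑ s ∈ Finset.range N, (if t + s ≤ T then q (t + s) else 0)
          = ∑ s ∈ Finset.range N, q (t + s) := by
        refine Finset.sum_congr rfl fun s hs => if_pos ?_
        rw [Finset.mem_range] at hs
        omega
      rw [h2, h3, hDt]
      linarith [hN t ht.1]
    · have h2 : D (t + N) = 0 := if_neg h
      have h3 : 0 ≤ ∑ s ∈ Finset.range N, (if t + s ≤ T then q (t + s) else 0) :=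
        Finset.sum_nonneg fun s _ => by split_ifs; exacts [hq _, le_rfl]
      rw [h2, hDt]
      nlinarith [hd t]
  have hsum := Finset.sum_le_sum hstep
  rw [← Finset.mul_sum, Finset.sum_add_distrib] at hsum
  have htel : ∑ t ∈ Finset.Icc 1 T, (D t - D (t + N)) ≤ N * (d 1 + Q) := by
    have h2 : ∀ M, ∑ t ∈ Finset.Icc 1 T, (D t - D (t + M)) ≤ M * (d 1 + Q) := by
      intro M
      induction M with
      | zero => simp
      | succ M ih =>
        have h3 : ∑ t ∈ Finset.Icc 1 T, (D (t + M) - D (t + (M + 1))) ≤ d 1 + Q := by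
          have h4 : ∀ S, ∑ t ∈ Finset.Icc 1 S, (D (t + M) - D (t + (M + 1)))
              = D (1 + M) - D (1 + S + M) := by
            intro S
            induction S with
            | zero => simp
            | succ S ih2 =>
              rw [Finset.sum_Icc_succ_top (by omega), ih2]
              rw [show S + 1 + M = 1 + S + M by omega,
                show S + 1 + (M + 1) = 1 + (S + 1) + M by omega]
              ring
          rw [h4]
          linarith [hDle M, hD0 (1 + T + M)]
        have h5 : ∑ t ∈ Finset.Icc 1 T, (D t - D (t + (M + 1)))
            = ∑ t ∈ Finset.Icc 1 T, (D t - D (t + M))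
              + ∑ t ∈ Finset.Icc 1 T, (D (t + M) - D (t + (M + 1))) := by
          rw [← Finset.sum_add_distrib]
          exact Finset.sum_congr rfl fun t _ => by ring
        rw [h5]
        push_cast
        linarith
    exact h2 N
  have hdouble : ∑ t ∈ Finset.Icc 1 T, ∑ s ∈ Finset.range N,
      (if t + s ≤ T then q (t + s) else 0) ≤ N * Q := by
    rw [Finset.sum_comm]
    calc _ ≤ ∑ s ∈ Finset.range N, Q := Finset.sum_le_sum fun s _ => ?_
      _ = N * Q := by simp
    rw [← Finset.sum_filter, hQ]
    have hinj : Set.InjOn (fun t => t + s) (Finset.filter (fun t => t + s ≤ T) (Finset.Icc 1 T)) :=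
      fun a _ b _ hab => by simpa using hab
    rw [← Finset.sum_image (f := q) hinj]
    refine Finset.sum_le_sum_of_subset_of_nonneg ?_ fun t _ _ => hq t
    intro a ha
    simp only [Finset.mem_image, Finset.mem_filter, Finset.mem_Icc] at ha ⊢
    omega
  nlinarith

end BanditCompressed

namespace BanditCompressed

/-! ### Projections and shrunken decision sets -/

section Proj

variable {p : ℕ}

theorem proj_spec {K : Set (Vec p)} (hne : K.Nonempty) (hK : IsClosed K) (x : Vec p) :
    proj K x ∈ K ∧ ∀ y ∈ K, ‖x - proj K x‖ ≤ ‖x - y‖ := by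
  refine Classical.epsilon_spec (p := fun y => y ∈ K ∧ ∀ y' ∈ K, ‖x - y‖ ≤ ‖x - y'‖) ?_
  obtain ⟨y, hy, h⟩ := hK.exists_infDist_eq_dist hne x
  refine ⟨y, hy, fun y' hy' => ?_⟩
  rw [← dist_eq_norm, ← dist_eq_norm, ← h]
  exact Metric.infDist_le_dist_of_mem hy'

theorem inner_sub_proj_nonpos {K : Set (Vec p)} (hne : K.Nonempty) (hK : IsClosed K)
    (hc : Convex ℝ K) (x : Vec p) {y : Vec p} (hy : y ∈ K) :
    inner ℝ (x - proj K x) (y - proj K x) ≤ 0 := by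
  obtain ⟨h1, h2⟩ := proj_spec hne hK x
  refine (norm_eq_iInf_iff_real_inner_le_zero hc h1).1 ?_ y hy
  have : Nonempty K := ⟨⟨_, h1⟩⟩
  refine le_antisymm (le_ciInf fun w => h2 w w.2) ?_
  exact ciInf_le (f := fun w : K => ‖x - (w : Vec p)‖)
    ⟨0, by rintro _ ⟨w, rfl⟩; exact norm_nonneg _⟩ ⟨_, h1⟩

theorem norm_proj_sub_proj_le {K : Set (Vec p)} (hne : K.Nonempty) (hK : IsClosed K)
    (hc : Convex ℝ K) (x y : Vec p) : ‖proj K x - proj K y‖ ≤ ‖x - y‖ := by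
  have h1 := inner_sub_proj_nonpos hne hK hc x (proj_spec hne hK y).1
  have h2 := inner_sub_proj_nonpos hne hK hc y (proj_spec hne hK x).1
  set a := proj K x
  set b := proj K y
  have h3 : ‖a - b‖ ^ 2 ≤ inner ℝ (x - y) (a - b) := by
    have e1 : inner ℝ (x - a) (b - a) = -inner ℝ (x - a) (a - b) := by
      rw [← inner_neg_right, neg_sub]
    have e2 : inner ℝ (x - y) (a - b)
        = inner ℝ (x - a) (a - b) + inner ℝ (a - b) (a - b) - inner ℝ (y - b) (a - b) := by
      rw [← inner_add_left, ← inner_sub_left]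
      congr 1
      abel
    rw [real_inner_self_eq_norm_sq] at e2
    linarith
  have h4 := real_inner_le_norm (x - y) (a - b)
  nlinarith [norm_nonneg (a - b), norm_nonneg (x - y)]

theorem proj_of_mem {K : Set (Vec p)} (hK : IsClosed K) {x : Vec p} (hx : x ∈ K) :
    proj K x = x := by
  have h := (proj_spec ⟨x, hx⟩ hK x).2 x hx
  rw [sub_self, norm_zero] at h
  exact (sub_eq_zero.1 (norm_le_zero_iff.1 h)).symm

theorem norm_proj_sub_le {K : Set (Vec p)} (hK : IsClosed K)
    (hc : Convex ℝ K) (x : Vec p) {y : Vec p} (hy : y ∈ K) : ‖proj K x - y‖ ≤ ‖x - y‖ := by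
  have := norm_proj_sub_proj_le ⟨y, hy⟩ hK hc x y
  rwa [proj_of_mem hK hy] at this

theorem continuous_proj {K : Set (Vec p)} (hne : K.Nonempty) (hK : IsClosed K)
    (hc : Convex ℝ K) : Continuous (proj K) := by
  refine LipschitzWith.continuous (K := 1) (.of_dist_le_mul fun x y => ?_)
  simpa [dist_eq_norm] using norm_proj_sub_proj_le hne hK hc x y

end Proj

namespace Problem

variable {n p : ℕ} {P : Problem n p} {r R : ℝ}

theorem SetAssumption.zero_mem (h : P.SetAssumption r R) (hr : 0 < r) : (0 : Vec p) ∈ P.X :=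
  h.ball_subset (by simpa using hr.le)

theorem SetAssumption.isClosed_smul (h : P.SetAssumption r R) {a : ℝ} (ha : 0 < a) :
    IsClosed (a • P.X) := h.isClosed.smul_of_ne_zero ha.ne'

theorem SetAssumption.nonempty_smul (h : P.SetAssumption r R) (hr : 0 < r) (a : ℝ) :
    (a • P.X).Nonempty := ⟨0, 0, h.zero_mem hr, by simp⟩

theorem SetAssumption.smul_subset_smul (h : P.SetAssumption r R) (hr : 0 < r) {a b : ℝ}
    (ha : 0 ≤ a) (hb : 0 < b) (hab : a ≤ b) : a • P.X ⊆ b • P.X := by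
  rintro _ ⟨x, hx, rfl⟩
  refine ⟨(a / b) • x, h.convex.smul_mem_of_zero_mem (h.zero_mem hr) hx
    ⟨by positivity, (div_le_one hb).2 hab⟩, ?_⟩
  simp only [smul_smul]
  congr 1
  field_simp

theorem SetAssumption.smul_subset (h : P.SetAssumption r R) (hr : 0 < r) {a : ℝ}
    (ha : 0 ≤ a) (ha1 : a ≤ 1) : a • P.X ⊆ P.X := by
  simpa using h.smul_subset_smul hr ha one_pos ha1

theorem SetAssumption.norm_le (h : P.SetAssumption r R) {x : Vec p} (hx : x ∈ P.X) : ‖x‖ ≤ R := by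
  simpa using h.subset_ball hx

/-! ### Estimates for the loss and constraint functions -/

/-- The norm `‖[g_{i,t}(x)]_+‖` of the local constraint violation. -/
noncomputable def violation (P : Problem n p) (i : Fin n) (t : ℕ) (x : Vec p) : ℝ :=
  ‖posPart (P.g i t x)‖

theorem violation_nonneg (i : Fin n) (t : ℕ) (x : Vec p) : 0 ≤ P.violation i t x := norm_nonneg _

/-- The local Lagrangian `f_{i,t} + ⟨v, g_{i,t}⟩` with the multiplier `v = γ [g_{i,t}(x)]_+` that
the algorithm attaches to the decision `x`. -/
noncomputable def lagrangian (P : Problem n p) (γ : ℝ) (i : Fin n) (t : ℕ) (x y : Vec p) : ℝ :=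
  P.f i t y + inner ℝ (γ • posPart (P.g i t x)) (P.g i t y)

/-- The two-point estimator of the gradient of the Lagrangian at `x` in the direction `u`. -/
noncomputable def estimator (P : Problem n p) (γ δ : ℝ) (i : Fin n) (t : ℕ) (x u : Vec p) : Vec p :=
  twoPointGrad δ (P.lagrangian γ i t x) x u

/-- The expectation of the two-point estimator over a uniform direction. -/
noncomputable def meanEstimator (P : Problem n p) (γ δ : ℝ) (i : Fin n) (t : ℕ) (x : Vec p) :
    Vec p :=
  ∫ u : Metric.sphere (0 : Vec p) 1, P.estimator γ δ i t x u ∂uniformSphere p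

end Problem

section PosPart

theorem posPart_apply {ι : Type} (v : EuclideanSpace ℝ ι) (k : ι) : posPart v k = max (v k) 0 := rfl

theorem norm_le_of_forall_le {ι : Type} [Fintype ι] {v w : EuclideanSpace ℝ ι}
    (h0 : ∀ k, 0 ≤ v k) (h : ∀ k, v k ≤ w k) : ‖v‖ ≤ ‖w‖ := by
  rw [← sq_le_sq₀ (norm_nonneg _) (norm_nonneg _), EuclideanSpace.norm_sq_eq,
    EuclideanSpace.norm_sq_eq]
  refine Finset.sum_le_sum fun k _ => ?_
  rw [Real.norm_of_nonneg (h0 k), Real.norm_of_nonneg ((h0 k).trans (h k))]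
  exact pow_le_pow_left₀ (h0 k) (h k) 2

theorem norm_posPart_le {ι : Type} [Fintype ι] (v : EuclideanSpace ℝ ι) :
    ‖posPart v‖ ≤ ‖v‖ := by
  rw [← sq_le_sq₀ (norm_nonneg _) (norm_nonneg _), EuclideanSpace.norm_sq_eq,
    EuclideanSpace.norm_sq_eq]
  refine Finset.sum_le_sum fun k _ => ?_
  rw [posPart_apply, Real.norm_of_nonneg (le_max_right _ _)]
  refine pow_le_pow_left₀ (le_max_right _ _) (max_le (le_abs_self _) (abs_nonneg _)) 2

/-- If `v ≤ w + d` componentwise, then the norms of the positive parts satisfy the same bound. -/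
theorem norm_posPart_le_add {ι : Type} [Fintype ι] {v w d : EuclideanSpace ℝ ι}
    (h : ∀ k, v k ≤ w k + d k) : ‖posPart v‖ ≤ ‖posPart w‖ + ‖d‖ := by
  have h1 : ‖posPart v‖ ≤ ‖posPart w + posPart d‖ := by
    refine norm_le_of_forall_le (fun k => le_max_right _ _) fun k => ?_
    rw [PiLp.add_apply, posPart_apply, posPart_apply, posPart_apply]
    refine max_le ?_ (add_nonneg (le_max_right _ _) (le_max_right _ _))
    exact (h k).trans (add_le_add (le_max_left _ _) (le_max_left _ _))
  exact h1.trans ((norm_add_le _ _).trans (add_le_add le_rfl (norm_posPart_le d)))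

theorem inner_posPart_self {ι : Type} [Fintype ι] (v : EuclideanSpace ℝ ι) :
    inner ℝ (posPart v) v = ‖posPart v‖ ^ 2 := by
  rw [← real_inner_self_eq_norm_sq, PiLp.inner_apply, PiLp.inner_apply]
  refine Finset.sum_congr rfl fun k _ => ?_
  simp only [posPart_apply, RCLike.inner_apply, conj_trivial]
  rcases le_total (v k) 0 with h | h <;> simp [h]

theorem inner_le_inner_of_nonneg {ι : Type} [Fintype ι] {v a b : EuclideanSpace ℝ ι}
    (hv : ∀ k, 0 ≤ v k) (h : ∀ k, a k ≤ b k) : inner ℝ v a ≤ inner ℝ v b := by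
  rw [PiLp.inner_apply, PiLp.inner_apply]
  refine Finset.sum_le_sum fun k _ => ?_
  simp only [RCLike.inner_apply, conj_trivial]
  exact mul_le_mul_of_nonneg_right (h k) (hv k)

theorem norm_le_sum_of_nonneg {ι : Type} [Fintype ι] {v : EuclideanSpace ℝ ι}
    (hv : ∀ k, 0 ≤ v k) : ‖v‖ ≤ ∑ k, v k := by
  have h0 : 0 ≤ ∑ k, v k := Finset.sum_nonneg fun k _ => hv k
  rw [← sq_le_sq₀ (norm_nonneg _) h0, EuclideanSpace.norm_sq_eq, sq, Finset.sum_mul]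
  refine Finset.sum_le_sum fun k _ => ?_
  rw [Real.norm_of_nonneg (hv k), sq]
  exact mul_le_mul_of_nonneg_left (Finset.single_le_sum (fun k _ => hv k) (Finset.mem_univ k))
    (hv k)

end PosPart

namespace Problem

variable {n p : ℕ} {P : Problem n p} {r R G₁ G₂ L : ℝ}

theorem GradientAssumption.hasBoundedSubgradients_inner (h : P.GradientAssumption G₁ G₂)
    {i : Fin n} {t : ℕ} (ht : 1 ≤ t) {v : EuclideanSpace ℝ (Fin (P.m i))} (hv : ∀ k, 0 ≤ v k) :
    HasBoundedSubgradients (fun y => inner ℝ v (P.g i t y)) P.dom (G₂ * ‖v‖) := by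
  intro x hx
  obtain ⟨J, hJ, hJn⟩ := h.g_bound i t ht x hx
  refine ⟨ContinuousLinearMap.adjoint J v, fun y hy => ?_, ?_⟩
  · rw [ContinuousLinearMap.adjoint_inner_left, ← inner_add_right]
    exact inner_le_inner_of_nonneg hv fun k => by simpa using hJ y hy k
  · refine (ContinuousLinearMap.le_opNorm _ _).trans ?_
    rw [LinearIsometryEquiv.norm_map]
    gcongr

theorem GradientAssumption.violation_le (h : P.GradientAssumption G₁ G₂)
    {i : Fin n} {t : ℕ} (ht : 1 ≤ t) {x y : Vec p} (hx : x ∈ P.dom) (hy : y ∈ P.dom) :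
    P.violation i t x ≤ P.violation i t y + G₂ * ‖x - y‖ := by
  obtain ⟨J, hJ, hJn⟩ := h.g_bound i t ht x hx
  have h1 : P.violation i t x ≤ P.violation i t y + ‖J (x - y)‖ := by
    refine norm_posPart_le_add fun k => ?_
    have h2 := hJ y hy k
    rw [← neg_sub x y, map_neg, PiLp.neg_apply] at h2
    linarith
  refine h1.trans ?_
  gcongr
  exact (J.le_opNorm _).trans (mul_le_mul_of_nonneg_right hJn (norm_nonneg _))

theorem GradientAssumption.abs_lagrangian_sub_le (h : P.GradientAssumption G₁ G₂)
    (hd : P.DomainAssumption) {γ : ℝ} (hγ : 0 ≤ γ) {i : Fin n} {t : ℕ} (ht : 1 ≤ t) (x : Vec p) :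
    ∀ y ∈ P.dom, ∀ y' ∈ P.dom, |P.lagrangian γ i t x y - P.lagrangian γ i t x y'|
      ≤ (G₁ + G₂ * (γ * P.violation i t x)) * ‖y - y'‖ := by
  intro y hy y' hy'
  have h1 := abs_sub_le_of_norm_gradientWithin_le hd.convex (h.f_diff i t ht) (h.f_bound i t ht)
    y hy y' hy'
  have h2 := (h.hasBoundedSubgradients_inner (i := i) ht (v := γ • posPart (P.g i t x))
    (fun k => mul_nonneg hγ (le_max_right _ _))).abs_sub_le hy hy'
  rw [norm_smul, Real.norm_of_nonneg hγ] at h2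
  have h3 : P.lagrangian γ i t x y - P.lagrangian γ i t x y' = (P.f i t y - P.f i t y')
      + (inner ℝ (γ • posPart (P.g i t x)) (P.g i t y)
        - inner ℝ (γ • posPart (P.g i t x)) (P.g i t y')) := by
    simp only [lagrangian]
    ring
  rw [h3, add_mul]
  exact (abs_add_le _ _).trans (add_le_add h1 h2)

/-- The two-point estimator is bounded by the Lipschitz constant of the Lagrangian, uniformly in
`δ`. -/
theorem GradientAssumption.norm_estimator_le (h : P.GradientAssumption G₁ G₂)
    (hd : P.DomainAssumption) {γ δ : ℝ} (hγ : 0 ≤ γ) (hδ : 0 < δ) {i : Fin n} {t : ℕ} (ht : 1 ≤ t)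
    {x : Vec p} (hx : x ∈ P.dom) {u : Metric.sphere (0 : Vec p) 1}
    (hu : x + δ • (u : Vec p) ∈ P.dom) :
    ‖P.estimator γ δ i t x u‖ ≤ p * (G₁ + G₂ * (γ * P.violation i t x)) := by
  have h1 := h.abs_lagrangian_sub_le hd hγ (i := i) ht x _ hu x hx
  have h2 : ‖x + δ • (u : Vec p) - x‖ = δ := by simp [norm_smul, abs_of_pos hδ]
  have h3 : ‖(u : Vec p)‖ = 1 := by simp
  rw [h2] at h1
  rw [estimator, twoPointGrad, norm_smul, h3, mul_one, norm_mul,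
    Real.norm_of_nonneg (by positivity : (0 : ℝ) ≤ p / δ), Real.norm_eq_abs]
  calc _ ≤ p / δ * ((G₁ + G₂ * (γ * P.violation i t x)) * δ) := by gcongr
    _ = _ := by field_simp

theorem GradientAssumption.integrable_estimator (h : P.GradientAssumption G₁ G₂)
    (hd : P.DomainAssumption) (hp : 1 ≤ p) {γ δ : ℝ} (hγ : 0 ≤ γ) (hδ : 0 < δ) {i : Fin n} {t : ℕ}
    (ht : 1 ≤ t) {x : Vec p} (hx : x ∈ P.dom)
    (hxD : ∀ᵐ u : Metric.sphere (0 : Vec p) 1 ∂uniformSphere p, x + δ • (u : Vec p) ∈ P.dom) :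
    Integrable (fun u : Metric.sphere (0 : Vec p) 1 => P.estimator γ δ i t x u)
      (uniformSphere p) := by
  have := isProbabilityMeasure_uniformSphere hp
  refine Integrable.of_bound (C := p * (G₁ + G₂ * (γ * P.violation i t x))) ?_ ?_
  · have hval : AEStronglyMeasurable (fun u : Metric.sphere (0 : Vec p) 1 => (u : Vec p))
        (uniformSphere p) := continuous_subtype_val.aestronglyMeasurable
    have hsc : AEStronglyMeasurable (fun u : Metric.sphere (0 : Vec p) 1 => p / δ
        * (P.lagrangian γ i t x (x + δ • (u : Vec p)) - P.lagrangian γ i t x x))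
        (uniformSphere p) :=
      ((aestronglyMeasurable_two_point hd.isClosed
        (continuousOn_of_abs_sub_le (h.abs_lagrangian_sub_le hd hγ ht x)) hxD).sub
        aestronglyMeasurable_const).const_mul _
    exact hsc.smul hval
  · filter_upwards [hxD] with u hu
    exact h.norm_estimator_le hd hγ hδ ht hx hu

theorem GradientAssumption.norm_meanEstimator_le (h : P.GradientAssumption G₁ G₂)
    (hd : P.DomainAssumption) (hp : 1 ≤ p) {γ δ : ℝ} (hγ : 0 ≤ γ) (hδ : 0 < δ) {i : Fin n} {t : ℕ}
    (ht : 1 ≤ t) {x : Vec p} (hx : x ∈ P.dom)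
    (hxD : ∀ᵐ u : Metric.sphere (0 : Vec p) 1 ∂uniformSphere p, x + δ • (u : Vec p) ∈ P.dom) :
    ‖P.meanEstimator γ δ i t x‖ ≤ p * (G₁ + G₂ * (γ * P.violation i t x)) := by
  have := isProbabilityMeasure_uniformSphere hp
  refine (norm_integral_le_of_norm_le_const
    (C := p * (G₁ + G₂ * (γ * P.violation i t x))) ?_).trans (by simp)
  filter_upwards [hxD] with u hu
  exact h.norm_estimator_le hd hγ hδ ht hx hu

/-- The mean estimator behaves like a gradient of the Lagrangian up to a bias of order `δ`. -/
theorem GradientAssumption.le_inner_meanEstimator (h : P.GradientAssumption G₁ G₂)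
    (hs : P.SmoothAssumption L) (hd : P.DomainAssumption) (hp : 1 ≤ p) {γ δ : ℝ} (hγ : 0 ≤ γ)
    (hδ : 0 < δ) {i : Fin n} {t : ℕ} (ht : 1 ≤ t) {x y : Vec p} (hx : x ∈ P.dom) (hy : y ∈ P.dom)
    (hxD : ∀ᵐ u : Metric.sphere (0 : Vec p) 1 ∂uniformSphere p, x + δ • (u : Vec p) ∈ P.dom) :
    inner ℝ (gradientWithin (P.f i t) P.dom x) (x - y) - p * L * δ * ‖x - y‖
        + γ * P.violation i t x ^ 2 - inner ℝ (γ • posPart (P.g i t x)) (P.g i t y)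
        - 2 * (G₂ * (γ * P.violation i t x)) * δ
      ≤ inner ℝ (P.meanEstimator γ δ i t x) (x - y) := by
  set v := γ • posPart (P.g i t x) with hv
  have hvn : ‖v‖ = γ * P.violation i t x := by rw [hv, norm_smul, Real.norm_of_nonneg hγ]; rfl
  have hsub := h.hasBoundedSubgradients_inner (i := i) ht (v := v)
    (fun k => mul_nonneg hγ (le_max_right _ _))
  have h1 := abs_integral_two_point_smooth_sub_le hp hd.isClosed hd.convex (h.f_diff i t ht)
    (h.f_bound i t ht) (hs i t ht) (h := y - x) hx hδ hxD
  have h2 := integral_two_point_convex_le hp hd.isClosed hsub (h := y - x) hx (by simpa using hy)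
    hδ hxD
  have hI1 := integrable_two_point hp hd.isClosed
    (abs_sub_le_of_norm_gradientWithin_le hd.convex (h.f_diff i t ht) (h.f_bound i t ht)) hx hδ hxD
    (y - x)
  have hI2 := integrable_two_point hp hd.isClosed (fun _ ha _ hb => hsub.abs_sub_le ha hb) hx hδ
    hxD (y - x)
  have h3 : inner ℝ (P.meanEstimator γ δ i t x) (y - x)
      = ∫ u : Metric.sphere (0 : Vec p) 1,
          p / δ * (P.f i t (x + δ • (u : Vec p)) - P.f i t x) * inner ℝ (u : Vec p) (y - x)
            ∂uniformSphere p
        + ∫ u : Metric.sphere (0 : Vec p) 1,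
          p / δ * (inner ℝ v (P.g i t (x + δ • (u : Vec p))) - inner ℝ v (P.g i t x))
            * inner ℝ (u : Vec p) (y - x) ∂uniformSphere p := by
    rw [← integral_add hI1 hI2, real_inner_comm, meanEstimator,
      ← integral_inner (h.integrable_estimator hd hp hγ hδ ht hx hxD)]
    refine integral_congr_ae (.of_forall fun u => ?_)
    simp only [estimator, twoPointGrad, lagrangian, inner_smul_right, ← hv]
    rw [real_inner_comm (y - x)]
    ring
  have h4 : inner ℝ v (P.g i t x) = γ * P.violation i t x ^ 2 := by
    rw [hv, inner_smul_left, inner_posPart_self]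
    rfl
  have h5 (a : Vec p) : inner ℝ a (x - y) = -inner ℝ a (y - x) := by
    rw [← inner_neg_right, neg_sub]
  simp only [add_sub_cancel] at h2
  rw [hvn] at h2
  rw [h5, h5, h3, norm_sub_rev x y]
  have h6 := (abs_le.1 h1).2
  linarith

/-- At a shrunken comparator the multiplier sees the Slater margin, up to the shrinkage error. -/
theorem GradientAssumption.inner_smul_posPart_le (h : P.GradientAssumption G₁ G₂)
    (hset : P.SetAssumption r R) (hr : 0 < r)
    (hd : P.DomainAssumption) {γ ξ ς : ℝ} (hγ : 0 ≤ γ) (hξ : 0 ≤ ξ) (hξ1 : ξ ≤ 1) (hς : 0 ≤ ς)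
    {i : Fin n} {t : ℕ} (ht : 1 ≤ t) (x : Vec p) {y : Vec p} (hy : y ∈ P.X)
    (hyς : ∀ k, P.g i t y k ≤ -ς) :
    inner ℝ (γ • posPart (P.g i t x)) (P.g i t ((1 - ξ) • y))
      ≤ γ * P.violation i t x * (G₂ * (ξ * R) - ς) := by
  have hy' : (1 - ξ) • y ∈ P.dom := hd.X_subset (hset.smul_subset hr (by linarith) (by linarith)
    ⟨y, hy, rfl⟩)
  obtain ⟨J, hJ, hJn⟩ := h.g_bound i t ht _ hy'
  have hpos : ∀ k, 0 ≤ posPart (P.g i t x) k := fun k => le_max_right _ _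
  have h1 : inner ℝ (posPart (P.g i t x)) (P.g i t ((1 - ξ) • y))
      ≤ inner ℝ (posPart (P.g i t x)) (J ((1 - ξ) • y - y) + WithLp.toLp 2 fun _ => -ς) := by
    refine inner_le_inner_of_nonneg hpos fun k => ?_
    have h2 := hJ y (hd.X_subset hy) k
    rw [← neg_sub _ y, map_neg, PiLp.neg_apply] at h2
    rw [PiLp.add_apply]
    linarith [hyς k]
  rw [inner_add_right] at h1
  have h3 : inner ℝ (posPart (P.g i t x)) (J ((1 - ξ) • y - y))
      ≤ P.violation i t x * (G₂ * (ξ * R)) := by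
    refine (real_inner_le_norm _ _).trans ?_
    refine mul_le_mul_of_nonneg_left ?_ (norm_nonneg _)
    have h4 : ‖(1 - ξ) • y - y‖ ≤ ξ * R := by
      have : (1 - ξ) • y - y = -(ξ • y) := by rw [sub_smul, one_smul]; abel
      rw [this, norm_neg, norm_smul, Real.norm_of_nonneg hξ]
      exact mul_le_mul_of_nonneg_left (hset.norm_le hy) hξ
    have h5 : 0 ≤ G₂ := (norm_nonneg _).trans hJn
    refine (J.le_opNorm _).trans ?_
    gcongr
  have h6 : inner ℝ (posPart (P.g i t x)) (WithLp.toLp 2 fun _ => -ς)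
      ≤ -ς * P.violation i t x := by
    rw [PiLp.inner_apply]
    simp only [RCLike.inner_apply, conj_trivial]
    rw [← Finset.mul_sum]
    have := norm_le_sum_of_nonneg hpos
    have h7 : P.violation i t x ≤ ∑ k, posPart (P.g i t x) k := this
    nlinarith
  rw [inner_smul_left]
  simp only [conj_trivial]
  have := mul_le_mul_of_nonneg_left (h1.trans (add_le_add h3 h6)) hγ
  linarith

/-- One projected step of one agent, relative to the shrunken comparator `(1 - α) y`. The squared
norm of the direction and all biases that multiply the violation are absorbed by the quadratic
penalty. -/
theorem GradientAssumption.one_step (h : P.GradientAssumption G₁ G₂)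
    (hset : P.SetAssumption r R) (hr : 0 < r) (hs : P.SmoothAssumption L)
    (hd : P.DomainAssumption) (hp : 1 ≤ p) {α γ γ₀ ς : ℝ} (hα : 0 < α) (hα1 : α ≤ 1)
    (hγ₀ : 0 < γ₀) (hγ₀' : γ₀ * (4 * ((p : ℝ) ^ 2 + 1) * G₂ ^ 2) ≤ 1) (hγ : γ = γ₀ / α)
    (hς : 0 ≤ ς) {i : Fin n} {t : ℕ} (ht : 1 ≤ t) {x y z b : Vec p} (hx : x ∈ P.dom) (hy : y ∈ P.X)
    (hxD : ∀ᵐ u : Metric.sphere (0 : Vec p) 1 ∂uniformSphere p, x + (r * α) • (u : Vec p) ∈ P.dom)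
    (hyς : ∀ k, P.g i t y k ≤ -ς)
    (hb : ‖b‖ ≤ p * (G₁ + G₂ * (γ * P.violation i t x)))
    (hz : ‖z - (1 - α) • y‖ ≤ ‖x - α • b - (1 - α) • y‖) :
    2 * α * inner ℝ (gradientWithin (P.f i t) P.dom x) (x - y) + γ₀ * P.violation i t x ^ 2
        + 2 * ς * γ₀ * P.violation i t x
        + 2 * α * inner ℝ (b - P.meanEstimator γ (r * α) i t x) (x - (1 - α) • y)
        + ‖z - (1 - α) • y‖ ^ 2
      ≤ ‖x - (1 - α) • y‖ ^ 2 + 2 * p * L * r * α ^ 2 * ‖x - (1 - α) • y‖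
        + (2 * p ^ 2 * G₁ ^ 2 + 2 * γ₀ * (G₂ * (R + 2 * r)) ^ 2 + 2 * G₁ * R) * α ^ 2 := by
  have hγ0 : 0 ≤ γ := by rw [hγ]; positivity
  have hδ : 0 < r * α := by positivity
  have hαγ : α * γ = γ₀ := by rw [hγ]; field_simp
  have hy' : (1 - α) • y ∈ P.dom := hd.X_subset (hset.smul_subset hr (by linarith) (by linarith)
    ⟨y, hy, rfl⟩)
  have hG₁ : 0 ≤ G₁ := (norm_nonneg _).trans (h.f_bound i t ht x hx)
  have hmean := h.le_inner_meanEstimator hs hd hp hγ0 hδ (i := i) ht hx hy' hxD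
  have hmult := h.inner_smul_posPart_le hset hr hd hγ0 hα.le hα1 hς (i := i) ht x hy hyς
  set G := P.violation i t x with hG
  have hG0 : 0 ≤ G := norm_nonneg _
  set y' := (1 - α) • y with hy'def
  set bm := P.meanEstimator γ (r * α) i t x with hbm
  have hgrn : ‖gradientWithin (P.f i t) P.dom x‖ ≤ G₁ := h.f_bound i t ht x hx
  set gr := gradientWithin (P.f i t) P.dom x with hgr
  have hyR := hset.norm_le hy
  clear_value G bm gr
  have hexp : ‖z - y'‖ ^ 2 ≤ ‖x - y'‖ ^ 2 - 2 * α * inner ℝ b (x - y') + α ^ 2 * ‖b‖ ^ 2 := by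
    have h1 : ‖z - y'‖ ^ 2 ≤ ‖x - α • b - y'‖ ^ 2 := pow_le_pow_left₀ (norm_nonneg _) hz 2
    have h2 : x - α • b - y' = (x - y') - α • b := by abel
    rw [h2, norm_sub_sq_real (x - y') (α • b), inner_smul_right, norm_smul,
      Real.norm_of_nonneg hα.le, real_inner_comm] at h1
    linarith
  have hbsq : α ^ 2 * ‖b‖ ^ 2 ≤ 2 * p ^ 2 * G₁ ^ 2 * α ^ 2 + γ₀ / 2 * G ^ 2 := by
    have h1 : (α * ‖b‖) ^ 2 ≤ (p * (α * G₁ + G₂ * (γ₀ * G))) ^ 2 := by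
      refine pow_le_pow_left₀ (by positivity) ?_ 2
      calc α * ‖b‖ ≤ α * (p * (G₁ + G₂ * (γ * G))) := by gcongr
        _ = p * (α * G₁ + G₂ * ((α * γ) * G)) := by ring
        _ = _ := by rw [hαγ]
    have h2 : (p * (α * G₁ + G₂ * (γ₀ * G))) ^ 2
        ≤ p ^ 2 * (2 * (α * G₁) ^ 2 + 2 * (G₂ * (γ₀ * G)) ^ 2) := by
      rw [mul_pow]
      gcongr
      nlinarith [sq_nonneg (α * G₁ - G₂ * (γ₀ * G))]
    have h3 : γ₀ * (4 * (p : ℝ) ^ 2 * G₂ ^ 2) ≤ 1 := by nlinarith [sq_nonneg G₂]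
    have h4 : γ₀ * (4 * (p : ℝ) ^ 2 * G₂ ^ 2) * (γ₀ / 2 * G ^ 2) ≤ 1 * (γ₀ / 2 * G ^ 2) := by
      gcongr
    have h5 := mul_le_mul_of_nonneg_left h2 zero_le_one
    linarith
  have hgrad : 2 * α * inner ℝ gr (x - y) ≤ 2 * α * inner ℝ gr (x - y') + 2 * G₁ * R * α ^ 2 := by
    have h1 : x - y = (x - y') - α • y := by
      rw [hy'def, sub_smul, one_smul]
      abel
    have h2 : -inner ℝ gr y ≤ G₁ * R :=
      ((neg_le_abs _).trans (abs_real_inner_le_norm _ _)).trans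
        (mul_le_mul hgrn hyR (norm_nonneg _) hG₁)
    rw [h1, inner_sub_right, inner_smul_right]
    have := mul_le_mul_of_nonneg_left h2 (by positivity : 0 ≤ 2 * α ^ 2)
    linarith
  have hinner : inner ℝ (b - bm) (x - y') = inner ℝ b (x - y') - inner ℝ bm (x - y') :=
    inner_sub_left _ _ _
  have hyoung : 2 * α * (γ₀ * (G₂ * (R + 2 * r))) * G
      ≤ γ₀ / 2 * G ^ 2 + 2 * γ₀ * (G₂ * (R + 2 * r)) ^ 2 * α ^ 2 := by
    have := mul_nonneg hγ₀.le (sq_nonneg (G - 2 * (G₂ * (R + 2 * r)) * α))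
    linarith
  -- multiply the mean bound by `2 α`, using `α γ = γ₀`
  have hmean2 : 2 * α * inner ℝ gr (x - y') - 2 * p * L * r * α ^ 2 * ‖x - y'‖ + 2 * γ₀ * G ^ 2
      + 2 * ς * γ₀ * G - 2 * α * (γ₀ * (G₂ * (R + 2 * r))) * G ≤ 2 * α * inner ℝ bm (x - y') := by
    have h1 : inner ℝ gr (x - y') - p * L * (r * α) * ‖x - y'‖ + γ * G ^ 2
        - γ * G * (G₂ * (α * R) - ς) - 2 * (G₂ * (γ * G)) * (r * α) ≤ inner ℝ bm (x - y') := by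
      linarith
    have h2 := mul_le_mul_of_nonneg_left h1 (by positivity : 0 ≤ 2 * α)
    refine le_trans (le_of_eq ?_) h2
    rw [← hαγ]
    ring
  rw [hinner]
  linarith

end Problem

end BanditCompressed

namespace BanditCompressed

/-! ### Independence and fresh randomness -/

section Fresh

variable {Ω E V : Type*} {m m₀ : MeasurableSpace Ω} {μ : Measure[m₀] Ω} [IsProbabilityMeasure μ]
  [TopologicalSpace E] [TopologicalSpace.PseudoMetrizableSpace E]
  [MeasurableSpace E] [BorelSpace E] [MeasurableSpace V] {X : Ω → E} {U : Ω → V}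

omit m in
theorem indepFun_prodMk_of_indepFun {α β δ : Type*} [MeasurableSpace α] [MeasurableSpace β]
    [MeasurableSpace δ] {a : Ω → δ} {c : Ω → α} {u : Ω → β} (ha : Measurable a) (hc : Measurable c)
    (hu : Measurable u) (h1 : IndepFun a (fun ω => (c ω, u ω)) μ) (h2 : IndepFun c u μ) :
    IndepFun (fun ω => (a ω, c ω)) u μ := by
  have hac : IndepFun a c μ := h1.comp measurable_id measurable_fst
  refine (indepFun_iff_map_prod_eq_prod_map_map (ha.prodMk hc).aemeasurable hu.aemeasurable).2 ?_
  have e1 := (indepFun_iff_map_prod_eq_prod_map_map ha.aemeasurable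
    (hc.prodMk hu).aemeasurable).1 h1
  have e2 := (indepFun_iff_map_prod_eq_prod_map_map ha.aemeasurable hc.aemeasurable).1 hac
  have e3 := (indepFun_iff_map_prod_eq_prod_map_map hc.aemeasurable hu.aemeasurable).1 h2
  have : IsProbabilityMeasure (μ.map c) := Measure.isProbabilityMeasure_map hc.aemeasurable
  have : IsProbabilityMeasure (μ.map u) := Measure.isProbabilityMeasure_map hu.aemeasurable
  have : IsProbabilityMeasure (μ.map a) := Measure.isProbabilityMeasure_map ha.aemeasurable
  rw [e3, ← Measure.prodAssoc_prod, ← e2] at e1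
  have e4 := congrArg (Measure.map MeasurableEquiv.prodAssoc.symm) e1
  rw [Measure.map_map (MeasurableEquiv.measurable _) (MeasurableEquiv.measurable _),
    Measure.map_map (MeasurableEquiv.measurable _) (ha.prodMk (hc.prodMk hu))] at e4
  simp only [MeasurableEquiv.symm_comp_self, Measure.map_id] at e4
  exact e4

omit m in
/-- Mutual independence of `H`, `(c, u)` and of `c`, `u` makes `u` independent of `H` and `c`
together. -/
theorem indep_sup_comap {α β : Type*} [mα : MeasurableSpace α] [MeasurableSpace β]
    {H : MeasurableSpace Ω} (hH : H ≤ m₀) {c : Ω → α} {u : Ω → β} (hc : Measurable[m₀] c)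
    (hu : Measurable[m₀] u)
    (h1 : Indep H ((inferInstance : MeasurableSpace (α × β)).comap fun ω => (c ω, u ω)) μ)
    (h2 : IndepFun c u μ) :
    Indep (H ⊔ (inferInstance : MeasurableSpace α).comap c)
      ((inferInstance : MeasurableSpace β).comap u) μ := by
  have hI : @IndepFun Ω Ω (α × β) m₀ H _ id (fun ω => (c ω, u ω)) μ := by
    rw [IndepFun_iff_Indep, MeasurableSpace.comap_id]
    exact h1
  have h3 := @indepFun_prodMk_of_indepFun Ω m₀ μ _ α β Ω _ _ H id c u (measurable_id'' hH) hc hu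
    hI h2
  rw [IndepFun_iff_Indep] at h3
  have h4 := @MeasurableSpace.comap_prodMk Ω Ω α H mα id c
  rw [MeasurableSpace.comap_id] at h4
  rw [← h4]
  exact h3

omit [IsProbabilityMeasure μ] in
theorem indepFun_of_aestronglyMeasurable (hX : AEStronglyMeasurable[m] X μ)
    (hU : Indep m ((inferInstance : MeasurableSpace V).comap U) μ) : IndepFun X U μ := by
  have h : IndepFun (hX.mk X) U μ := by
    rw [IndepFun_iff_Indep]
    exact indep_of_indep_of_le_left hU hX.stronglyMeasurable_mk.measurable.comap_le
  exact h.congr hX.ae_eq_mk.symm (ae_eq_refl _)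

/-- Fubini for a variable `X` known to the σ-algebra `m` and a variable `U` independent of `m`. -/
theorem lintegral_fresh (hm : m ≤ m₀) (hX : AEStronglyMeasurable[m] X μ) (hUm : Measurable U)
    (hU : Indep m ((inferInstance : MeasurableSpace V).comap U) μ) {F : E × V → ENNReal}
    (hF : Measurable F) :
    ∫⁻ ω, F (X ω, U ω) ∂μ = ∫⁻ ω, ∫⁻ v, F (X ω, v) ∂(μ.map U) ∂μ := by
  have hXm : AEMeasurable X μ := (hX.mono hm).aemeasurable
  have : IsProbabilityMeasure (μ.map U) := Measure.isProbabilityMeasure_map hUm.aemeasurable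
  have h := (indepFun_iff_map_prod_eq_prod_map_map hXm hUm.aemeasurable).1
    (indepFun_of_aestronglyMeasurable hX hU)
  have : SFinite (μ.map X) := inferInstance
  rw [← lintegral_map' hF.aemeasurable (hXm.prodMk hUm.aemeasurable), h,
    lintegral_prod _ hF.aemeasurable]
  exact lintegral_map' hF.lintegral_prod_right'.aemeasurable hXm

/-- An almost sure property of `(X, U)` holds for almost every `X` and, given it, almost every
value of the independent variable `U`. -/
theorem ae_ae_fresh (hm : m ≤ m₀) (hX : AEStronglyMeasurable[m] X μ) (hUm : Measurable U)
    (hU : Indep m ((inferInstance : MeasurableSpace V).comap U) μ) {A : Set (E × V)}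
    (hA : MeasurableSet A) (h : ∀ᵐ ω ∂μ, (X ω, U ω) ∈ A) :
    ∀ᵐ ω ∂μ, ∀ᵐ v ∂(μ.map U), (X ω, v) ∈ A := by
  have hXm : AEMeasurable X μ := (hX.mono hm).aemeasurable
  have : IsProbabilityMeasure (μ.map U) := Measure.isProbabilityMeasure_map hUm.aemeasurable
  have h1 := (indepFun_iff_map_prod_eq_prod_map_map hXm hUm.aemeasurable).1
    (indepFun_of_aestronglyMeasurable hX hU)
  have h2 : ∀ᵐ q ∂(μ.map fun ω => (X ω, U ω)), q ∈ A :=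
    (ae_map_iff (hXm.prodMk hUm.aemeasurable) hA).2 h
  rw [h1] at h2
  exact ae_of_ae_map hXm (Measure.ae_ae_of_ae_prod h2)

/-- Fluctuations `K (X, U) - E_U K (X, ·)` caused by fresh randomness `U` are orthogonal to every
vector that is determined by the past. -/
theorem integral_inner_fresh_eq_zero {H : Type*} [NormedAddCommGroup H] [InnerProductSpace ℝ H]
    [CompleteSpace H] [MeasurableSpace H] [BorelSpace H] [SecondCountableTopology H]
    [SecondCountableTopology E]
    (hm : m ≤ m₀) (hX : AEStronglyMeasurable[m] X μ) (hUm : Measurable U)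
    (hU : Indep m ((inferInstance : MeasurableSpace V).comap U) μ) {φ : Ω → H}
    (hφ : AEStronglyMeasurable[m] φ μ) {K : E × V → H} (hK : StronglyMeasurable K)
    (hKi : ∀ᵐ ω ∂μ, Integrable (fun v => K (X ω, v)) (μ.map U))
    (hint : Integrable (fun ω => inner ℝ (K (X ω, U ω) - ∫ v, K (X ω, v) ∂(μ.map U)) (φ ω)) μ) :
    ∫ ω, inner ℝ (K (X ω, U ω) - ∫ v, K (X ω, v) ∂(μ.map U)) (φ ω) ∂μ = 0 := by
  have hp : IsProbabilityMeasure (μ.map U) := Measure.isProbabilityMeasure_map hUm.aemeasurable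
  have hY : AEStronglyMeasurable[m] (fun ω => (X ω, φ ω)) μ := hX.prodMk hφ
  have hYm : AEMeasurable (fun ω => (X ω, φ ω)) μ := (hY.mono hm).aemeasurable
  have h1 := (indepFun_iff_map_prod_eq_prod_map_map hYm hUm.aemeasurable).1
    (indepFun_of_aestronglyMeasurable hY hU)
  have hmean : StronglyMeasurable fun x => ∫ v, K (x, v) ∂(μ.map U) :=
    hK.integral_prod_right'
  let F : (E × H) × V → ℝ := fun q =>
    inner ℝ (K (q.1.1, q.2) - ∫ v, K (q.1.1, v) ∂(μ.map U)) q.1.2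
  have hF : StronglyMeasurable F := by
    refine StronglyMeasurable.inner (StronglyMeasurable.sub ?_ ?_) ?_
    · exact hK.comp_measurable (by fun_prop)
    · exact hmean.comp_measurable (by fun_prop)
    · exact (Measurable.stronglyMeasurable (by fun_prop))
  have hpair : AEMeasurable (fun ω => ((X ω, φ ω), U ω)) μ := hYm.prodMk hUm.aemeasurable
  have hFi : Integrable F ((μ.map fun ω => (X ω, φ ω)).prod (μ.map U)) := by
    rw [← h1]
    exact (integrable_map_measure hF.aestronglyMeasurable hpair).2 hint
  change ∫ ω, F ((X ω, φ ω), U ω) ∂μ = 0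
  rw [← integral_map hpair hF.aestronglyMeasurable, h1, integral_prod _ hFi,
    integral_map hYm hF.integral_prod_right'.aestronglyMeasurable]
  refine integral_eq_zero_of_ae ?_
  filter_upwards [hKi] with ω hω
  simp only [F, Pi.zero_apply]
  have h2 : ∀ v, inner ℝ (K (X ω, v) - ∫ v, K (X ω, v) ∂(μ.map U)) (φ ω)
      = inner ℝ (φ ω) (K (X ω, v) - ∫ v, K (X ω, v) ∂(μ.map U)) := fun v => real_inner_comm _ _
  simp only [h2]
  rw [integral_inner (f := fun v => K (X ω, v) - ∫ v, K (X ω, v) ∂(μ.map U))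
    (hω.sub (integrable_const _)), integral_sub hω (integrable_const _)]
  simp

end Fresh

namespace Model

variable {n p : ℕ} {Ω Ξ : Type*} [MeasurableSpace Ξ] [m₀ : MeasurableSpace Ω] {μ : Measure Ω}
  {M : Model n p Ω Ξ} {S : Schedule}

/-- All randomness used by agent `q.1` at iteration `q.2 + 1`. -/
def source (M : Model n p Ω Ξ) (q : Fin n × ℕ) (ω : Ω) : Ξ × Metric.sphere (0 : Vec p) 1 :=
  (M.c q.1 (q.2 + 1) ω, M.u q.1 (q.2 + 1) ω)

/-- The information contained in the randomness with indices in `A`. -/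
abbrev sourceAlgebra (M : Model n p Ω Ξ) (A : Set (Fin n × ℕ)) : MeasurableSpace Ω :=
  ⨆ q ∈ A, (inferInstance : MeasurableSpace (Ξ × Metric.sphere (0 : Vec p) 1)).comap (M.source q)

/-- The information available before iteration `t`. -/
abbrev past (M : Model n p Ω Ξ) (t : ℕ) : MeasurableSpace Ω :=
  M.sourceAlgebra {q | q.2 + 1 < t}

/-- The information on which the decision `x_{i,t}` may depend: everything before iteration `t`,
all randomness of the other agents at iteration `t`, and the compressor of agent `i`, but not the
direction `u_{i,t}`. -/
abbrev decisionAlgebra (M : Model n p Ω Ξ) (i : Fin n) (t : ℕ) : MeasurableSpace Ω :=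
  M.sourceAlgebra {q | q.2 + 1 < t ∨ (q.2 + 1 = t ∧ q.1 ≠ i)}
    ⊔ (inferInstance : MeasurableSpace Ξ).comap (M.c i t)

omit m₀ in
theorem sourceAlgebra_mono {A A' : Set (Fin n × ℕ)} (h : A ⊆ A') :
    M.sourceAlgebra A ≤ M.sourceAlgebra A' :=
  biSup_mono h

theorem SamplingAssumption.measurable_source (h : M.SamplingAssumption μ) (q : Fin n × ℕ) :
    Measurable (M.source q) := (h.meas_c _ _).prodMk (h.meas_u _ _)

theorem SamplingAssumption.sourceAlgebra_le (h : M.SamplingAssumption μ) (A : Set (Fin n × ℕ)) :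
    M.sourceAlgebra A ≤ m₀ :=
  iSup₂_le fun q _ => (h.measurable_source q).comap_le

theorem SamplingAssumption.decisionAlgebra_le (h : M.SamplingAssumption μ) (i : Fin n) (t : ℕ) :
    M.decisionAlgebra i t ≤ m₀ :=
  sup_le (h.sourceAlgebra_le _) (h.meas_c i t).comap_le

omit m₀ in
theorem past_le_decisionAlgebra (i : Fin n) (t : ℕ) : M.past t ≤ M.decisionAlgebra i t :=
  (sourceAlgebra_mono fun _ hq => .inl hq).trans le_sup_left

omit m₀ in
theorem past_mono {t t' : ℕ} (h : t ≤ t') : M.past t ≤ M.past t' :=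
  sourceAlgebra_mono fun _ hq => lt_of_lt_of_le hq h

omit m₀ in
theorem measurable_source_of_mem {A : Set (Fin n × ℕ)} {q : Fin n × ℕ} (hq : q ∈ A) :
    Measurable[M.sourceAlgebra A] (M.source q) :=
  (comap_measurable (M.source q)).mono
    (le_iSup₂ (f := fun (q : Fin n × ℕ) (_ : q ∈ A) =>
      (inferInstance : MeasurableSpace (Ξ × Metric.sphere (0 : Vec p) 1)).comap (M.source q)) q hq)
    le_rfl

omit m₀ in
theorem measurable_c_past (i : Fin n) {t t' : ℕ} (ht : 1 ≤ t) (htt : t < t') :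
    Measurable[M.past t'] (M.c i t) := by
  obtain ⟨k, rfl⟩ : ∃ k, t = k + 1 := ⟨t - 1, by omega⟩
  exact measurable_fst.comp (measurable_source_of_mem (M := M) (q := (i, k)) (by simpa using htt))

omit m₀ in
theorem measurable_u_past (i : Fin n) {t t' : ℕ} (ht : 1 ≤ t) (htt : t < t') :
    Measurable[M.past t'] (M.u i t) := by
  obtain ⟨k, rfl⟩ : ∃ k, t = k + 1 := ⟨t - 1, by omega⟩
  exact measurable_snd.comp (measurable_source_of_mem (M := M) (q := (i, k)) (by simpa using htt))

omit m₀ in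
theorem measurable_c_decisionAlgebra (i j : Fin n) {t : ℕ} (ht : 1 ≤ t) :
    Measurable[M.decisionAlgebra i t] (M.c j t) := by
  by_cases hij : j = i
  · subst hij
    exact (comap_measurable (M.c j t)).mono le_sup_right le_rfl
  · obtain ⟨k, rfl⟩ : ∃ k, t = k + 1 := ⟨t - 1, by omega⟩
    exact (measurable_fst.comp (measurable_source_of_mem (M := M) (q := (j, k))
      (Or.inr ⟨rfl, hij⟩))).mono le_sup_left le_rfl

theorem SamplingAssumption.indep_sourceAlgebra (h : M.SamplingAssumption μ)
    {A : Set (Fin n × ℕ)} {q : Fin n × ℕ} (hq : q ∉ A) :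
    Indep (M.sourceAlgebra A)
      ((inferInstance : MeasurableSpace (Ξ × Metric.sphere (0 : Vec p) 1)).comap (M.source q))
      μ := by
  have hle : ∀ q, (inferInstance : MeasurableSpace (Ξ × Metric.sphere (0 : Vec p) 1)).comap
      (M.source q) ≤ m₀ := fun q => (h.measurable_source q).comap_le
  have h1 := indep_iSup_of_disjoint hle ((iIndepFun_iff_iIndep _ _ _).1 h.indep)
    (S := A) (T := {q}) (Set.disjoint_singleton_right.2 hq)
  rw [iSup_singleton] at h1
  exact h1

theorem SamplingAssumption.map_c [IsProbabilityMeasure μ] (h : M.SamplingAssumption μ)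
    (hp : 1 ≤ p) (i : Fin n) {t : ℕ} (ht : 1 ≤ t) : μ.map (M.c i t) = M.ν := by
  have := isProbabilityMeasure_uniformSphere hp
  have h1 := congrArg (Measure.map Prod.fst) (h.law i t ht)
  rw [Measure.map_map measurable_fst ((h.meas_c i t).prodMk (h.meas_u i t)),
    Measure.map_fst_prod, measure_univ, one_smul] at h1
  exact h1

theorem SamplingAssumption.map_u [IsProbabilityMeasure μ] (h : M.SamplingAssumption μ)
    (hν : IsProbabilityMeasure M.ν) (hp : 1 ≤ p) (i : Fin n) {t : ℕ} (ht : 1 ≤ t) :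
    μ.map (M.u i t) = uniformSphere p := by
  have := isProbabilityMeasure_uniformSphere hp
  have h1 := congrArg (Measure.map Prod.snd) (h.law i t ht)
  rw [Measure.map_map measurable_snd ((h.meas_c i t).prodMk (h.meas_u i t)),
    Measure.map_snd_prod, measure_univ, one_smul] at h1
  exact h1

theorem SamplingAssumption.indep_c (h : M.SamplingAssumption μ) (i : Fin n) {t : ℕ} (ht : 1 ≤ t) :
    Indep (M.past t) ((inferInstance : MeasurableSpace Ξ).comap (M.c i t)) μ := by
  obtain ⟨k, rfl⟩ : ∃ k, t = k + 1 := ⟨t - 1, by omega⟩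
  have h1 := h.indep_sourceAlgebra (A := {q | q.2 + 1 < k + 1}) (q := (i, k)) (by simp)
  refine indep_of_indep_of_le_right h1 ?_
  exact (measurable_fst.comp (comap_measurable (M.source (i, k)))).comap_le

theorem SamplingAssumption.indep_u [IsProbabilityMeasure μ] (h : M.SamplingAssumption μ)
    (hν : IsProbabilityMeasure M.ν) (hp : 1 ≤ p) (i : Fin n) {t : ℕ} (ht : 1 ≤ t) :
    Indep (M.decisionAlgebra i t)
      ((inferInstance : MeasurableSpace (Metric.sphere (0 : Vec p) 1)).comap (M.u i t)) μ := by
  have h2 : IndepFun (M.c i t) (M.u i t) μ := by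
    rw [indepFun_iff_map_prod_eq_prod_map_map (h.meas_c i t).aemeasurable
      (h.meas_u i t).aemeasurable, h.map_c hp i ht, h.map_u hν hp i ht]
    exact h.law i t ht
  refine indep_sup_comap (h.sourceAlgebra_le _) (h.meas_c i t) (h.meas_u i t) ?_ h2
  obtain ⟨k, rfl⟩ : ∃ k, t = k + 1 := ⟨t - 1, by omega⟩
  exact h.indep_sourceAlgebra (q := (i, k)) (by simp)

end Model

end BanditCompressed

namespace BanditCompressed

/-! ### Measurability and moments of the iterates -/

/-- The relations between the parameter sequences that the analysis of a single iteration uses. -/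
structure Schedule.IsCoupled (S : Schedule) (r γ₀ : ℝ) : Prop where
  α_pos : ∀ t, 1 ≤ t → 0 < S.α t
  α_lt_one : ∀ t, 1 ≤ t → S.α t < 1
  α_anti : ∀ t, 1 ≤ t → S.α (t + 1) ≤ S.α t
  γ_eq : ∀ t, 1 ≤ t → S.γ t = γ₀ / S.α t
  ξ_eq : ∀ t, 1 ≤ t → S.ξ t = S.α t
  δ_eq : ∀ t, 1 ≤ t → S.δ t = r * S.α t
  s_pos : ∀ t, 1 ≤ t → 0 < S.s t

theorem aestronglyMeasurable_finset_sum {Ω ι F : Type*} {m m₀ : MeasurableSpace Ω}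
    {μ : Measure[m₀] Ω} [NormedAddCommGroup F] {f : ι → Ω → F} (s : Finset ι)
    (hf : ∀ i, AEStronglyMeasurable[m] (f i) μ) :
    AEStronglyMeasurable[m] (fun ω => ∑ i ∈ s, f i ω) μ := by
  classical
  induction s using Finset.induction_on with
  | empty => simpa using aestronglyMeasurable_const
  | insert i s hi ih =>
    simp only [Finset.sum_insert hi]
    exact (hf i).add ih

namespace Problem

variable {n p : ℕ} {P : Problem n p} {r R G₁ G₂ L : ℝ}

theorem GradientAssumption.continuousOn_g (h : P.GradientAssumption G₁ G₂) {i : Fin n} {t : ℕ}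
    (ht : 1 ≤ t) : ContinuousOn (P.g i t) P.dom := by
  rw [(PiLp.homeomorph 2 fun _ : Fin (P.m i) => ℝ).isInducing.continuousOn_iff, continuousOn_pi]
  intro k
  have h1 := (h.hasBoundedSubgradients_inner (i := i) ht (v := EuclideanSpace.single k (1 : ℝ))
    (fun l => by
      rw [PiLp.single_apply]
      split_ifs <;> simp)).continuousOn
  change ContinuousOn (fun y => P.g i t y k) P.dom
  simpa [EuclideanSpace.inner_single_left] using h1

theorem continuous_posPart {ι : Type} :
    Continuous (posPart : EuclideanSpace ℝ ι → EuclideanSpace ℝ ι) := by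
  unfold posPart
  fun_prop

theorem GradientAssumption.continuousOn_violation (h : P.GradientAssumption G₁ G₂) {i : Fin n}
    {t : ℕ} (ht : 1 ≤ t) : ContinuousOn (P.violation i t) P.dom :=
  (continuous_posPart.comp_continuousOn (h.continuousOn_g ht)).norm

/-- The pairs of a decision and a direction for which both query points lie in the domain. -/
def queryDomain (P : Problem n p) (δ : ℝ) : Set (Vec p × Metric.sphere (0 : Vec p) 1) :=
  {q | q.1 ∈ P.dom ∧ q.1 + δ • (q.2 : Vec p) ∈ P.dom}

theorem DomainAssumption.isClosed_queryDomain (hd : P.DomainAssumption) (δ : ℝ) :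
    IsClosed (P.queryDomain δ) :=
  (hd.isClosed.preimage continuous_fst).inter (hd.isClosed.preimage (by fun_prop))

theorem GradientAssumption.continuousOn_estimator (h : P.GradientAssumption G₁ G₂) (γ δ : ℝ)
    {i : Fin n} {t : ℕ} (ht : 1 ≤ t) :
    ContinuousOn (fun q : Vec p × Metric.sphere (0 : Vec p) 1 => P.estimator γ δ i t q.1 q.2)
      (P.queryDomain δ) := by
  have hf : ContinuousOn (P.f i t) P.dom := (h.f_diff i t ht).continuousOn
  have hg := h.continuousOn_g (i := i) ht
  have h1 : Set.MapsTo (fun q : Vec p × Metric.sphere (0 : Vec p) 1 => q.1)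
    (P.queryDomain δ) P.dom := fun q hq => hq.1
  have h2 : Set.MapsTo (fun q : Vec p × Metric.sphere (0 : Vec p) 1 => q.1 + δ • (q.2 : Vec p))
    (P.queryDomain δ) P.dom := fun q hq => hq.2
  have c1 : ContinuousOn (fun q : Vec p × Metric.sphere (0 : Vec p) 1 => q.1)
    (P.queryDomain δ) := by fun_prop
  have c2 : ContinuousOn (fun q : Vec p × Metric.sphere (0 : Vec p) 1 => q.1 + δ • (q.2 : Vec p))
    (P.queryDomain δ) := by fun_prop
  have hv : ContinuousOn (fun q : Vec p × Metric.sphere (0 : Vec p) 1 =>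
      γ • posPart (P.g i t q.1)) (P.queryDomain δ) :=
    (continuous_posPart.comp_continuousOn (hg.comp c1 h1)).const_smul γ
  have l2 := (hf.comp c2 h2).add (hv.inner (𝕜 := ℝ) (hg.comp c2 h2))
  have l1 := (hf.comp c1 h1).add (hv.inner (𝕜 := ℝ) (hg.comp c1 h1))
  have hval : ContinuousOn (fun q : Vec p × Metric.sphere (0 : Vec p) 1 => (q.2 : Vec p))
    (P.queryDomain δ) := by fun_prop
  exact (continuousOn_const.mul (l2.sub l1)).smul hval

end Problem

namespace Model

variable {n p : ℕ} {Ω Ξ : Type*} [MeasurableSpace Ξ] {m : MeasurableSpace Ω}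
  [m₀ : MeasurableSpace Ω] {μ : Measure Ω}
  {M : Model n p Ω Ξ} {S : Schedule} {r R G₁ G₂ L w C γ₀ : ℝ} {B : ℕ}

/-- The compression error `ẑ_{j,t} - z_{j,t}`. -/
noncomputable def compErr (M : Model n p Ω Ξ) (S : Schedule) (t : ℕ) (j : Fin n) (ω : Ω) : Vec p :=
  M.newZhat S ω t (M.state S ω t) j - (M.state S ω t).z j

/-- The fluctuation of the two-point estimator around its mean over the direction. -/
noncomputable def noise (M : Model n p Ω Ξ) (S : Schedule) (t : ℕ) (j : Fin n) (ω : Ω) : Vec p :=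
  M.estimator (S.γ t) (S.δ t) j t (M.x S ω j t) (M.u j t ω)
    - M.meanEstimator (S.γ t) (S.δ t) j t (M.x S ω j t)

omit m₀ in
theorem x_eq_sum (ω : Ω) (i : Fin n) (t : ℕ) :
    M.x S ω i t = ∑ j, M.W t i j • ((M.state S ω t).z j + M.compErr S t j ω) := by
  simp only [x, newX, compErr, add_sub_cancel]

omit m₀ in
theorem direction_eq (ω : Ω) (t : ℕ) (i : Fin n) (x : Vec p) :
    M.direction S ω t i x = M.estimator (S.γ t) (S.δ t) i t x (M.u i t ω) := by
  ext a
  simp only [direction, Problem.estimator, twoPointGrad, twoPointJac, dual, Problem.lagrangian,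
    PiLp.add_apply, PiLp.smul_apply, Matrix.mulVec, dotProduct, Matrix.of_apply, smul_eq_mul,
    PiLp.inner_apply, RCLike.inner_apply, conj_trivial]
  have h : ∀ y y' : EuclideanSpace ℝ (Fin (M.m i)), ∀ v : EuclideanSpace ℝ (Fin (M.m i)),
      ∑ k, (p : ℝ) / S.δ t * (y k - y' k) * ((M.u i t ω : Vec p) a) * v k
        = (p : ℝ) / S.δ t * (∑ k, y k * v k - ∑ k, y' k * v k) * (M.u i t ω : Vec p) a := by
    intro y y' v
    rw [← Finset.sum_sub_distrib, Finset.mul_sum, Finset.sum_mul]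
    exact Finset.sum_congr rfl fun k _ => by ring
  have h' := h (M.g i t (x + S.δ t • (M.u i t ω : Vec p))) (M.g i t x)
    (S.γ t • posPart (M.g i t x))
  simp only [PiLp.smul_apply, smul_eq_mul] at h'
  rw [h']
  ring

omit m₀ in
theorem state_succ (ω : Ω) {t : ℕ} (ht : 1 ≤ t) :
    M.state S ω (t + 1) = M.step S ω t (M.state S ω t) := by
  obtain ⟨k, rfl⟩ : ∃ k, t = k + 1 := ⟨t - 1, by omega⟩
  rfl

omit m₀ in
theorem z_succ (ω : Ω) (i : Fin n) {t : ℕ} (ht : 1 ≤ t) :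
    (M.state S ω (t + 1)).z i = proj ((1 - S.ξ (t + 1)) • M.X)
      (M.x S ω i t - S.α t • M.estimator (S.γ t) (S.δ t) i t (M.x S ω i t) (M.u i t ω)) := by
  rw [state_succ ω ht, ← direction_eq]
  rfl

theorem Admissible.z_mem (h : M.Admissible S μ r R G₁ G₂ L w B C) (hr : 0 < r)
    (hS : S.IsCoupled r γ₀) (ω : Ω) (i : Fin n) {t : ℕ} (ht : 1 ≤ t) :
    (M.state S ω t).z i ∈ (1 - S.α t) • M.X := by
  obtain ⟨k, rfl⟩ : ∃ k, t = k + 1 := ⟨t - 1, by omega⟩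
  rcases Nat.eq_zero_or_pos k with rfl | hk
  · rw [← hS.ξ_eq 1 le_rfl]
    exact h.init i
  · rw [z_succ ω i hk, hS.ξ_eq _ ht]
    exact (proj_spec (h.set.nonempty_smul hr _)
      (h.set.isClosed_smul (sub_pos.2 (hS.α_lt_one _ ht))) _).1

theorem Admissible.z_mem_X (h : M.Admissible S μ r R G₁ G₂ L w B C) (hr : 0 < r)
    (hS : S.IsCoupled r γ₀) (ω : Ω) (i : Fin n) {t : ℕ} (ht : 1 ≤ t) :
    (M.state S ω t).z i ∈ M.X :=
  h.set.smul_subset hr (by linarith [hS.α_lt_one t ht]) (by linarith [hS.α_pos t ht])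
    (h.z_mem hr hS ω i ht)

/-! Measurability with respect to a σ-algebra `m` that knows the past and possibly some of the
randomness of iteration `t`. -/

theorem aestronglyMeasurable_newZhat (hc : M.CompressorAssumption C) {t : ℕ} {j : Fin n}
    (hcm : Measurable[m] (M.c j t))
    (hz : AEStronglyMeasurable[m] (fun ω => (M.state S ω t).z j) μ)
    (hzh : AEStronglyMeasurable[m] (fun ω => (M.state S ω t).zhat j) μ) :
    AEStronglyMeasurable[m] (fun ω => M.newZhat S ω t (M.state S ω t) j) μ := by
  have hin : AEStronglyMeasurable[m] (fun ω => compInput S t (M.state S ω t) j) μ :=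
    (hz.sub hzh).const_smul (S.s t)⁻¹
  have hcomp : AEStronglyMeasurable[m]
      (fun ω => M.compress (M.c j t ω) (compInput S t (M.state S ω t) j)) μ := by
    refine ⟨fun ω => M.compress (M.c j t ω) (hin.mk _ ω), ?_, ?_⟩
    · exact (hc.meas.comp (hcm.prodMk hin.stronglyMeasurable_mk.measurable)).stronglyMeasurable
    · filter_upwards [hin.ae_eq_mk] with ω hω
      rw [← hω]
  have := hzh.add (hcomp.const_smul (S.s t))
  exact this

theorem aestronglyMeasurable_x (hc : M.CompressorAssumption C) {t : ℕ} (i : Fin n)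
    (hcm : ∀ j, Measurable[m] (M.c j t))
    (hz : ∀ j, AEStronglyMeasurable[m] (fun ω => (M.state S ω t).z j) μ)
    (hzh : ∀ j, AEStronglyMeasurable[m] (fun ω => (M.state S ω t).zhat j) μ) :
    AEStronglyMeasurable[m] (fun ω => M.x S ω i t) μ := by
  unfold x newX
  refine aestronglyMeasurable_finset_sum Finset.univ fun j => ?_
  have := (aestronglyMeasurable_newZhat hc (hcm j) (hz j) (hzh j)).const_smul (M.W t i j)
  exact this

theorem Admissible.mem_queryDomain (h : M.Admissible S μ r R G₁ G₂ L w B C) (i : Fin n) {t : ℕ}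
    (ht : 1 ≤ t) : ∀ᵐ ω ∂μ, (M.x S ω i t, M.u i t ω) ∈ M.queryDomain (S.δ t) := by
  filter_upwards [h.wellDefined] with ω hω
  exact (hω i t ht).2

theorem Admissible.aestronglyMeasurable_estimator (h : M.Admissible S μ r R G₁ G₂ L w B C)
    {i : Fin n} {t : ℕ} (ht : 1 ≤ t) (hx : AEStronglyMeasurable[m] (fun ω => M.x S ω i t) μ)
    (hu : Measurable[m] (M.u i t)) :
    AEStronglyMeasurable[m]
      (fun ω => M.estimator (S.γ t) (S.δ t) i t (M.x S ω i t) (M.u i t ω)) μ :=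
  aestronglyMeasurable_comp_of_continuousOn
    (φ := fun q : Vec p × Metric.sphere (0 : Vec p) 1 => M.estimator (S.γ t) (S.δ t) i t q.1 q.2)
    (X := fun ω => (M.x S ω i t, M.u i t ω)) (h.domain.isClosed_queryDomain _)
    (h.gradient.continuousOn_estimator _ _ ht)
    (hx.prodMk hu.stronglyMeasurable.aestronglyMeasurable) (h.mem_queryDomain i ht)

theorem Admissible.aestronglyMeasurable_state (h : M.Admissible S μ r R G₁ G₂ L w B C)
    (hr : 0 < r) (hS : S.IsCoupled r γ₀) {t : ℕ} (ht : 1 ≤ t) :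
    (∀ i, AEStronglyMeasurable[M.past t] (fun ω => (M.state S ω t).z i) μ) ∧
      ∀ i, AEStronglyMeasurable[M.past t] (fun ω => (M.state S ω t).zhat i) μ := by
  induction t, ht using Nat.le_induction with
  | base => exact ⟨fun i => aestronglyMeasurable_const, fun i => aestronglyMeasurable_const⟩
  | succ t ht ih =>
    have hle : M.past t ≤ M.past (t + 1) := past_mono (Nat.le_succ t)
    have hz := fun i => (ih.1 i).mono hle
    have hzh := fun i => (ih.2 i).mono hle
    have hc := fun j => M.measurable_c_past j ht (Nat.lt_succ_self t)
    refine ⟨fun i => ?_, fun i => ?_⟩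
    · have hx := aestronglyMeasurable_x h.compressor i hc hz hzh
      have hb := h.aestronglyMeasurable_estimator ht hx
        (M.measurable_u_past i ht (Nat.lt_succ_self t))
      simp only [z_succ _ i ht]
      have ht' : 1 ≤ t + 1 := by omega
      rw [hS.ξ_eq _ ht']
      have hpos := sub_pos.2 (hS.α_lt_one _ ht')
      exact (continuous_proj (h.set.nonempty_smul hr _) (h.set.isClosed_smul hpos)
        (h.set.convex.smul _)).comp_aestronglyMeasurable (hx.sub (hb.const_smul (S.α t)))
    · simp only [state_succ _ ht, step]
      exact aestronglyMeasurable_newZhat h.compressor (hc i) (hz i) (hzh i)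

theorem Admissible.aestronglyMeasurable_x_past (h : M.Admissible S μ r R G₁ G₂ L w B C)
    (hr : 0 < r) (hS : S.IsCoupled r γ₀) (i : Fin n) {t : ℕ} (ht : 1 ≤ t) :
    AEStronglyMeasurable[M.past (t + 1)] (fun ω => M.x S ω i t) μ := by
  have hle : M.past t ≤ M.past (t + 1) := past_mono (Nat.le_succ t)
  obtain ⟨hz, hzh⟩ := h.aestronglyMeasurable_state hr hS ht
  exact aestronglyMeasurable_x h.compressor i
    (fun j => M.measurable_c_past j ht (Nat.lt_succ_self t))
    (fun j => (hz j).mono hle) (fun j => (hzh j).mono hle)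

theorem Admissible.aestronglyMeasurable_x_decision (h : M.Admissible S μ r R G₁ G₂ L w B C)
    (hr : 0 < r) (hS : S.IsCoupled r γ₀) (i : Fin n) {t : ℕ} (ht : 1 ≤ t) :
    AEStronglyMeasurable[M.decisionAlgebra i t] (fun ω => M.x S ω i t) μ := by
  have hle : M.past t ≤ M.decisionAlgebra i t := past_le_decisionAlgebra i t
  obtain ⟨hz, hzh⟩ := h.aestronglyMeasurable_state hr hS ht
  exact aestronglyMeasurable_x h.compressor i
    (fun j => M.measurable_c_decisionAlgebra i j ht)
    (fun j => (hz j).mono hle) (fun j => (hzh j).mono hle)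

/-- Almost surely the whole sphere around the decision, up to a null set, may be queried. -/
theorem Admissible.ae_ae_mem_dom [IsProbabilityMeasure μ]
    (h : M.Admissible S μ r R G₁ G₂ L w B C) (hp : 1 ≤ p)
    (hr : 0 < r) (hS : S.IsCoupled r γ₀) (i : Fin n) {t : ℕ} (ht : 1 ≤ t) :
    ∀ᵐ ω ∂μ, ∀ᵐ v : Metric.sphere (0 : Vec p) 1 ∂uniformSphere p,
      M.x S ω i t + S.δ t • (v : Vec p) ∈ M.dom := by
  have h1 := ae_ae_fresh (h.sampling.decisionAlgebra_le i t)
    (h.aestronglyMeasurable_x_decision hr hS i ht) (h.sampling.meas_u i t)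
    (h.sampling.indep_u h.compressor.prob hp i ht)
    (h.domain.isClosed_queryDomain (S.δ t)).measurableSet (h.mem_queryDomain i ht)
  rw [h.sampling.map_u h.compressor.prob hp i ht] at h1
  filter_upwards [h1] with ω hω
  filter_upwards [hω] with v hv
  exact hv.2

theorem Admissible.aestronglyMeasurable_meanEstimator [IsProbabilityMeasure μ]
    (h : M.Admissible S μ r R G₁ G₂ L w B C) (hp : 1 ≤ p)
    (hr : 0 < r) (hS : S.IsCoupled r γ₀) (i : Fin n) {t : ℕ} (ht : 1 ≤ t)
    (hx : AEStronglyMeasurable[m] (fun ω => M.x S ω i t) μ) :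
    AEStronglyMeasurable[m] (fun ω => M.meanEstimator (S.γ t) (S.δ t) i t (M.x S ω i t)) μ := by
  have := isProbabilityMeasure_uniformSphere hp
  set K : Vec p × Metric.sphere (0 : Vec p) 1 → Vec p :=
    (M.queryDomain (S.δ t)).indicator fun q => M.estimator (S.γ t) (S.δ t) i t q.1 q.2 with hK
  have hKm : StronglyMeasurable K := stronglyMeasurable_indicator_of_continuousOn
    (h.domain.isClosed_queryDomain _) (h.gradient.continuousOn_estimator _ _ ht)
  have hKint : StronglyMeasurable fun x => ∫ v, K (x, v) ∂uniformSphere p :=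
    hKm.integral_prod_right'
  refine ⟨fun ω => ∫ v, K (hx.mk _ ω, v) ∂uniformSphere p,
    hKint.comp_measurable hx.stronglyMeasurable_mk.measurable, ?_⟩
  filter_upwards [hx.ae_eq_mk, h.wellDefined, h.ae_ae_mem_dom hp hr hS i ht] with ω h1 h2 h3
  rw [← h1]
  refine integral_congr_ae ?_
  filter_upwards [h3] with v hv
  rw [hK, Set.indicator_of_mem]
  exact ⟨(h2 i t ht).2.1, hv⟩

theorem Admissible.aestronglyMeasurable_noise [IsProbabilityMeasure μ]
    (h : M.Admissible S μ r R G₁ G₂ L w B C) (hp : 1 ≤ p)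
    (hr : 0 < r) (hS : S.IsCoupled r γ₀) (i : Fin n) {t : ℕ} (ht : 1 ≤ t) :
    AEStronglyMeasurable[M.past (t + 1)] (M.noise S t i) μ := by
  have hx := h.aestronglyMeasurable_x_past hr hS i ht
  exact (h.aestronglyMeasurable_estimator ht hx
    (M.measurable_u_past i ht (Nat.lt_succ_self t))).sub
    (h.aestronglyMeasurable_meanEstimator hp hr hS i ht hx)

/-- The noise of iteration `t` is orthogonal to everything known when `x_{i,t}` is chosen. -/
theorem Admissible.integral_inner_noise [IsProbabilityMeasure μ]
    (h : M.Admissible S μ r R G₁ G₂ L w B C) (hp : 1 ≤ p)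
    (hr : 0 < r) (hγ₀ : 0 < γ₀) (hS : S.IsCoupled r γ₀) (i : Fin n) {t : ℕ} (ht : 1 ≤ t)
    {φ : Ω → Vec p} (hφ : AEStronglyMeasurable[M.decisionAlgebra i t] φ μ)
    (hint : Integrable (fun ω => inner ℝ (M.noise S t i ω) (φ ω)) μ) :
    ∫ ω, inner ℝ (M.noise S t i ω) (φ ω) ∂μ = 0 := by
  set K : Vec p × Metric.sphere (0 : Vec p) 1 → Vec p :=
    (M.queryDomain (S.δ t)).indicator fun q => M.estimator (S.γ t) (S.δ t) i t q.1 q.2 with hK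
  have hKm : StronglyMeasurable K := stronglyMeasurable_indicator_of_continuousOn
    (h.domain.isClosed_queryDomain _) (h.gradient.continuousOn_estimator _ _ ht)
  have hmap := h.sampling.map_u h.compressor.prob hp i ht
  have hγ : 0 ≤ S.γ t := by
    rw [hS.γ_eq t ht]
    have := hS.α_pos t ht
    positivity
  have hδ : 0 < S.δ t := by
    rw [hS.δ_eq t ht]
    have := hS.α_pos t ht
    positivity
  have hgood := h.ae_ae_mem_dom hp hr hS i ht
  have hKeq : ∀ᵐ ω ∂μ, (fun v => K (M.x S ω i t, v)) =ᵐ[uniformSphere p]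
      fun v => M.estimator (S.γ t) (S.δ t) i t (M.x S ω i t) v := by
    filter_upwards [h.wellDefined, hgood] with ω h2 h3
    filter_upwards [h3] with v hv
    rw [hK, Set.indicator_of_mem]
    exact ⟨(h2 i t ht).2.1, hv⟩
  have heq : (fun ω => inner ℝ (K (M.x S ω i t, M.u i t ω)
      - ∫ v, K (M.x S ω i t, v) ∂(μ.map (M.u i t))) (φ ω))
      =ᵐ[μ] fun ω => inner ℝ (M.noise S t i ω) (φ ω) := by
    filter_upwards [h.mem_queryDomain i ht, hKeq] with ω h1 h2
    rw [hmap, integral_congr_ae h2, hK, Set.indicator_of_mem h1]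
    rfl
  rw [← integral_congr_ae heq]
  refine integral_inner_fresh_eq_zero (h.sampling.decisionAlgebra_le i t)
    (h.aestronglyMeasurable_x_decision hr hS i ht) (h.sampling.meas_u i t)
    (h.sampling.indep_u h.compressor.prob hp i ht) hφ hKm ?_ (hint.congr heq.symm)
  rw [hmap]
  filter_upwards [h.wellDefined, hgood, hKeq] with ω h2 h3 h4
  exact (integrable_congr h4).2
    (h.gradient.integrable_estimator h.domain hp hγ hδ ht (h2 i t ht).2.1 h3)

/-! Second moments. -/

theorem Admissible.aestronglyMeasurable_compErr (h : M.Admissible S μ r R G₁ G₂ L w B C)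
    (hr : 0 < r) (hS : S.IsCoupled r γ₀) (j : Fin n) {t : ℕ} (ht : 1 ≤ t) :
    AEStronglyMeasurable (M.compErr S t j) μ := by
  obtain ⟨hz, hzh⟩ := h.aestronglyMeasurable_state hr hS ht
  have hz' := (hz j).mono (h.sampling.sourceAlgebra_le _)
  exact (aestronglyMeasurable_newZhat h.compressor (h.sampling.meas_c j t) hz'
    ((hzh j).mono (h.sampling.sourceAlgebra_le _))).sub hz'

/-- The input of the compressor is scaled by `1 / s_t`, so the error is of order `s_t` whatever the
size of the input. Square integrability of the iterates is a consequence, not an assumption. -/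
theorem Admissible.compErr_moment [IsProbabilityMeasure μ]
    (h : M.Admissible S μ r R G₁ G₂ L w B C) (hp : 1 ≤ p)
    (hr : 0 < r) (hS : S.IsCoupled r γ₀) (j : Fin n) {t : ℕ} (ht : 1 ≤ t) :
    MemLp (M.compErr S t j) 2 μ ∧ ∫ ω, ‖M.compErr S t j ω‖ ^ 2 ∂μ ≤ C * S.s t ^ 2 := by
  have hs := hS.s_pos t ht
  have hm := h.aestronglyMeasurable_compErr hr hS j ht
  have hC : 0 ≤ C := by
    obtain ⟨ω, hω⟩ := h.wellDefined.exists
    exact (integral_nonneg fun a => by positivity).trans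
      (h.compressor.error _ (hω j t ht).1).2
  obtain ⟨hz, hzh⟩ := h.aestronglyMeasurable_state hr hS ht
  have hin : AEStronglyMeasurable[M.past t] (fun ω => compInput S t (M.state S ω t) j) μ :=
    ((hz j).sub (hzh j)).const_smul (S.s t)⁻¹
  have heq : ∀ ω, M.compErr S t j ω = S.s t •
      (M.compress (M.c j t ω) (compInput S t (M.state S ω t) j)
        - compInput S t (M.state S ω t) j) := by
    intro ω
    rw [compErr, newZhat, smul_sub]
    nth_rewrite 3 [compInput]
    rw [smul_smul, mul_inv_cancel₀ hs.ne', one_smul]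
    abel
  let F : Vec p × Ξ → ENNReal := fun q => ENNReal.ofReal (‖M.compress q.2 q.1 - q.1‖ ^ 2)
  have hF : Measurable F := by
    refine ENNReal.measurable_ofReal.comp (Measurable.pow_const (Measurable.norm ?_) 2)
    exact (h.compressor.meas.comp measurable_swap).sub measurable_fst
  have h1 : ∫⁻ ω, F (compInput S t (M.state S ω t) j, M.c j t ω) ∂μ ≤ ENNReal.ofReal C := by
    rw [lintegral_fresh (h.sampling.sourceAlgebra_le _) hin (h.sampling.meas_c j t)
      (h.sampling.indep_c j ht) hF, h.sampling.map_c hp j ht]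
    calc _ ≤ ∫⁻ _, ENNReal.ofReal C ∂μ := lintegral_mono_ae ?_
      _ = ENNReal.ofReal C := by simp
    filter_upwards [h.wellDefined] with ω hω
    obtain ⟨hi, hle⟩ := h.compressor.error _ (hω j t ht).1
    simp only [F]
    rw [← ofReal_integral_eq_lintegral_ofReal hi (.of_forall fun a => by positivity)]
    exact ENNReal.ofReal_le_ofReal hle
  have h2 : ∫⁻ ω, ENNReal.ofReal (‖M.compErr S t j ω‖ ^ 2) ∂μ ≤ ENNReal.ofReal (C * S.s t ^ 2) := by
    have : ∀ ω, ENNReal.ofReal (‖M.compErr S t j ω‖ ^ 2)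
        = ENNReal.ofReal (S.s t ^ 2) * F (compInput S t (M.state S ω t) j, M.c j t ω) := by
      intro ω
      rw [heq, norm_smul, mul_pow, Real.norm_of_nonneg hs.le, ENNReal.ofReal_mul (by positivity)]
    simp_rw [this]
    rw [lintegral_const_mul' _ _ ENNReal.ofReal_ne_top, mul_comm C,
      ENNReal.ofReal_mul (by positivity)]
    gcongr
  have h3 : Integrable (fun ω => ‖M.compErr S t j ω‖ ^ 2) μ := by
    refine ⟨(hm.norm.pow 2), ?_⟩
    rw [hasFiniteIntegral_iff_ofReal (.of_forall fun ω => by positivity)]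
    exact h2.trans_lt ENNReal.ofReal_lt_top
  refine ⟨(memLp_two_iff_integrable_sq_norm hm).2 h3, ?_⟩
  rw [← ofReal_integral_eq_lintegral_ofReal h3 (.of_forall fun ω => by positivity)] at h2
  exact (ENNReal.ofReal_le_ofReal_iff (by positivity)).1 h2

theorem Admissible.memLp_x [IsProbabilityMeasure μ]
    (h : M.Admissible S μ r R G₁ G₂ L w B C) (hp : 1 ≤ p)
    (hr : 0 < r) (hS : S.IsCoupled r γ₀) (i : Fin n) {t : ℕ} (ht : 1 ≤ t) :
    MemLp (fun ω => M.x S ω i t) 2 μ := by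
  have hz : ∀ j, MemLp (fun ω => (M.state S ω t).z j) 2 μ := fun j =>
    MemLp.of_bound (((h.aestronglyMeasurable_state hr hS ht).1 j).mono
      (h.sampling.sourceAlgebra_le _)) R
      (.of_forall fun ω => h.set.norm_le (h.z_mem_X hr hS ω j ht))
  simp only [x_eq_sum]
  refine memLp_finsetSum _ fun j _ => ?_
  have := ((hz j).add (h.compErr_moment hp hr hS j ht).1).const_smul (M.W t i j)
  exact this

theorem Admissible.memLp_violation [IsProbabilityMeasure μ]
    (h : M.Admissible S μ r R G₁ G₂ L w B C) (hp : 1 ≤ p)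
    (hr : 0 < r) (hS : S.IsCoupled r γ₀) (i j : Fin n) {t : ℕ} (ht : 1 ≤ t) :
    MemLp (fun ω => M.violation j t (M.x S ω i t)) 2 μ := by
  have h0 := h.domain.X_subset (h.set.zero_mem hr)
  have hx := h.memLp_x hp hr hS i ht
  have hxd : ∀ᵐ ω ∂μ, M.x S ω i t ∈ M.dom := by
    filter_upwards [h.wellDefined] with ω hω
    exact (hω i t ht).2.1
  have hg : MemLp (fun ω => M.violation j t 0 + G₂ * ‖M.x S ω i t‖) 2 μ :=
    (memLp_const (M.violation j t 0)).add (hx.norm.const_mul G₂)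
  have hm : AEStronglyMeasurable (fun ω => M.violation j t (M.x S ω i t)) μ :=
    aestronglyMeasurable_comp_of_continuousOn (φ := M.violation j t)
      (X := fun ω => M.x S ω i t) h.domain.isClosed
      (h.gradient.continuousOn_violation ht) hx.aestronglyMeasurable hxd
  refine hg.mono hm ?_
  filter_upwards [hxd] with ω hω
  have h1 := h.gradient.violation_le (i := j) ht hω h0
  rw [sub_zero] at h1
  rw [Real.norm_of_nonneg (Problem.violation_nonneg _ _ _)]
  exact h1.trans (le_abs_self _)

theorem Admissible.ae_norm_estimator_le [IsProbabilityMeasure μ]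
    (h : M.Admissible S μ r R G₁ G₂ L w B C)
    (hr : 0 < r) (hγ₀ : 0 < γ₀) (hS : S.IsCoupled r γ₀) (i : Fin n) {t : ℕ} (ht : 1 ≤ t) :
    ∀ᵐ ω ∂μ, ‖M.estimator (S.γ t) (S.δ t) i t (M.x S ω i t) (M.u i t ω)‖
      ≤ p * (G₁ + G₂ * (S.γ t * M.violation i t (M.x S ω i t))) := by
  have hα := hS.α_pos t ht
  have hγ : 0 ≤ S.γ t := by rw [hS.γ_eq t ht]; positivity
  have hδ : 0 < S.δ t := by rw [hS.δ_eq t ht]; positivity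
  filter_upwards [h.mem_queryDomain i ht] with ω hω
  exact h.gradient.norm_estimator_le h.domain hγ hδ ht hω.1 hω.2

theorem Admissible.ae_norm_noise_le [IsProbabilityMeasure μ]
    (h : M.Admissible S μ r R G₁ G₂ L w B C) (hp : 1 ≤ p)
    (hr : 0 < r) (hγ₀ : 0 < γ₀) (hS : S.IsCoupled r γ₀) (i : Fin n) {t : ℕ} (ht : 1 ≤ t) :
    ∀ᵐ ω ∂μ, ‖M.noise S t i ω‖
      ≤ 2 * (p * (G₁ + G₂ * (S.γ t * M.violation i t (M.x S ω i t)))) := by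
  have hα := hS.α_pos t ht
  have hγ : 0 ≤ S.γ t := by rw [hS.γ_eq t ht]; positivity
  have hδ : 0 < S.δ t := by rw [hS.δ_eq t ht]; positivity
  filter_upwards [h.mem_queryDomain i ht, h.ae_norm_estimator_le hr hγ₀ hS i ht,
    h.ae_ae_mem_dom hp hr hS i ht] with ω h1 h2 h3
  have h4 := h.gradient.norm_meanEstimator_le h.domain hp hγ hδ ht (i := i) h1.1 h3
  rw [two_mul]
  exact (norm_sub_le _ _).trans (add_le_add h2 h4)

theorem Admissible.memLp_noise [IsProbabilityMeasure μ]
    (h : M.Admissible S μ r R G₁ G₂ L w B C) (hp : 1 ≤ p)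
    (hr : 0 < r) (hγ₀ : 0 < γ₀) (hS : S.IsCoupled r γ₀) (i : Fin n) {t : ℕ} (ht : 1 ≤ t) :
    MemLp (M.noise S t i) 2 μ := by
  have hv := h.memLp_violation hp hr hS i i ht
  have hg : MemLp (fun ω => 2 * (p * (G₁ + G₂ * (S.γ t * M.violation i t (M.x S ω i t))))) 2 μ :=
    (((memLp_const G₁).add ((hv.const_mul (S.γ t)).const_mul G₂)).const_mul (p : ℝ)).const_mul 2
  refine hg.of_le_mul (c := 1)
    ((h.aestronglyMeasurable_noise hp hr hS i ht).mono (h.sampling.sourceAlgebra_le _)) ?_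
  filter_upwards [h.ae_norm_noise_le hp hr hγ₀ hS i ht] with ω hω
  rw [one_mul]
  exact hω.trans (le_abs_self _)

end Model

end BanditCompressed

namespace BanditCompressed

/-! ### Pathwise bounds -/

section DoublyStochastic

variable {n : ℕ} {E : ℕ → Fin n → Fin n → Prop} {W : ℕ → Matrix (Fin n) (Fin n) ℝ} {w : ℝ} {B : ℕ}
  {V : Type*} [NormedAddCommGroup V] [NormedSpace ℝ V]

theorem NetworkAssumption.sum_sum_mul (h : NetworkAssumption E W w B) {t : ℕ} (ht : 1 ≤ t)
    (a : Fin n → ℝ) : ∑ i, ∑ j, W t i j * a j = ∑ j, a j := by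
  rw [Finset.sum_comm]
  refine Finset.sum_congr rfl fun j _ => ?_
  rw [← Finset.sum_mul, h.col_sum t ht, one_mul]

theorem NetworkAssumption.norm_mix_le (h : NetworkAssumption E W w B) (hw : 0 < w) {t : ℕ}
    (ht : 1 ≤ t) (v : Fin n → V) (i : Fin n) :
    ‖∑ j, W t i j • v j‖ ≤ ∑ j, W t i j * ‖v j‖ := by
  refine (norm_sum_le _ _).trans (le_of_eq (Finset.sum_congr rfl fun j _ => ?_))
  rw [norm_smul, Real.norm_of_nonneg (h.weight_nonneg hw ht i j)]

theorem NetworkAssumption.sum_norm_mix_le (h : NetworkAssumption E W w B) (hw : 0 < w) {t : ℕ}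
    (ht : 1 ≤ t) (v : Fin n → V) : ∑ i, ‖∑ j, W t i j • v j‖ ≤ ∑ j, ‖v j‖ :=
  (Finset.sum_le_sum fun i _ => h.norm_mix_le hw ht v i).trans (h.sum_sum_mul ht _).le

theorem NetworkAssumption.sum_norm_sq_mix_le (h : NetworkAssumption E W w B) (hw : 0 < w) {t : ℕ}
    (ht : 1 ≤ t) (v : Fin n → V) : ∑ i, ‖∑ j, W t i j • v j‖ ^ 2 ≤ ∑ j, ‖v j‖ ^ 2 := by
  refine (Finset.sum_le_sum fun i _ => ?_).trans (h.sum_sum_mul ht fun j => ‖v j‖ ^ 2).le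
  have hconv : ConvexOn ℝ Set.univ fun x : V => ‖x‖ ^ 2 :=
    (convexOn_norm convex_univ).pow (fun _ _ => norm_nonneg _) 2
  have := hconv.map_sum_le (t := Finset.univ) (w := fun j => W t i j) (p := v)
    (fun j _ => h.weight_nonneg hw ht i j) (h.row_sum t ht i) (fun j _ => Set.mem_univ _)
  simpa using this

theorem NetworkAssumption.norm_mix_le_sum (h : NetworkAssumption E W w B) (hw : 0 < w) {t : ℕ}
    (ht : 1 ≤ t) (v : Fin n → V) (i : Fin n) : ‖∑ j, W t i j • v j‖ ≤ ∑ j, ‖v j‖ :=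
  (Finset.single_le_sum (f := fun i => ‖∑ j, W t i j • v j‖) (fun _ _ => norm_nonneg _)
    (Finset.mem_univ i)).trans (h.sum_norm_mix_le hw ht v)

end DoublyStochastic

/-- Abel summation against nondecreasing weights. -/
theorem sum_mul_sub_succ_le {a D : ℕ → ℝ} {Dm : ℝ} (ha : ∀ t, 1 ≤ t → 0 ≤ a t)
    (ham : ∀ t, 1 ≤ t → a t ≤ a (t + 1)) (hD : ∀ t, 1 ≤ t → D t ≤ Dm)
    (hD0 : ∀ t, 1 ≤ t → 0 ≤ D t) {T : ℕ} (hT : 1 ≤ T) :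
    ∑ t ∈ Finset.Icc 1 T, a t * (D t - D (t + 1)) ≤ Dm * a T := by
  have key : ∑ t ∈ Finset.Icc 1 T, a t * (D t - D (t + 1)) ≤ Dm * a T - a T * D (T + 1) := by
    induction T, hT using Nat.le_induction with
    | base =>
      simp only [Finset.Icc_self, Finset.sum_singleton]
      nlinarith [mul_le_mul_of_nonneg_left (hD 1 le_rfl) (ha 1 le_rfl)]
    | succ T hT ih =>
      rw [Finset.sum_Icc_succ_top (by omega)]
      have h1 := mul_nonneg (sub_nonneg.2 (ham T hT)) (sub_nonneg.2 (hD (T + 1) (by omega)))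
      nlinarith
  exact key.trans (by linarith [mul_nonneg (ha T hT) (hD0 (T + 1) (by omega))])

namespace Model

variable {n p : ℕ} {Ω Ξ : Type*} [MeasurableSpace Ξ] [m₀ : MeasurableSpace Ω] {μ : Measure Ω}
  {M : Model n p Ω Ξ} {S : Schedule} {r R G₁ G₂ L w C γ₀ : ℝ} {B : ℕ}

/-- An admissible run with coupled parameter sequences and admissible constants. -/
structure TunedRun (M : Model n p Ω Ξ) (S : Schedule) (μ : Measure Ω)
    (r R G₁ G₂ L w : ℝ) (B : ℕ) (C γ₀ : ℝ) : Prop where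
  admissible : M.Admissible S μ r R G₁ G₂ L w B C
  coupled : S.IsCoupled r γ₀
  one_le_n : 1 ≤ n
  one_le_p : 1 ≤ p
  r_pos : 0 < r
  w_pos : 0 < w
  γ₀_pos : 0 < γ₀
  γ₀_le : γ₀ * (4 * ((p : ℝ) ^ 2 + 1) * G₂ ^ 2) ≤ 1
  R_nonneg : 0 ≤ R
  G₁_nonneg : 0 ≤ G₁
  G₂_nonneg : 0 ≤ G₂
  L_nonneg : 0 ≤ L
  C_nonneg : 0 ≤ C

/-- An outcome for which the query points stay in the domain and the estimators obey their
almost sure bounds. -/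
structure IsRegular (M : Model n p Ω Ξ) (S : Schedule) (G₁ G₂ : ℝ) (ω : Ω) : Prop where
  mem_dom : ∀ i t, 1 ≤ t → M.x S ω i t ∈ M.dom
  ae_mem_dom : ∀ i t, 1 ≤ t → ∀ᵐ v : Metric.sphere (0 : Vec p) 1 ∂uniformSphere p,
    M.x S ω i t + S.δ t • (v : Vec p) ∈ M.dom
  estimator_le : ∀ i t, 1 ≤ t →
    ‖M.estimator (S.γ t) (S.δ t) i t (M.x S ω i t) (M.u i t ω)‖
      ≤ p * (G₁ + G₂ * (S.γ t * M.violation i t (M.x S ω i t)))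

theorem TunedRun.ae_isRegular [IsProbabilityMeasure μ]
    (h : M.TunedRun S μ r R G₁ G₂ L w B C γ₀) : ∀ᵐ ω ∂μ, M.IsRegular S G₁ G₂ ω := by
  have h1 : ∀ᵐ ω ∂μ, ∀ i t, 1 ≤ t → ∀ᵐ v : Metric.sphere (0 : Vec p) 1 ∂uniformSphere p,
      M.x S ω i t + S.δ t • (v : Vec p) ∈ M.dom := by
    rw [ae_all_iff]; intro i
    rw [ae_all_iff]; intro t
    exact Filter.eventually_imp_distrib_left.2
      (h.admissible.ae_ae_mem_dom h.one_le_p h.r_pos h.coupled i)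
  have h2 : ∀ᵐ ω ∂μ, ∀ i t, 1 ≤ t →
      ‖M.estimator (S.γ t) (S.δ t) i t (M.x S ω i t) (M.u i t ω)‖
        ≤ p * (G₁ + G₂ * (S.γ t * M.violation i t (M.x S ω i t))) := by
    rw [ae_all_iff]; intro i
    rw [ae_all_iff]; intro t
    exact Filter.eventually_imp_distrib_left.2
      (h.admissible.ae_norm_estimator_le h.r_pos h.γ₀_pos h.coupled i)
  filter_upwards [h.admissible.wellDefined, h1, h2] with ω hw h1 h2
  exact ⟨fun i t ht => (hw i t ht).2.1, h1, h2⟩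

/-- The local violation `‖[g_{i,t}(x_{i,t})]_+‖` along the run. -/
noncomputable def viol (M : Model n p Ω Ξ) (S : Schedule) (t : ℕ) (i : Fin n) (ω : Ω) : ℝ :=
  M.violation i t (M.x S ω i t)

/-- The total compression error at iteration `t`, to first order. -/
noncomputable def errSum (M : Model n p Ω Ξ) (S : Schedule) (t : ℕ) (ω : Ω) : ℝ :=
  ∑ j, ‖M.compErr S t j ω‖

/-- The total compression error at iteration `t`, to second order. -/
noncomputable def errSqSum (M : Model n p Ω Ξ) (S : Schedule) (t : ℕ) (ω : Ω) : ℝ :=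
  ∑ j, ‖M.compErr S t j ω‖ ^ 2

/-- The loss gradient `∇ f_{i,t}(x_{i,t})` along the run. -/
noncomputable def grad (M : Model n p Ω Ξ) (S : Schedule) (t : ℕ) (i : Fin n) (ω : Ω) : Vec p :=
  gradientWithin (M.f i t) M.dom (M.x S ω i t)

omit m₀ in
theorem errSum_nonneg (t : ℕ) (ω : Ω) : 0 ≤ M.errSum S t ω :=
  Finset.sum_nonneg fun _ _ => norm_nonneg _

omit m₀ in
theorem errSqSum_nonneg (t : ℕ) (ω : Ω) : 0 ≤ M.errSqSum S t ω :=
  Finset.sum_nonneg fun _ _ => by positivity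

omit m₀ in
theorem x_sub_eq {E : ℕ → Fin n → Fin n → Prop} (hE : NetworkAssumption E M.W w B) (ω : Ω)
    (i : Fin n) {t : ℕ} (ht : 1 ≤ t) (y : Vec p) :
    M.x S ω i t - y = ∑ j, M.W t i j • ((M.state S ω t).z j - y + M.compErr S t j ω) := by
  rw [x_eq_sum]
  simp only [smul_add, smul_sub, Finset.sum_add_distrib, Finset.sum_sub_distrib]
  rw [← Finset.sum_smul, hE.row_sum t ht, one_smul]
  abel

theorem TunedRun.norm_z_sub_le (h : M.TunedRun S μ r R G₁ G₂ L w B C γ₀) (ω : Ω) (i : Fin n)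
    {t : ℕ} (ht : 1 ≤ t) {y : Vec p} (hy : y ∈ M.X) : ‖(M.state S ω t).z i - y‖ ≤ 2 * R := by
  have h1 := h.admissible.set.norm_le (h.admissible.z_mem_X h.r_pos h.coupled ω i ht)
  have h2 := h.admissible.set.norm_le hy
  exact (norm_sub_le _ _).trans (by linarith)

theorem TunedRun.sum_norm_x_sub_le (h : M.TunedRun S μ r R G₁ G₂ L w B C γ₀) (ω : Ω)
    {t : ℕ} (ht : 1 ≤ t) {y : Vec p} (hy : y ∈ M.X) :
    ∑ i, ‖M.x S ω i t - y‖ ≤ n * (2 * R) + M.errSum S t ω := by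
  simp only [x_sub_eq h.admissible.network ω _ ht y]
  refine (h.admissible.network.sum_norm_mix_le h.w_pos ht _).trans ?_
  calc _ ≤ ∑ j : Fin n, (2 * R + ‖M.compErr S t j ω‖) := Finset.sum_le_sum fun j _ =>
        (norm_add_le _ _).trans (add_le_add (h.norm_z_sub_le ω j ht hy) le_rfl)
    _ = _ := by
        rw [Finset.sum_add_distrib]
        simp [errSum]

theorem TunedRun.sum_norm_sq_x_sub_le (h : M.TunedRun S μ r R G₁ G₂ L w B C γ₀) (ω : Ω)
    {t : ℕ} (ht : 1 ≤ t) {y : Vec p} (hy : y ∈ M.X) :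
    ∑ i, ‖M.x S ω i t - y‖ ^ 2 ≤ ∑ i, ‖(M.state S ω t).z i - y‖ ^ 2
      + 4 * R * M.errSum S t ω + M.errSqSum S t ω := by
  simp only [x_sub_eq h.admissible.network ω _ ht y]
  refine (h.admissible.network.sum_norm_sq_mix_le h.w_pos ht _).trans ?_
  rw [errSum, errSqSum, Finset.mul_sum, ← Finset.sum_add_distrib, ← Finset.sum_add_distrib]
  refine Finset.sum_le_sum fun j _ => ?_
  have h1 := h.norm_z_sub_le ω j ht hy
  have h2 := norm_add_le ((M.state S ω t).z j - y) (M.compErr S t j ω)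
  have h3 := pow_le_pow_left₀ (norm_nonneg _) h2 2
  nlinarith [mul_le_mul_of_nonneg_right h1 (norm_nonneg (M.compErr S t j ω))]

theorem TunedRun.shrink_mem (h : M.TunedRun S μ r R G₁ G₂ L w B C γ₀) {t : ℕ} (ht : 1 ≤ t)
    {y : Vec p} (hy : y ∈ M.X) : (1 - S.α t) • y ∈ M.X :=
  h.admissible.set.smul_subset h.r_pos (by linarith [h.coupled.α_lt_one t ht])
    (by linarith [h.coupled.α_pos t ht]) ⟨y, hy, rfl⟩

/-- One iteration of the network: the squared distance to the (shrunken) comparator `y` decreases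
by the linearized regret and the penalty. -/
theorem TunedRun.drift (h : M.TunedRun S μ r R G₁ G₂ L w B C γ₀) {ω : Ω}
    (hω : M.IsRegular S G₁ G₂ ω) {t : ℕ} (ht : 1 ≤ t) {y : Vec p} (hy : y ∈ M.X) {ς : ℝ}
    (hς : 0 ≤ ς) (hyς : ∀ i k, M.g i t y k ≤ -ς) :
    ∑ i, (2 * S.α t * inner ℝ (M.grad S t i ω) (M.x S ω i t - y) + γ₀ * M.viol S t i ω ^ 2
        + 2 * ς * γ₀ * M.viol S t i ω
        + 2 * S.α t * inner ℝ (M.noise S t i ω) (M.x S ω i t - (1 - S.α t) • y))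
      + ∑ i, ‖(M.state S ω (t + 1)).z i - (1 - S.α (t + 1)) • y‖ ^ 2
    ≤ ∑ i, ‖(M.state S ω t).z i - (1 - S.α t) • y‖ ^ 2
      + n * (2 * p ^ 2 * G₁ ^ 2 + 2 * γ₀ * (G₂ * (R + 2 * r)) ^ 2 + 2 * G₁ * R
          + 4 * p * L * r * R) * S.α t ^ 2
      + n * (4 * R ^ 2) * (S.α t - S.α (t + 1))
      + ((4 * R + 2 * p * L * r) * M.errSum S t ω + M.errSqSum S t ω) := by
  have hα := h.coupled.α_pos t ht
  have hα1 := (h.coupled.α_lt_one t ht).le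
  have hα' := h.coupled.α_pos (t + 1) (by omega)
  have hα1' := (h.coupled.α_lt_one (t + 1) (by omega)).le
  have hanti := h.coupled.α_anti t ht
  have hR := h.R_nonneg
  have hmem : (1 - S.α t) • y ∈ M.X := h.shrink_mem ht hy
  have hmem' : (1 - S.α t) • y ∈ (1 - S.α (t + 1)) • M.X :=
    h.admissible.set.smul_subset_smul h.r_pos (by linarith)
      (sub_pos.2 (h.coupled.α_lt_one (t + 1) (by omega))) (by linarith) ⟨y, hy, rfl⟩
  set c₁ : ℝ := 2 * p ^ 2 * G₁ ^ 2 + 2 * γ₀ * (G₂ * (R + 2 * r)) ^ 2 + 2 * G₁ * R with hc₁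
  have hstep : ∀ i, 2 * S.α t * inner ℝ (M.grad S t i ω) (M.x S ω i t - y)
        + γ₀ * M.viol S t i ω ^ 2 + 2 * ς * γ₀ * M.viol S t i ω
        + 2 * S.α t * inner ℝ (M.noise S t i ω) (M.x S ω i t - (1 - S.α t) • y)
        + ‖(M.state S ω (t + 1)).z i - (1 - S.α (t + 1)) • y‖ ^ 2
      ≤ ‖M.x S ω i t - (1 - S.α t) • y‖ ^ 2
        + 2 * p * L * r * S.α t ^ 2 * ‖M.x S ω i t - (1 - S.α t) • y‖ + c₁ * S.α t ^ 2
        + 4 * R ^ 2 * (S.α t - S.α (t + 1)) := by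
    intro i
    have hδ := h.coupled.δ_eq t ht
    have hz : ‖(M.state S ω (t + 1)).z i - (1 - S.α t) • y‖
        ≤ ‖M.x S ω i t - S.α t • M.estimator (S.γ t) (S.δ t) i t (M.x S ω i t) (M.u i t ω)
          - (1 - S.α t) • y‖ := by
      rw [z_succ ω i ht, h.coupled.ξ_eq _ (by omega)]
      exact norm_proj_sub_le (h.admissible.set.isClosed_smul
        (sub_pos.2 (h.coupled.α_lt_one (t + 1) (by omega)))) (h.admissible.set.convex.smul _) _
        hmem'
    have h1 := h.admissible.gradient.one_step h.admissible.set h.r_pos h.admissible.smooth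
      h.admissible.domain h.one_le_p hα hα1 h.γ₀_pos h.γ₀_le (h.coupled.γ_eq t ht) hς (i := i) ht
      (hω.mem_dom i t ht) hy (by rw [← hδ]; exact hω.ae_mem_dom i t ht) (hyς i)
      (hω.estimator_le i t ht) hz
    rw [← hδ] at h1
    have h2 : ‖(M.state S ω (t + 1)).z i - (1 - S.α (t + 1)) • y‖ ^ 2
        ≤ ‖(M.state S ω (t + 1)).z i - (1 - S.α t) • y‖ ^ 2
          + 4 * R ^ 2 * (S.α t - S.α (t + 1)) := by
      have ha := h.norm_z_sub_le ω i (t := t + 1) (by omega) (h.shrink_mem (t := t + 1)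
        (by omega) hy)
      have hb := h.norm_z_sub_le ω i (t := t + 1) (by omega) hmem
      have hab : ‖(M.state S ω (t + 1)).z i - (1 - S.α (t + 1)) • y‖
          ≤ ‖(M.state S ω (t + 1)).z i - (1 - S.α t) • y‖ + (S.α t - S.α (t + 1)) * R := by
        have e : (M.state S ω (t + 1)).z i - (1 - S.α (t + 1)) • y
            = ((M.state S ω (t + 1)).z i - (1 - S.α t) • y) - (S.α t - S.α (t + 1)) • y := by
          module
        rw [e]
        refine (norm_sub_le _ _).trans (add_le_add le_rfl ?_)
        rw [norm_smul, Real.norm_of_nonneg (sub_nonneg.2 hanti)]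
        exact mul_le_mul_of_nonneg_left (h.admissible.set.norm_le hy) (sub_nonneg.2 hanti)
      set A := ‖(M.state S ω (t + 1)).z i - (1 - S.α (t + 1)) • y‖
      set A' := ‖(M.state S ω (t + 1)).z i - (1 - S.α t) • y‖
      have hA : 0 ≤ A := norm_nonneg _
      have hA' : 0 ≤ A' := norm_nonneg _
      have hd : 0 ≤ (S.α t - S.α (t + 1)) * R := mul_nonneg (sub_nonneg.2 hanti) hR
      have e1 : A ^ 2 - A' ^ 2 = (A - A') * (A + A') := by ring
      have e2 : (A - A') * (A + A') ≤ (S.α t - S.α (t + 1)) * R * (A + A') :=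
        mul_le_mul_of_nonneg_right (by linarith) (by linarith)
      have e3 : (S.α t - S.α (t + 1)) * R * (A + A') ≤ (S.α t - S.α (t + 1)) * R * (4 * R) :=
        mul_le_mul_of_nonneg_left (by linarith) hd
      linarith
    have h3 : M.grad S t i ω = gradientWithin (M.f i t) M.dom (M.x S ω i t) := rfl
    have h4 : M.viol S t i ω = M.violation i t (M.x S ω i t) := rfl
    have h5 : M.noise S t i ω = M.estimator (S.γ t) (S.δ t) i t (M.x S ω i t) (M.u i t ω)
      - M.meanEstimator (S.γ t) (S.δ t) i t (M.x S ω i t) := rfl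
    rw [h3, h4, h5]
    linarith
  have hsum := Finset.sum_le_sum fun i (_ : i ∈ Finset.univ) => hstep i
  rw [Finset.sum_add_distrib] at hsum
  refine hsum.trans ?_
  rw [Finset.sum_add_distrib, Finset.sum_add_distrib, Finset.sum_add_distrib, ← Finset.mul_sum]
  simp only [Finset.sum_const, Finset.card_univ, Fintype.card_fin, nsmul_eq_mul]
  have h1 := h.sum_norm_sq_x_sub_le ω ht hmem
  have h2 := h.sum_norm_x_sub_le ω ht hmem
  have hk : 0 ≤ 2 * p * L * r := by
    have := h.L_nonneg
    have := h.r_pos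
    positivity
  have h3 := mul_le_mul_of_nonneg_left h2 (mul_nonneg hk (sq_nonneg (S.α t)))
  have h4 : 2 * p * L * r * S.α t ^ 2 * M.errSum S t ω ≤ 2 * p * L * r * M.errSum S t ω := by
    have : S.α t ^ 2 ≤ 1 := pow_le_one₀ hα.le hα1
    have h5 := mul_le_mul_of_nonneg_left this (mul_nonneg hk (errSum_nonneg (M := M) (S := S) t ω))
    linarith
  linarith

/-- The cumulative disagreement is controlled by the stepsizes, violations and compression
errors. -/
theorem TunedRun.sum_spread_le (h : M.TunedRun S μ r R G₁ G₂ L w B C γ₀) {ω : Ω}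
    (hω : M.IsRegular S G₁ G₂ ω) (T : ℕ) :
    n * w ^ (n * B) * ∑ t ∈ Finset.Icc 1 T, spread (M.state S ω t).z
      ≤ 2 * R * (n * B) + 4 * (n * B) * ∑ t ∈ Finset.Icc 1 T,
        (n * p * G₁ * S.α t + p * G₂ * γ₀ * ∑ i, M.viol S t i ω + M.errSum S t ω) := by
  have hnet := h.admissible.network
  set η : ℕ → Fin n → Vec p := fun t i =>
    (M.state S ω (t + 1)).z i - ∑ j, M.W t i j • (M.state S ω t).z j with hη
  have hz : ∀ t, 1 ≤ t → ∀ i, (M.state S ω (t + 1)).z i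
      = ∑ j, M.W t i j • (M.state S ω t).z j + η t i := fun t _ i => by simp [hη]
  have hηle : ∀ t, 1 ≤ t → ∑ i, ‖η t i‖
      ≤ n * p * G₁ * S.α t + p * G₂ * γ₀ * ∑ i, M.viol S t i ω + M.errSum S t ω := by
    intro t ht
    have hα := h.coupled.α_pos t ht
    have hpos' := sub_pos.2 (h.coupled.α_lt_one (t + 1) (by omega))
    have h1 : ∀ i, ‖η t i‖ ≤ p * G₁ * S.α t + p * G₂ * γ₀ * M.viol S t i ω
        + ‖∑ j, M.W t i j • M.compErr S t j ω‖ := by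
      intro i
      have hmean : ∑ j, M.W t i j • (M.state S ω t).z j ∈ (1 - S.α t) • M.X :=
        (h.admissible.set.convex.smul _).sum_mem (fun j _ => hnet.weight_nonneg h.w_pos ht i j)
          (hnet.row_sum t ht i) fun j _ => h.admissible.z_mem h.r_pos h.coupled ω j ht
      have hmean' : ∑ j, M.W t i j • (M.state S ω t).z j ∈ (1 - S.α (t + 1)) • M.X :=
        h.admissible.set.smul_subset_smul h.r_pos (by linarith [h.coupled.α_lt_one t ht]) hpos'
          (by linarith [h.coupled.α_anti t ht]) hmean
      have h2 : ‖η t i‖ ≤ ‖M.x S ω i t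
          - S.α t • M.estimator (S.γ t) (S.δ t) i t (M.x S ω i t) (M.u i t ω)
          - ∑ j, M.W t i j • (M.state S ω t).z j‖ := by
        simp only [hη]
        rw [z_succ ω i ht, h.coupled.ξ_eq _ (by omega)]
        exact norm_proj_sub_le (h.admissible.set.isClosed_smul hpos')
          (h.admissible.set.convex.smul _) _ hmean'
      have h3 : M.x S ω i t - S.α t • M.estimator (S.γ t) (S.δ t) i t (M.x S ω i t) (M.u i t ω)
          - ∑ j, M.W t i j • (M.state S ω t).z j
          = ∑ j, M.W t i j • M.compErr S t j ω
            - S.α t • M.estimator (S.γ t) (S.δ t) i t (M.x S ω i t) (M.u i t ω) := by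
        rw [x_eq_sum]
        simp only [smul_add, Finset.sum_add_distrib]
        abel
      rw [h3] at h2
      have h4 : ‖S.α t • M.estimator (S.γ t) (S.δ t) i t (M.x S ω i t) (M.u i t ω)‖
          ≤ p * G₁ * S.α t + p * G₂ * γ₀ * M.viol S t i ω := by
        rw [norm_smul, Real.norm_of_nonneg hα.le]
        refine (mul_le_mul_of_nonneg_left (hω.estimator_le i t ht) hα.le).trans (le_of_eq ?_)
        rw [h.coupled.γ_eq t ht, viol]
        field_simp
      refine h2.trans ((norm_sub_le _ _).trans ?_)
      linarith
    refine (Finset.sum_le_sum fun i _ => h1 i).trans ?_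
    rw [Finset.sum_add_distrib, Finset.sum_add_distrib]
    simp only [Finset.sum_const, Finset.card_univ, Fintype.card_fin, nsmul_eq_mul]
    rw [← Finset.mul_sum]
    have h5 := hnet.sum_norm_mix_le h.w_pos ht fun j => M.compErr S t j ω
    have h6 : M.errSum S t ω = ∑ j, ‖M.compErr S t j ω‖ := rfl
    rw [h6]
    linarith
  have hρ : n * w ^ (n * B) ≤ 1 := by
    let i₀ : Fin n := ⟨0, h.one_le_n⟩
    rw [← hnet.transition_row_sum le_rfl (n * B) i₀]
    calc (n : ℝ) * w ^ (n * B) = ∑ _j : Fin n, w ^ (n * B) := by simp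
      _ ≤ _ := Finset.sum_le_sum fun j _ => hnet.pow_le_transition h.w_pos le_rfl i₀ j
  have hmain := sum_le_of_window_contraction (d := fun t => spread (M.state S ω t).z)
    (q := fun t => 2 * ∑ i, ‖η t i‖) (N := n * B) (ρ := n * w ^ (n * B)) hρ
    (fun t => spread_nonneg _) (fun t => by positivity)
    (fun t ht => hnet.spread_succ_le (z := fun t => (M.state S ω t).z) h.w_pos hz ht)
    (fun t ht => hnet.spread_add_window_le (z := fun t => (M.state S ω t).z) h.w_pos hz ht) T
  have hd1 : spread (M.state S ω 1).z ≤ 2 * R :=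
    spread_le (by linarith [h.R_nonneg]) fun i j => h.norm_z_sub_le ω i le_rfl
      (h.admissible.z_mem_X h.r_pos h.coupled ω j le_rfl)
  have hq : ∑ t ∈ Finset.Icc 1 T, 2 * ∑ i, ‖η t i‖ ≤ 2 * ∑ t ∈ Finset.Icc 1 T,
      (n * p * G₁ * S.α t + p * G₂ * γ₀ * ∑ i, M.viol S t i ω + M.errSum S t ω) := by
    rw [← Finset.mul_sum]
    refine mul_le_mul_of_nonneg_left (Finset.sum_le_sum fun t ht => ?_) zero_le_two
    exact hηle t (Finset.mem_Icc.1 ht).1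
  have hN : (0 : ℝ) ≤ n * B := by positivity
  push_cast at hmain
  have h7 := mul_le_mul_of_nonneg_left hd1 hN
  have h8 := mul_le_mul_of_nonneg_left hq hN
  linarith

theorem TunedRun.norm_x_sub_x_le (h : M.TunedRun S μ r R G₁ G₂ L w B C γ₀) (ω : Ω) (i j : Fin n)
    {t : ℕ} (ht : 1 ≤ t) :
    ‖M.x S ω i t - M.x S ω j t‖ ≤ spread (M.state S ω t).z + 2 * M.errSum S t ω := by
  have hnet := h.admissible.network
  have e : M.x S ω i t - M.x S ω j t
      = (∑ k, M.W t i k • (M.state S ω t).z k - ∑ k, M.W t j k • (M.state S ω t).z k)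
        + (∑ k, M.W t i k • M.compErr S t k ω - ∑ k, M.W t j k • M.compErr S t k ω) := by
    rw [x_eq_sum, x_eq_sum]
    simp only [smul_add, Finset.sum_add_distrib]
    abel
  rw [e]
  refine (norm_add_le _ _).trans (add_le_add ?_ ?_)
  · exact (norm_sub_le_spread (fun i => ∑ k, M.W t i k • (M.state S ω t).z k) i j).trans
      (hnet.spread_mix_le h.w_pos ht _)
  · refine (norm_sub_le _ _).trans ?_
    rw [two_mul]
    exact add_le_add (hnet.norm_mix_le_sum h.w_pos ht _ i) (hnet.norm_mix_le_sum h.w_pos ht _ j)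

end Model

/-! ### The global functions -/

namespace Problem

variable {n p : ℕ} {P : Problem n p} {r R G₁ G₂ L : ℝ}

theorem uniqueDiffOn_dom (hset : P.SetAssumption r R) (hr : 0 < r) (hd : P.DomainAssumption) :
    UniqueDiffOn ℝ P.dom := by
  refine uniqueDiffOn_convex hd.convex ⟨0, ?_⟩
  rw [mem_interior]
  exact ⟨Metric.ball 0 r, (Metric.ball_subset_closedBall.trans hset.ball_subset).trans hd.X_subset,
    Metric.isOpen_ball, Metric.mem_ball_self hr⟩

theorem gradientWithin_globalLoss (hset : P.SetAssumption r R) (hr : 0 < r)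
    (hd : P.DomainAssumption) (h : P.GradientAssumption G₁ G₂) {t : ℕ} (ht : 1 ≤ t) {x : Vec p}
    (hx : x ∈ P.dom) :
    gradientWithin (P.globalLoss t) P.dom x
      = (1 / (n : ℝ)) • ∑ j, gradientWithin (P.f j t) P.dom x := by
  have hu : UniqueDiffWithinAt ℝ P.dom x := uniqueDiffOn_dom hset hr hd x hx
  have hdj : ∀ j, DifferentiableWithinAt ℝ (P.f j t) P.dom x := fun j => h.f_diff j t ht x hx
  have h1 : fderivWithin ℝ (P.globalLoss t) P.dom x
      = (1 / (n : ℝ)) • ∑ j, fderivWithin ℝ (P.f j t) P.dom x := by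
    have hs : HasFDerivWithinAt (fun y => ∑ j, P.f j t y)
        (∑ j, fderivWithin ℝ (P.f j t) P.dom x) P.dom x :=
      HasFDerivWithinAt.fun_sum fun j _ => (hdj j).hasFDerivWithinAt
    exact (hs.const_mul (1 / (n : ℝ))).fderivWithin hu
  simp only [gradientWithin]
  rw [h1]
  simp

theorem norm_gradientWithin_globalLoss_le (hset : P.SetAssumption r R) (hr : 0 < r) (hn : 1 ≤ n)
    (hd : P.DomainAssumption) (h : P.GradientAssumption G₁ G₂) {t : ℕ} (ht : 1 ≤ t) {x : Vec p}
    (hx : x ∈ P.dom) : ‖gradientWithin (P.globalLoss t) P.dom x‖ ≤ G₁ := by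
  have hn' : (0 : ℝ) < n := by positivity
  rw [gradientWithin_globalLoss hset hr hd h ht hx, norm_smul,
    Real.norm_of_nonneg (by positivity : (0 : ℝ) ≤ 1 / n)]
  have h1 : ‖∑ j, gradientWithin (P.f j t) P.dom x‖ ≤ n * G₁ := by
    refine (norm_sum_le _ _).trans ?_
    calc _ ≤ ∑ _j : Fin n, G₁ := Finset.sum_le_sum fun j _ => h.f_bound j t ht x hx
      _ = n * G₁ := by simp
  calc _ ≤ 1 / (n : ℝ) * (n * G₁) := by gcongr
    _ = G₁ := by field_simp

theorem continuousOn_gradientWithin_globalLoss (hset : P.SetAssumption r R) (hr : 0 < r)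
    (hd : P.DomainAssumption) (h : P.GradientAssumption G₁ G₂) (hs : P.SmoothAssumption L) {t : ℕ}
    (ht : 1 ≤ t) : ContinuousOn (gradientWithin (P.globalLoss t) P.dom) P.dom := by
  have h1 : ContinuousOn (fun x => (1 / (n : ℝ)) • ∑ j, gradientWithin (P.f j t) P.dom x) P.dom := by
    have hj : ∀ j, ContinuousOn (gradientWithin (P.f j t) P.dom) P.dom := fun j => ?_
    · exact ContinuousOn.const_smul (continuousOn_finsetSum Finset.univ fun j _ => hj j) (1 / (n : ℝ))
    refine LipschitzOnWith.continuousOn (K := L.toNNReal) (.of_dist_le_mul fun x hx y hy => ?_)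
    rw [dist_eq_norm, dist_eq_norm]
    exact (hs j t ht x hx y hy).trans
      (mul_le_mul_of_nonneg_right (Real.le_coe_toNNReal _) (norm_nonneg _))
  exact h1.congr fun x hx => gradientWithin_globalLoss hset hr hd h ht hx

theorem norm_posPart_globalConstraint_le (t : ℕ) (x : Vec p) :
    ‖posPart (P.globalConstraint t x)‖ ≤ ∑ i, P.violation i t x := by
  have h0 : 0 ≤ ∑ i, P.violation i t x := Finset.sum_nonneg fun i _ => violation_nonneg i t x
  rw [← sq_le_sq₀ (norm_nonneg _) h0, EuclideanSpace.norm_sq_eq, Fintype.sum_sigma]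
  calc _ = ∑ i, P.violation i t x ^ 2 := by
        refine Finset.sum_congr rfl fun i _ => ?_
        rw [violation, EuclideanSpace.norm_sq_eq]
        rfl
    _ ≤ (∑ i, P.violation i t x) ^ 2 := by
        rw [sq, Finset.sum_mul]
        refine Finset.sum_le_sum fun i _ => ?_
        rw [sq]
        exact mul_le_mul_of_nonneg_left (Finset.single_le_sum
          (fun i _ => violation_nonneg i t x) (Finset.mem_univ i)) (violation_nonneg i t x)

end Problem

namespace Model

variable {n p : ℕ} {Ω Ξ : Type*} [MeasurableSpace Ξ] [m₀ : MeasurableSpace Ω] {μ : Measure Ω}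
  {M : Model n p Ω Ξ} {S : Schedule} {r R G₁ G₂ L w C γ₀ : ℝ} {B : ℕ}

/-- The regret of agent `i` against the global loss reduces to the local regrets, up to the
disagreement of the agents. -/
theorem TunedRun.inner_globalLoss_le (h : M.TunedRun S μ r R G₁ G₂ L w B C γ₀) {ω : Ω}
    (hω : M.IsRegular S G₁ G₂ ω) (i : Fin n) {t : ℕ} (ht : 1 ≤ t) {y : Vec p} (hy : y ∈ M.X) :
    inner ℝ (gradientWithin (M.globalLoss t) M.dom (M.x S ω i t)) (M.x S ω i t - y)
      ≤ 1 / (n : ℝ) * ∑ j, inner ℝ (M.grad S t j ω) (M.x S ω j t - y)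
        + ((G₁ + 2 * R * L) * (spread (M.state S ω t).z + 2 * M.errSum S t ω)
          + 2 * G₁ * M.errSum S t ω) := by
  have hn' : (0 : ℝ) < n := by
    have := h.one_le_n
    positivity
  have hxi := hω.mem_dom i t ht
  rw [Problem.gradientWithin_globalLoss h.admissible.set h.r_pos h.admissible.domain
    h.admissible.gradient ht hxi, inner_smul_left, sum_inner]
  simp only [conj_trivial]
  set K := (G₁ + 2 * R * L) * (spread (M.state S ω t).z + 2 * M.errSum S t ω)
          + 2 * G₁ * M.errSum S t ω with hK
  have key : ∀ j, inner ℝ (gradientWithin (M.f j t) M.dom (M.x S ω i t)) (M.x S ω i t - y)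
      ≤ inner ℝ (M.grad S t j ω) (M.x S ω j t - y) + K := by
    intro j
    have hxj := hω.mem_dom j t ht
    set a := gradientWithin (M.f j t) M.dom (M.x S ω i t) with ha
    have hb : M.grad S t j ω = gradientWithin (M.f j t) M.dom (M.x S ω j t) := rfl
    set b := M.grad S t j ω
    have han : ‖a‖ ≤ G₁ := h.admissible.gradient.f_bound j t ht _ hxi
    have hbn : ‖b‖ ≤ G₁ := h.admissible.gradient.f_bound j t ht _ hxj
    have hab : ‖a - b‖ ≤ L * ‖M.x S ω i t - M.x S ω j t‖ := by
      rw [ha, hb]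
      exact h.admissible.smooth j t ht _ hxi _ hxj
    have hd := h.norm_x_sub_x_le ω i j ht
    set d := ‖M.x S ω i t - M.x S ω j t‖ with hddef
    -- split `x_j - y` into a bounded part and the averaged compression error
    set e₁ := ∑ k, M.W t j k • ((M.state S ω t).z k - y) with he₁
    set e₂ := ∑ k, M.W t j k • M.compErr S t k ω with he₂
    have hsplit : M.x S ω j t - y = e₁ + e₂ := by
      rw [x_sub_eq h.admissible.network ω j ht y, he₁, he₂, ← Finset.sum_add_distrib]
      simp only [smul_add]
    have he₁n : ‖e₁‖ ≤ 2 * R := by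
      refine (h.admissible.network.norm_mix_le h.w_pos ht _ j).trans ?_
      calc _ ≤ ∑ k, M.W t j k * (2 * R) := Finset.sum_le_sum fun k _ =>
            mul_le_mul_of_nonneg_left (h.norm_z_sub_le ω k ht hy)
              (h.admissible.network.weight_nonneg h.w_pos ht j k)
        _ = 2 * R := by rw [← Finset.sum_mul, h.admissible.network.row_sum t ht, one_mul]
    have he₂n : ‖e₂‖ ≤ M.errSum S t ω := h.admissible.network.norm_mix_le_sum h.w_pos ht _ j
    have e : inner ℝ a (M.x S ω i t - y) = inner ℝ b (M.x S ω j t - y)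
        + inner ℝ a (M.x S ω i t - M.x S ω j t) + inner ℝ (a - b) e₁ + inner ℝ (a - b) e₂ := by
      rw [add_assoc, ← inner_add_right (a - b), ← hsplit, inner_sub_left a b, add_right_comm,
        ← sub_add_sub_cancel (M.x S ω i t) (M.x S ω j t) y, inner_add_right]
      ring
    have hG := h.G₁_nonneg
    have hd0 : 0 ≤ d := norm_nonneg _
    have h1 : inner ℝ a (M.x S ω i t - M.x S ω j t) ≤ G₁ * d :=
      (real_inner_le_norm _ _).trans (mul_le_mul_of_nonneg_right han hd0)
    have h2 : inner ℝ (a - b) e₁ ≤ L * d * (2 * R) :=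
      (real_inner_le_norm _ _).trans (mul_le_mul hab he₁n (norm_nonneg _)
        (mul_nonneg h.L_nonneg hd0))
    have h3 : inner ℝ (a - b) e₂ ≤ 2 * G₁ * M.errSum S t ω :=
      (real_inner_le_norm _ _).trans (mul_le_mul ((norm_sub_le _ _).trans (by linarith)) he₂n
        (norm_nonneg _) (by linarith))
    have h4 : 0 ≤ G₁ + 2 * R * L := by
      have := h.R_nonneg
      have := h.L_nonneg
      positivity
    have h5 := mul_le_mul_of_nonneg_left hd h4
    rw [e, hK]
    linarith
  have hsum := Finset.sum_le_sum fun j (_ : j ∈ Finset.univ) => key j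
  rw [Finset.sum_add_distrib] at hsum
  simp only [Finset.sum_const, Finset.card_univ, Fintype.card_fin, nsmul_eq_mul] at hsum
  calc _ ≤ 1 / (n : ℝ) * (∑ j, inner ℝ (M.grad S t j ω) (M.x S ω j t - y) + n * K) :=
        mul_le_mul_of_nonneg_left hsum (by positivity)
    _ = _ := by field_simp

theorem TunedRun.violation_x_le (h : M.TunedRun S μ r R G₁ G₂ L w B C γ₀) {ω : Ω}
    (hω : M.IsRegular S G₁ G₂ ω) (i : Fin n) {t : ℕ} (ht : 1 ≤ t) :
    ‖posPart (M.globalConstraint t (M.x S ω i t))‖ ≤ ∑ j, M.viol S t j ω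
      + n * G₂ * (spread (M.state S ω t).z + 2 * M.errSum S t ω) := by
  refine (Problem.norm_posPart_globalConstraint_le t _).trans ?_
  have h1 : ∀ j, M.violation j t (M.x S ω i t) ≤ M.viol S t j ω
      + G₂ * (spread (M.state S ω t).z + 2 * M.errSum S t ω) := fun j =>
    (h.admissible.gradient.violation_le ht (hω.mem_dom i t ht) (hω.mem_dom j t ht)).trans
      (add_le_add le_rfl (mul_le_mul_of_nonneg_left (h.norm_x_sub_x_le ω i j ht) h.G₂_nonneg))
  refine (Finset.sum_le_sum fun j _ => h1 j).trans (le_of_eq ?_)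
  rw [Finset.sum_add_distrib]
  simp only [Finset.sum_const, Finset.card_univ, Fintype.card_fin, nsmul_eq_mul]
  ring

end Model

end BanditCompressed

namespace BanditCompressed

/-! ### Expectations of the error terms -/

namespace Model

variable {n p : ℕ} {Ω Ξ : Type*} [MeasurableSpace Ξ] [m₀ : MeasurableSpace Ω] {μ : Measure Ω}
  {M : Model n p Ω Ξ} {S : Schedule} {r R G₁ G₂ L w C γ₀ : ℝ} {B : ℕ}

section

variable [IsProbabilityMeasure μ]

theorem TunedRun.memLp_compErr (h : M.TunedRun S μ r R G₁ G₂ L w B C γ₀) (j : Fin n) {t : ℕ}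
    (ht : 1 ≤ t) : MemLp (M.compErr S t j) 2 μ :=
  (h.admissible.compErr_moment h.one_le_p h.r_pos h.coupled j ht).1

theorem TunedRun.integrable_errSum (h : M.TunedRun S μ r R G₁ G₂ L w B C γ₀) {t : ℕ}
    (ht : 1 ≤ t) : Integrable (M.errSum S t) μ :=
  integrable_finsetSum _ fun j _ => ((h.memLp_compErr j ht).integrable one_le_two).norm

theorem TunedRun.integrable_errSqSum (h : M.TunedRun S μ r R G₁ G₂ L w B C γ₀) {t : ℕ}
    (ht : 1 ≤ t) : Integrable (M.errSqSum S t) μ :=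
  integrable_finsetSum _ fun j _ => (h.memLp_compErr j ht).integrable_norm_pow two_ne_zero

theorem TunedRun.integral_errSqSum_le (h : M.TunedRun S μ r R G₁ G₂ L w B C γ₀) {t : ℕ}
    (ht : 1 ≤ t) : ∫ ω, M.errSqSum S t ω ∂μ ≤ n * (C * S.s t ^ 2) := by
  unfold errSqSum
  rw [integral_finsetSum _ fun j _ => (h.memLp_compErr j ht).integrable_norm_pow two_ne_zero]
  calc _ ≤ ∑ _j : Fin n, C * S.s t ^ 2 := Finset.sum_le_sum fun j _ =>
        (h.admissible.compErr_moment h.one_le_p h.r_pos h.coupled j ht).2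
    _ = _ := by simp

/-- The first moment of the compression errors, from the second one by `2ab ≤ a² + b²` at scale
`s_t`. -/
theorem TunedRun.integral_errSum_le (h : M.TunedRun S μ r R G₁ G₂ L w B C γ₀) {t : ℕ}
    (ht : 1 ≤ t) : ∫ ω, M.errSum S t ω ∂μ ≤ n * ((1 + C) * S.s t) := by
  have hs := h.coupled.s_pos t ht
  have hC := h.C_nonneg
  unfold errSum
  rw [integral_finsetSum _ fun j _ => ((h.memLp_compErr j ht).integrable one_le_two).norm]
  calc _ ≤ ∑ _j : Fin n, (1 + C) * S.s t := Finset.sum_le_sum fun j _ => ?_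
    _ = _ := by simp
  have h2 := (h.memLp_compErr j ht).integrable_norm_pow two_ne_zero
  have h3 : ∫ ω, ‖M.compErr S t j ω‖ ∂μ
      ≤ ∫ ω, (S.s t + (S.s t)⁻¹ * ‖M.compErr S t j ω‖ ^ 2) ∂μ := by
    refine integral_mono ((h.memLp_compErr j ht).integrable one_le_two).norm
      ((integrable_const _).add (h2.const_mul _)) fun ω => ?_
    have hn := norm_nonneg (M.compErr S t j ω)
    have h4 : S.s t * ‖M.compErr S t j ω‖ ≤ S.s t * (S.s t + (S.s t)⁻¹ * ‖M.compErr S t j ω‖ ^ 2) := by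
      rw [mul_add, mul_inv_cancel_left₀ hs.ne']
      nlinarith [sq_nonneg (S.s t - ‖M.compErr S t j ω‖)]
    exact le_of_mul_le_mul_left h4 hs
  rw [integral_add (integrable_const _) (h2.const_mul _), integral_const_mul] at h3
  have h5 := (h.admissible.compErr_moment h.one_le_p h.r_pos h.coupled j ht).2
  have h6 : (S.s t)⁻¹ * ∫ ω, ‖M.compErr S t j ω‖ ^ 2 ∂μ ≤ (S.s t)⁻¹ * (C * S.s t ^ 2) := by
    gcongr
  have h7 : (S.s t)⁻¹ * (C * S.s t ^ 2) = C * S.s t := by field_simp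
  simp only [integral_const, probReal_univ, one_smul] at h3
  linarith

theorem TunedRun.memLp_viol (h : M.TunedRun S μ r R G₁ G₂ L w B C γ₀) (i : Fin n) {t : ℕ}
    (ht : 1 ≤ t) : MemLp (M.viol S t i) 2 μ :=
  h.admissible.memLp_violation h.one_le_p h.r_pos h.coupled i i ht

theorem TunedRun.integrable_viol (h : M.TunedRun S μ r R G₁ G₂ L w B C γ₀) (i : Fin n) {t : ℕ}
    (ht : 1 ≤ t) : Integrable (M.viol S t i) μ := (h.memLp_viol i ht).integrable one_le_two

theorem TunedRun.integrable_viol_sq (h : M.TunedRun S μ r R G₁ G₂ L w B C γ₀) (i : Fin n) {t : ℕ}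
    (ht : 1 ≤ t) : Integrable (fun ω => M.viol S t i ω ^ 2) μ := (h.memLp_viol i ht).integrable_sq

theorem TunedRun.memLp_noise (h : M.TunedRun S μ r R G₁ G₂ L w B C γ₀) (i : Fin n) {t : ℕ}
    (ht : 1 ≤ t) : MemLp (M.noise S t i) 2 μ :=
  h.admissible.memLp_noise h.one_le_p h.r_pos h.γ₀_pos h.coupled i ht

omit [IsProbabilityMeasure μ] in
theorem integrable_inner_of_memLp {f g : Ω → Vec p} (hf : MemLp f 2 μ) (hg : MemLp g 2 μ) :
    Integrable (fun ω => inner ℝ (f ω) (g ω)) μ := by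
  refine (hf.norm.integrable_mul hg.norm).mono'
    (hf.aestronglyMeasurable.inner hg.aestronglyMeasurable) (.of_forall fun ω => ?_)
  simpa using norm_inner_le_norm (𝕜 := ℝ) (f ω) (g ω)

theorem TunedRun.memLp_x (h : M.TunedRun S μ r R G₁ G₂ L w B C γ₀) (i : Fin n) {t : ℕ}
    (ht : 1 ≤ t) : MemLp (fun ω => M.x S ω i t) 2 μ :=
  h.admissible.memLp_x h.one_le_p h.r_pos h.coupled i ht

theorem TunedRun.integrable_inner_noise_x (h : M.TunedRun S μ r R G₁ G₂ L w B C γ₀) (i : Fin n)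
    {t : ℕ} (ht : 1 ≤ t) (y : Vec p) :
    Integrable (fun ω => inner ℝ (M.noise S t i ω) (M.x S ω i t - y)) μ :=
  integrable_inner_of_memLp (h.memLp_noise i ht) ((h.memLp_x i ht).sub (memLp_const y))

theorem TunedRun.integral_inner_noise_x (h : M.TunedRun S μ r R G₁ G₂ L w B C γ₀) (i : Fin n)
    {t : ℕ} (ht : 1 ≤ t) (y : Vec p) :
    ∫ ω, inner ℝ (M.noise S t i ω) (M.x S ω i t - y) ∂μ = 0 :=
  h.admissible.integral_inner_noise h.one_le_p h.r_pos h.γ₀_pos h.coupled i ht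
    ((h.admissible.aestronglyMeasurable_x_decision h.r_pos h.coupled i ht).sub
      aestronglyMeasurable_const) (h.integrable_inner_noise_x i ht y)

theorem TunedRun.integral_norm_sq_noise_le (h : M.TunedRun S μ r R G₁ G₂ L w B C γ₀) (i : Fin n)
    {t : ℕ} (ht : 1 ≤ t) :
    ∫ ω, ‖M.noise S t i ω‖ ^ 2 ∂μ
      ≤ 8 * p ^ 2 * G₁ ^ 2 + 8 * p ^ 2 * G₂ ^ 2 * S.γ t ^ 2 * ∫ ω, M.viol S t i ω ^ 2 ∂μ := by
  have hv := h.integrable_viol_sq i ht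
  have h1 : ∫ ω, ‖M.noise S t i ω‖ ^ 2 ∂μ
      ≤ ∫ ω, (8 * p ^ 2 * G₁ ^ 2 + 8 * p ^ 2 * G₂ ^ 2 * S.γ t ^ 2 * M.viol S t i ω ^ 2) ∂μ := by
    refine integral_mono_ae ((h.memLp_noise i ht).integrable_norm_pow two_ne_zero)
      ((integrable_const _).add (hv.const_mul _)) ?_
    filter_upwards [h.admissible.ae_norm_noise_le h.one_le_p h.r_pos h.γ₀_pos h.coupled i ht]
      with ω hω
    have hω' : ‖M.noise S t i ω‖ ≤ 2 * (p * (G₁ + G₂ * (S.γ t * M.viol S t i ω))) := hω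
    refine (pow_le_pow_left₀ (norm_nonneg _) hω' 2).trans ?_
    have := mul_nonneg (sq_nonneg (p : ℝ)) (sq_nonneg (G₁ - G₂ * (S.γ t * M.viol S t i ω)))
    linarith
  rw [integral_add (integrable_const _) (hv.const_mul _), integral_const, probReal_univ, one_smul,
    integral_const_mul] at h1
  exact h1

/-- The weighted sum `∑_{t ≤ T} (1 - α_t) N_{j,t}` of the noise vectors of agent `j`. The weights
are those of the shrunken comparators. -/
noncomputable def noiseSum (M : Model n p Ω Ξ) (S : Schedule) (j : Fin n) (T : ℕ) (ω : Ω) : Vec p :=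
  ∑ t ∈ Finset.Icc 1 T, (1 - S.α t) • M.noise S t j ω

omit m₀ in
theorem noiseSum_succ (j : Fin n) (T : ℕ) (ω : Ω) : M.noiseSum S j (T + 1) ω
    = M.noiseSum S j T ω + (1 - S.α (T + 1)) • M.noise S (T + 1) j ω :=
  Finset.sum_Icc_succ_top (by omega) _

theorem TunedRun.aestronglyMeasurable_noiseSum (h : M.TunedRun S μ r R G₁ G₂ L w B C γ₀)
    (j : Fin n) (T : ℕ) : AEStronglyMeasurable[M.past (T + 1)] (M.noiseSum S j T) μ := by
  induction T with
  | zero =>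
    have : M.noiseSum S j 0 = fun _ => 0 := by
      ext1 ω
      simp [noiseSum]
    rw [this]
    exact aestronglyMeasurable_const
  | succ T ih =>
    have e : M.noiseSum S j (T + 1)
        = fun ω => M.noiseSum S j T ω + (1 - S.α (T + 1)) • M.noise S (T + 1) j ω :=
      funext fun ω => noiseSum_succ j T ω
    rw [e]
    have h1 := h.admissible.aestronglyMeasurable_noise h.one_le_p h.r_pos h.coupled j
      (t := T + 1) (by omega)
    exact (ih.mono (past_mono (by omega))).add (h1.const_smul (1 - S.α (T + 1)))

theorem TunedRun.memLp_noiseSum (h : M.TunedRun S μ r R G₁ G₂ L w B C γ₀) (j : Fin n) (T : ℕ) :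
    MemLp (M.noiseSum S j T) 2 μ := by
  refine memLp_finsetSum _ fun t ht => ?_
  exact (h.memLp_noise j (Finset.mem_Icc.1 ht).1).const_smul (1 - S.α t)

/-- The noise vectors of one agent are orthogonal over time. -/
theorem TunedRun.integral_norm_sq_noiseSum_le (h : M.TunedRun S μ r R G₁ G₂ L w B C γ₀)
    (j : Fin n) (T : ℕ) : ∫ ω, ‖M.noiseSum S j T ω‖ ^ 2 ∂μ
      ≤ ∑ t ∈ Finset.Icc 1 T, ∫ ω, ‖M.noise S t j ω‖ ^ 2 ∂μ := by
  induction T with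
  | zero => simp [noiseSum]
  | succ T ih =>
    have ht : 1 ≤ T + 1 := by omega
    have hα := h.coupled.α_pos (T + 1) ht
    have hα1 := h.coupled.α_lt_one (T + 1) ht
    rw [Finset.sum_Icc_succ_top ht]
    have hN := h.memLp_noise j ht
    have hS := h.memLp_noiseSum j T
    have hcross := integrable_inner_of_memLp hN hS
    have hzero : ∫ ω, inner ℝ (M.noise S (T + 1) j ω) (M.noiseSum S j T ω) ∂μ = 0 :=
      h.admissible.integral_inner_noise h.one_le_p h.r_pos h.γ₀_pos h.coupled j ht
        ((h.aestronglyMeasurable_noiseSum j T).mono (past_le_decisionAlgebra j (T + 1))) hcross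
    have e : ∀ ω, ‖M.noiseSum S j (T + 1) ω‖ ^ 2 = ‖M.noiseSum S j T ω‖ ^ 2
        + (2 * (1 - S.α (T + 1)) * inner ℝ (M.noise S (T + 1) j ω) (M.noiseSum S j T ω)
          + (1 - S.α (T + 1)) ^ 2 * ‖M.noise S (T + 1) j ω‖ ^ 2) := by
      intro ω
      rw [noiseSum_succ, @norm_add_sq_real, inner_smul_right, norm_smul, mul_pow,
        Real.norm_eq_abs, sq_abs, real_inner_comm]
      ring
    simp_rw [e]
    have hN2 := hN.integrable_norm_pow two_ne_zero
    have i1 : Integrable (fun ω => 2 * (1 - S.α (T + 1))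
        * inner ℝ (M.noise S (T + 1) j ω) (M.noiseSum S j T ω)
          + (1 - S.α (T + 1)) ^ 2 * ‖M.noise S (T + 1) j ω‖ ^ 2) μ :=
      (hcross.const_mul _).add (hN2.const_mul _)
    rw [integral_add (hS.integrable_norm_pow two_ne_zero) i1, integral_add (hcross.const_mul _)
      (hN2.const_mul _), integral_const_mul, integral_const_mul, hzero, mul_zero, zero_add]
    refine add_le_add ih ?_
    have h1 : (1 - S.α (T + 1)) ^ 2 ≤ 1 := pow_le_one₀ (by linarith) (by linarith)
    have h2 : 0 ≤ ∫ ω, ‖M.noise S (T + 1) j ω‖ ^ 2 ∂μ := integral_nonneg fun ω => by positivity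
    nlinarith

/-! ### Expected constraint violation -/

/-- The total squared distance of the agents to the shrunken comparator at iteration `t`. -/
noncomputable def potential (M : Model n p Ω Ξ) (S : Schedule) (y : Vec p) (t : ℕ) (ω : Ω) : ℝ :=
  ∑ i, ‖(M.state S ω t).z i - (1 - S.α t) • y‖ ^ 2

omit m₀ [IsProbabilityMeasure μ] in
theorem potential_nonneg (y : Vec p) (t : ℕ) (ω : Ω) : 0 ≤ M.potential S y t ω :=
  Finset.sum_nonneg fun _ _ => by positivity

omit [IsProbabilityMeasure μ] in
theorem TunedRun.potential_le (h : M.TunedRun S μ r R G₁ G₂ L w B C γ₀) {y : Vec p} (hy : y ∈ M.X)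
    {t : ℕ} (ht : 1 ≤ t) (ω : Ω) : M.potential S y t ω ≤ n * (4 * R ^ 2) := by
  calc _ ≤ ∑ _i : Fin n, 4 * R ^ 2 := Finset.sum_le_sum fun i _ => by
        have h1 := pow_le_pow_left₀ (norm_nonneg _) (h.norm_z_sub_le ω i ht (h.shrink_mem ht hy)) 2
        linarith
    _ = _ := by simp

theorem TunedRun.integrable_potential (h : M.TunedRun S μ r R G₁ G₂ L w B C γ₀) {y : Vec p}
    (hy : y ∈ M.X) {t : ℕ} (ht : 1 ≤ t) : Integrable (M.potential S y t) μ := by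
  have hm : AEStronglyMeasurable (M.potential S y t) μ := by
    unfold potential
    refine aestronglyMeasurable_finset_sum Finset.univ fun i => ?_
    have hz := ((h.admissible.aestronglyMeasurable_state h.r_pos h.coupled ht).1 i).mono
      (h.admissible.sampling.sourceAlgebra_le _)
    exact ((hz.sub aestronglyMeasurable_const).norm.pow 2)
  refine Integrable.of_bound hm (n * (4 * R ^ 2)) (.of_forall fun ω => ?_)
  rw [Real.norm_of_nonneg (potential_nonneg _ _ _)]
  exact h.potential_le hy ht ω

/-- The expected drift. Without division by the stepsize, the regret term is only bounded below by
`-2 G₁ α_t ‖x - y‖`, which costs a multiple of `α_t`. -/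
theorem TunedRun.integral_drift (h : M.TunedRun S μ r R G₁ G₂ L w B C γ₀) {t : ℕ} (ht : 1 ≤ t)
    {sm : ℝ} (hsm : S.s t ≤ sm) {y : Vec p} (hy : y ∈ M.X) {ς : ℝ}
    (hς : 0 ≤ ς) (hyς : ∀ i k, M.g i t y k ≤ -ς) :
    ∑ i, (γ₀ * ∫ ω, M.viol S t i ω ^ 2 ∂μ + 2 * ς * γ₀ * ∫ ω, M.viol S t i ω ∂μ)
      + ∫ ω, M.potential S y (t + 1) ω ∂μ
    ≤ ∫ ω, M.potential S y t ω ∂μ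
      + n * (2 * p ^ 2 * G₁ ^ 2 + 2 * γ₀ * (G₂ * (R + 2 * r)) ^ 2 + 2 * G₁ * R
          + 4 * p * L * r * R + 4 * G₁ * R) * S.α t
      + n * (4 * R ^ 2) * (S.α t - S.α (t + 1))
      + n * ((4 * R + 2 * p * L * r + 2 * G₁) * (1 + C) + C * sm) * S.s t := by
  have hα := h.coupled.α_pos t ht
  have hα1 := h.coupled.α_lt_one t ht
  have hG := h.G₁_nonneg
  have hR := h.R_nonneg
  set c : ℝ := 2 * p ^ 2 * G₁ ^ 2 + 2 * γ₀ * (G₂ * (R + 2 * r)) ^ 2 + 2 * G₁ * R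
          + 4 * p * L * r * R with hc
  have hc0 : 0 ≤ c := by
    have := h.L_nonneg
    have := h.r_pos
    have := h.γ₀_pos
    positivity
  set k : ℝ := 4 * R + 2 * p * L * r with hk
  have hk0 : 0 ≤ k := by
    have := h.L_nonneg
    have := h.r_pos
    positivity
  have hpath : ∀ᵐ ω ∂μ, ∑ i, (γ₀ * M.viol S t i ω ^ 2 + 2 * ς * γ₀ * M.viol S t i ω)
      + ∑ i, 2 * S.α t * inner ℝ (M.noise S t i ω) (M.x S ω i t - (1 - S.α t) • y)
      + M.potential S y (t + 1) ω
      ≤ M.potential S y t ω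
      + (n * (c + 4 * G₁ * R) * S.α t + n * (4 * R ^ 2) * (S.α t - S.α (t + 1)))
      + ((k + 2 * G₁) * M.errSum S t ω + M.errSqSum S t ω) := by
    filter_upwards [h.ae_isRegular] with ω hω
    have h1 := h.drift hω ht hy hς hyς
    have h2 : ∀ i, -(2 * S.α t * inner ℝ (M.grad S t i ω) (M.x S ω i t - y))
        ≤ 2 * S.α t * G₁ * ‖M.x S ω i t - y‖ := by
      intro i
      have h3 : -inner ℝ (M.grad S t i ω) (M.x S ω i t - y) ≤ G₁ * ‖M.x S ω i t - y‖ :=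
        (neg_le_abs _).trans ((abs_real_inner_le_norm _ _).trans (mul_le_mul_of_nonneg_right
          (h.admissible.gradient.f_bound i t ht _ (hω.mem_dom i t ht)) (norm_nonneg _)))
      have h4 := mul_le_mul_of_nonneg_left h3 (by positivity : 0 ≤ 2 * S.α t)
      linarith
    have h3 := Finset.sum_le_sum fun i (_ : i ∈ Finset.univ) => h2 i
    rw [Finset.sum_neg_distrib, ← Finset.mul_sum Finset.univ (fun i => ‖M.x S ω i t - y‖)] at h3
    have h4 := mul_le_mul_of_nonneg_left (h.sum_norm_x_sub_le ω ht hy)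
      (by positivity : 0 ≤ 2 * S.α t * G₁)
    have h5 : 2 * S.α t * G₁ * M.errSum S t ω ≤ 2 * G₁ * M.errSum S t ω := by
      have := mul_le_mul_of_nonneg_left hα1.le
        (mul_nonneg (mul_nonneg zero_le_two hG) (errSum_nonneg (M := M) (S := S) t ω))
      linarith
    have h6 : n * c * S.α t ^ 2 ≤ n * c * S.α t := by
      have : S.α t ^ 2 ≤ S.α t := by nlinarith
      exact mul_le_mul_of_nonneg_left this (by positivity)
    have h7 : ∑ i, (2 * S.α t * inner ℝ (M.grad S t i ω) (M.x S ω i t - y)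
        + γ₀ * M.viol S t i ω ^ 2 + 2 * ς * γ₀ * M.viol S t i ω
        + 2 * S.α t * inner ℝ (M.noise S t i ω) (M.x S ω i t - (1 - S.α t) • y))
      = ∑ i, 2 * S.α t * inner ℝ (M.grad S t i ω) (M.x S ω i t - y)
        + (∑ i, (γ₀ * M.viol S t i ω ^ 2 + 2 * ς * γ₀ * M.viol S t i ω)
        + ∑ i, 2 * S.α t * inner ℝ (M.noise S t i ω) (M.x S ω i t - (1 - S.α t) • y)) := by
      rw [← Finset.sum_add_distrib, ← Finset.sum_add_distrib]
      exact Finset.sum_congr rfl fun i _ => by ring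
    rw [h7] at h1
    simp only [potential]
    linarith
  have iv : ∀ i, Integrable (fun ω => γ₀ * M.viol S t i ω ^ 2 + 2 * ς * γ₀ * M.viol S t i ω) μ :=
    fun i => ((h.integrable_viol_sq i ht).const_mul _).add ((h.integrable_viol i ht).const_mul _)
  have iN : ∀ i, Integrable (fun ω =>
      2 * S.α t * inner ℝ (M.noise S t i ω) (M.x S ω i t - (1 - S.α t) • y)) μ :=
    fun i => (h.integrable_inner_noise_x i ht _).const_mul _
  have iD := h.integrable_potential hy ht
  have iD' := h.integrable_potential hy (t := t + 1) (by omega)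
  have ie := h.integrable_errSum ht
  have ie2 := h.integrable_errSqSum ht
  have iV := integrable_finsetSum Finset.univ fun i _ => iv i
  have iNS := integrable_finsetSum Finset.univ fun i _ => iN i
  have i1 : Integrable (fun ω =>
      ∑ i, (γ₀ * M.viol S t i ω ^ 2 + 2 * ς * γ₀ * M.viol S t i ω)
      + ∑ i, 2 * S.α t * inner ℝ (M.noise S t i ω) (M.x S ω i t - (1 - S.α t) • y)) μ := iV.add iNS
  have i2 : Integrable (fun ω => M.potential S y t ω + (n * (c + 4 * G₁ * R) * S.α t
      + n * (4 * R ^ 2) * (S.α t - S.α (t + 1)))) μ := iD.add (integrable_const _)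
  have i3 : Integrable (fun ω => (k + 2 * G₁) * M.errSum S t ω + M.errSqSum S t ω) μ :=
    (ie.const_mul _).add ie2
  have hmono := integral_mono_ae (i1.add iD') (i2.add i3) hpath
  simp only [Pi.add_apply] at hmono
  rw [integral_add i1 iD', integral_add iV iNS, integral_add i2 i3,
    integral_add iD (integrable_const _), integral_add (ie.const_mul _) ie2,
    integral_const_mul, integral_finsetSum _ (fun i _ => iv i),
    integral_finsetSum _ (fun i _ => iN i)] at hmono
  have hNz : ∀ i, ∫ ω, 2 * S.α t * inner ℝ (M.noise S t i ω) (M.x S ω i t - (1 - S.α t) • y) ∂μ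
      = 0 := fun i => by rw [integral_const_mul, h.integral_inner_noise_x i ht, mul_zero]
  have hv : ∀ i, ∫ ω, (γ₀ * M.viol S t i ω ^ 2 + 2 * ς * γ₀ * M.viol S t i ω) ∂μ
      = γ₀ * ∫ ω, M.viol S t i ω ^ 2 ∂μ + 2 * ς * γ₀ * ∫ ω, M.viol S t i ω ∂μ := fun i => by
    rw [integral_add ((h.integrable_viol_sq i ht).const_mul _)
      ((h.integrable_viol i ht).const_mul _), integral_const_mul, integral_const_mul]
  simp only [hNz, hv, Finset.sum_const_zero, add_zero, integral_const, probReal_univ,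
    one_smul] at hmono
  have h1 := mul_le_mul_of_nonneg_left (h.integral_errSum_le ht) (by positivity : 0 ≤ k + 2 * G₁)
  have h2 := h.integral_errSqSum_le ht
  have h3 : n * (C * S.s t ^ 2) ≤ n * (C * (sm * S.s t)) := by
    have hs := h.coupled.s_pos t ht
    have hC := h.C_nonneg
    rw [sq]
    gcongr
  linarith

/-- Expected penalty along the run, relative to a fixed comparator with constraint margin `ς`. -/
theorem TunedRun.sum_integral_viol_le (h : M.TunedRun S μ r R G₁ G₂ L w B C γ₀) {T : ℕ}
    (hT : 1 ≤ T) {sm : ℝ} (hsm : ∀ t, 1 ≤ t → S.s t ≤ sm) {y : Vec p} (hy : y ∈ M.X) {ς : ℝ}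
    (hς : 0 ≤ ς) (hyς : ∀ t ∈ Finset.Icc 1 T, ∀ i k, M.g i t y k ≤ -ς) :
    ∑ t ∈ Finset.Icc 1 T, ∑ i,
        (γ₀ * ∫ ω, M.viol S t i ω ^ 2 ∂μ + 2 * ς * γ₀ * ∫ ω, M.viol S t i ω ∂μ)
    ≤ n * (8 * R ^ 2)
      + n * (2 * p ^ 2 * G₁ ^ 2 + 2 * γ₀ * (G₂ * (R + 2 * r)) ^ 2 + 2 * G₁ * R
          + 4 * p * L * r * R + 4 * G₁ * R) * ∑ t ∈ Finset.Icc 1 T, S.α t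
      + n * ((4 * R + 2 * p * L * r + 2 * G₁) * (1 + C) + C * sm)
        * ∑ t ∈ Finset.Icc 1 T, S.s t := by
  set c := (n : ℝ) * (2 * p ^ 2 * G₁ ^ 2 + 2 * γ₀ * (G₂ * (R + 2 * r)) ^ 2 + 2 * G₁ * R
          + 4 * p * L * r * R + 4 * G₁ * R)
  set k := (n : ℝ) * ((4 * R + 2 * p * L * r + 2 * G₁) * (1 + C) + C * sm)
  have hstep := Finset.sum_le_sum fun t (ht : t ∈ Finset.Icc 1 T) =>
    h.integral_drift (Finset.mem_Icc.1 ht).1 (hsm t (Finset.mem_Icc.1 ht).1) hy hς (hyς t ht)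
  simp only [Finset.sum_add_distrib] at hstep ⊢
  rw [← Finset.mul_sum, ← Finset.mul_sum, ← Finset.mul_sum] at hstep
  have htel : ∀ a : ℕ → ℝ, ∑ t ∈ Finset.Icc 1 T, a t - ∑ t ∈ Finset.Icc 1 T, a (t + 1)
      = a 1 - a (T + 1) := by
    intro a
    rw [← Finset.sum_sub_distrib]
    clear hstep hyς
    induction T, hT using Nat.le_induction with
    | base => simp
    | succ T hT ih =>
      rw [Finset.sum_Icc_succ_top (by omega), ih]
      ring
  have h1 := htel fun t => ∫ ω, M.potential S y t ω ∂μ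
  have h2 := htel S.α
  rw [← Finset.sum_sub_distrib] at h2
  rw [h2] at hstep
  have h3 : ∫ ω, M.potential S y 1 ω ∂μ ≤ n * (4 * R ^ 2) := by
    have := integral_mono (h.integrable_potential hy le_rfl) (integrable_const (n * (4 * R ^ 2)))
      fun ω => h.potential_le hy le_rfl ω
    simpa using this
  have h4 : 0 ≤ ∫ ω, M.potential S y (T + 1) ω ∂μ := integral_nonneg fun ω => potential_nonneg _ _ _
  have h5 : (n : ℝ) * (4 * R ^ 2) * (S.α 1 - S.α (T + 1)) ≤ n * (4 * R ^ 2) * 1 := by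
    refine mul_le_mul_of_nonneg_left ?_ (by positivity)
    linarith [h.coupled.α_lt_one 1 le_rfl, h.coupled.α_pos (T + 1) (by omega)]
  linarith

theorem TunedRun.integrable_posPart_globalConstraint (h : M.TunedRun S μ r R G₁ G₂ L w B C γ₀)
    (i : Fin n) {t : ℕ} (ht : 1 ≤ t) :
    Integrable (fun ω => ‖posPart (M.globalConstraint t (M.x S ω i t))‖) μ := by
  have hcont : ContinuousOn (fun x => ‖posPart (M.globalConstraint t x)‖) M.dom := by
    refine (Problem.continuous_posPart.comp_continuousOn ?_).norm
    unfold Problem.globalConstraint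
    refine (PiLp.continuous_toLp 2 _).comp_continuousOn (continuousOn_pi.2 fun k => ?_)
    exact (EuclideanSpace.proj (𝕜 := ℝ) k.2).continuous.comp_continuousOn
      (h.admissible.gradient.continuousOn_g (i := k.1) ht)
  have hx : ∀ᵐ ω ∂μ, M.x S ω i t ∈ M.dom := h.ae_isRegular.mono fun ω hω => hω.mem_dom i t ht
  have hm := aestronglyMeasurable_comp_of_continuousOn (X := fun ω => M.x S ω i t)
    h.admissible.domain.isClosed hcont (h.memLp_x i ht).aestronglyMeasurable hx
  have hg : Integrable (fun ω => ∑ j, M.violation j t (M.x S ω i t)) μ :=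
    integrable_finsetSum _ fun j _ => (h.admissible.memLp_violation h.one_le_p h.r_pos h.coupled
      i j ht).integrable one_le_two
  refine hg.mono' hm (.of_forall fun ω => ?_)
  rw [norm_norm]
  exact Problem.norm_posPart_globalConstraint_le t _

theorem TunedRun.integrable_netCCV (h : M.TunedRun S μ r R G₁ G₂ L w B C γ₀) (T : ℕ) :
    Integrable (fun ω => M.netCCV T (M.x S ω)) μ := by
  unfold Problem.netCCV
  refine Integrable.const_mul (integrable_finsetSum _ fun i _ =>
    integrable_finsetSum _ fun t ht => ?_) _
  exact h.integrable_posPart_globalConstraint i (Finset.mem_Icc.1 ht).1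

omit [IsProbabilityMeasure μ] in
theorem TunedRun.sum_spread_le' (h : M.TunedRun S μ r R G₁ G₂ L w B C γ₀) {ω : Ω}
    (hω : M.IsRegular S G₁ G₂ ω) (T : ℕ) :
    ∑ t ∈ Finset.Icc 1 T, spread (M.state S ω t).z
      ≤ 2 * R * B / w ^ (n * B) + 4 * B / w ^ (n * B) * ∑ t ∈ Finset.Icc 1 T,
        (n * p * G₁ * S.α t + p * G₂ * γ₀ * ∑ i, M.viol S t i ω + M.errSum S t ω) := by
  have h1 := h.sum_spread_le hω T
  have hn : (0 : ℝ) < n := by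
    have := h.one_le_n
    positivity
  have hw := h.w_pos
  have hρ : 0 < n * w ^ (n * B) := by positivity
  refine le_of_mul_le_mul_left (h1.trans (le_of_eq ?_)) hρ
  field_simp

/-- The network violation is the sum of the local ones up to the disagreement, which is itself
controlled by stepsizes, local violations and compression errors. -/
theorem TunedRun.integral_netCCV_le (h : M.TunedRun S μ r R G₁ G₂ L w B C γ₀) (T : ℕ) :
    ∫ ω, M.netCCV T (M.x S ω) ∂μ ≤ n * G₂ * (2 * R * B / w ^ (n * B))
      + n * G₂ * (4 * B / w ^ (n * B)) * (n * p * G₁) * ∑ t ∈ Finset.Icc 1 T, S.α t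
      + (1 + n * G₂ * (4 * B / w ^ (n * B)) * (p * G₂ * γ₀))
        * ∑ t ∈ Finset.Icc 1 T, ∑ i, ∫ ω, M.viol S t i ω ∂μ
      + (2 * n * G₂ + n * G₂ * (4 * B / w ^ (n * B))) * (n * (1 + C))
        * ∑ t ∈ Finset.Icc 1 T, S.s t := by
  set Λ : ℝ := 4 * B / w ^ (n * B) with hΛ
  have hw := h.w_pos
  have hG₂ := h.G₂_nonneg
  have hγ := h.γ₀_pos
  have hn : (0 : ℝ) < n := by
    have := h.one_le_n
    positivity
  have hΛ0 : 0 ≤ Λ := by positivity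
  have hpath : ∀ᵐ ω ∂μ, M.netCCV T (M.x S ω) ≤ ∑ t ∈ Finset.Icc 1 T,
      (n * G₂ * Λ * (n * p * G₁) * S.α t
        + ((1 + n * G₂ * Λ * (p * G₂ * γ₀)) * ∑ i, M.viol S t i ω
        + (2 * n * G₂ + n * G₂ * Λ) * M.errSum S t ω)) + n * G₂ * (2 * R * B / w ^ (n * B)) := by
    filter_upwards [h.ae_isRegular] with ω hω
    have h1 : M.netCCV T (M.x S ω) ≤ ∑ t ∈ Finset.Icc 1 T, (∑ j, M.viol S t j ω
        + n * G₂ * (spread (M.state S ω t).z + 2 * M.errSum S t ω)) := by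
      unfold Problem.netCCV
      rw [one_div, inv_mul_le_iff₀ hn]
      calc _ ≤ ∑ _i : Fin n, ∑ t ∈ Finset.Icc 1 T, (∑ j, M.viol S t j ω
            + n * G₂ * (spread (M.state S ω t).z + 2 * M.errSum S t ω)) :=
            Finset.sum_le_sum fun i _ => Finset.sum_le_sum fun t ht =>
              h.violation_x_le hω i (Finset.mem_Icc.1 ht).1
        _ = _ := by simp
    refine h1.trans ?_
    have h2 := mul_le_mul_of_nonneg_left (h.sum_spread_le' hω T) (by positivity : 0 ≤ n * G₂)
    rw [← hΛ] at h2
    simp only [mul_add, Finset.sum_add_distrib, ← Finset.mul_sum] at h2 ⊢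
    linarith
  have iv : ∀ t ∈ Finset.Icc 1 T, Integrable (fun ω => ∑ i, M.viol S t i ω) μ := fun t ht =>
    integrable_finsetSum _ fun i _ => h.integrable_viol i (Finset.mem_Icc.1 ht).1
  have ie : ∀ t ∈ Finset.Icc 1 T, Integrable (M.errSum S t) μ := fun t ht =>
    h.integrable_errSum (Finset.mem_Icc.1 ht).1
  have iR : ∀ t ∈ Finset.Icc 1 T, Integrable (fun ω =>
      n * G₂ * Λ * (n * p * G₁) * S.α t
        + ((1 + n * G₂ * Λ * (p * G₂ * γ₀)) * ∑ i, M.viol S t i ω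
        + (2 * n * G₂ + n * G₂ * Λ) * M.errSum S t ω)) μ := fun t ht =>
    (integrable_const _).add (((iv t ht).const_mul _).add ((ie t ht).const_mul _))
  have hmono := integral_mono_ae (h.integrable_netCCV T)
    ((integrable_finsetSum _ iR).add (integrable_const (n * G₂ * (2 * R * B / w ^ (n * B))))) hpath
  simp only [Pi.add_apply] at hmono
  rw [integral_add (integrable_finsetSum _ iR) (integrable_const _), integral_finsetSum _ iR]
    at hmono
  refine hmono.trans ?_
  have hterm : ∀ t ∈ Finset.Icc 1 T, ∫ ω, (n * G₂ * Λ * (n * p * G₁) * S.α t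
        + ((1 + n * G₂ * Λ * (p * G₂ * γ₀)) * ∑ i, M.viol S t i ω
        + (2 * n * G₂ + n * G₂ * Λ) * M.errSum S t ω)) ∂μ
      ≤ n * G₂ * Λ * (n * p * G₁) * S.α t
        + (1 + n * G₂ * Λ * (p * G₂ * γ₀)) * ∑ i, ∫ ω, M.viol S t i ω ∂μ
        + (2 * n * G₂ + n * G₂ * Λ) * (n * (1 + C)) * S.s t := by
    intro t ht
    have ht1 := (Finset.mem_Icc.1 ht).1
    have i1 : Integrable (fun ω => (1 + n * G₂ * Λ * (p * G₂ * γ₀)) * ∑ i, M.viol S t i ω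
        + (2 * n * G₂ + n * G₂ * Λ) * M.errSum S t ω) μ :=
      ((iv t ht).const_mul _).add ((ie t ht).const_mul _)
    rw [integral_add (integrable_const _) i1,
      integral_add ((iv t ht).const_mul _) ((ie t ht).const_mul _), integral_const, probReal_univ,
      one_smul, integral_const_mul, integral_const_mul, integral_finsetSum _ fun i _ => h.integrable_viol i ht1]
    have := mul_le_mul_of_nonneg_left (h.integral_errSum_le ht1)
      (by positivity : 0 ≤ 2 * n * G₂ + n * G₂ * Λ)
    linarith
  have hsum := Finset.sum_le_sum hterm
  simp only [Finset.sum_add_distrib, ← Finset.mul_sum] at hsum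
  simp only [integral_const, probReal_univ, one_smul]
  linarith

end

end Model

end BanditCompressed

namespace BanditCompressed

/-! ### Regret -/

/-- The support-type function `s ↦ inf_{y ∈ F} ⟨s, y⟩` of a bounded set is Lipschitz. -/
theorem lipschitzWith_sInf_inner {p : ℕ} {F : Set (Vec p)} (hF : F.Nonempty) {R : NNReal}
    (hR : ∀ y ∈ F, ‖y‖ ≤ R) :
    LipschitzWith R fun s : Vec p => sInf ((fun y => inner ℝ s y) '' F) := by
  refine LipschitzWith.of_le_add_mul R fun s s' => ?_
  rw [← sub_le_iff_le_add]
  refine le_csInf (hF.image _) ?_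
  rintro _ ⟨y, hy, rfl⟩
  have hbdd : BddBelow ((fun y => inner ℝ s y) '' F) := by
    refine ⟨-(‖s‖ * R), ?_⟩
    rintro _ ⟨z, hz, rfl⟩
    exact (neg_le_neg (mul_le_mul_of_nonneg_left (hR z hz) (norm_nonneg s))).trans
      (neg_le_of_abs_le (abs_real_inner_le_norm s z))
  have h1 : sInf ((fun y => inner ℝ s y) '' F) ≤ inner ℝ s y := csInf_le hbdd ⟨y, hy, rfl⟩
  have h2 : inner ℝ (s - s') y ≤ R * dist s s' := by
    rw [dist_eq_norm, mul_comm]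
    exact (real_inner_le_norm _ _).trans (mul_le_mul_of_nonneg_left (hR y hy) (norm_nonneg _))
  rw [inner_sub_left] at h2
  simp only
  linarith

namespace Model

variable {n p : ℕ} {Ω Ξ : Type*} [MeasurableSpace Ξ] [m₀ : MeasurableSpace Ω] {μ : Measure Ω}
  {M : Model n p Ω Ξ} {S : Schedule} {r R G₁ G₂ L w C γ₀ : ℝ} {B : ℕ}

/-- A pathwise bound for the regret of every agent, with expectation of the right order. The last
sum collects the terms involving the noise of the estimators, which are compensated on average by
the quadratic penalty. -/
noncomputable def regretMajorant (M : Model n p Ω Ξ) (S : Schedule) (c₀ c₁ c₂ : ℝ) (T : ℕ)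
    (ω : Ω) : ℝ :=
  c₀ / S.α T + ∑ t ∈ Finset.Icc 1 T, (c₁ * S.α t + (c₂ * M.errSum S t ω + M.errSqSum S t ω) / S.α t)
    + 1 / (n : ℝ) * ∑ j, (S.α T / 16 * ‖M.noiseSum S j T ω‖ ^ 2
      - ∑ t ∈ Finset.Icc 1 T, (inner ℝ (M.noise S t j ω) (M.x S ω j t)
        + S.γ t / 4 * M.viol S t j ω ^ 2))

theorem _root_.BanditCompressed.Schedule.IsCoupled.α_le (hS : S.IsCoupled r γ₀) {t T : ℕ}
    (ht : 1 ≤ t) (hT : t ≤ T) : S.α T ≤ S.α t := by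
  induction T, hT using Nat.le_induction with
  | base => exact le_rfl
  | succ T hT ih => exact (hS.α_anti T (ht.trans hT)).trans ih

/-- The drift inequality rescaled by the stepsize, as a bound for the average local regret. -/
theorem TunedRun.average_inner_grad_le (h : M.TunedRun S μ r R G₁ G₂ L w B C γ₀) {ω : Ω}
    (hω : M.IsRegular S G₁ G₂ ω) {t : ℕ} (ht : 1 ≤ t) {y : Vec p} (hy : y ∈ M.X)
    (hyg : ∀ i k, M.g i t y k ≤ 0) :
    1 / (n : ℝ) * ∑ j, inner ℝ (M.grad S t j ω) (M.x S ω j t - y)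
    ≤ 1 / (n : ℝ) * (1 / (2 * S.α t) * ((M.potential S y t ω + n * (4 * R ^ 2) * S.α t)
        - (M.potential S y (t + 1) ω + n * (4 * R ^ 2) * S.α (t + 1))))
      + (2 * p ^ 2 * G₁ ^ 2 + 2 * γ₀ * (G₂ * (R + 2 * r)) ^ 2 + 2 * G₁ * R
          + 4 * p * L * r * R) * S.α t
      + ((4 * R + 2 * p * L * r) * M.errSum S t ω + M.errSqSum S t ω) / S.α t
      + 1 / (n : ℝ) * ∑ j, ((1 - S.α t) * inner ℝ (M.noise S t j ω) y
        - inner ℝ (M.noise S t j ω) (M.x S ω j t) - S.γ t / 2 * M.viol S t j ω ^ 2) := by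
  have hα := h.coupled.α_pos t ht
  have hα1 := h.coupled.α_lt_one t ht
  have hn1 : (1 : ℝ) ≤ n := by exact_mod_cast h.one_le_n
  have hn : (0 : ℝ) < n := by linarith
  have hd := h.drift hω ht hy (le_refl 0) (by simpa using hyg)
  set c : ℝ := 2 * p ^ 2 * G₁ ^ 2 + 2 * γ₀ * (G₂ * (R + 2 * r)) ^ 2 + 2 * G₁ * R
          + 4 * p * L * r * R with hc
  have hc0 : 0 ≤ c := by
    have := h.L_nonneg
    have := h.r_pos
    have := h.γ₀_pos
    have := h.G₁_nonneg
    have := h.R_nonneg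
    positivity
  set e := (4 * R + 2 * p * L * r) * M.errSum S t ω + M.errSqSum S t ω with he
  have he0 : 0 ≤ e := by
    have := h.L_nonneg
    have := h.r_pos
    have := h.R_nonneg
    have := errSum_nonneg (M := M) (S := S) t ω
    have := errSqSum_nonneg (M := M) (S := S) t ω
    positivity
  have hsum : ∑ i, (2 * S.α t * inner ℝ (M.grad S t i ω) (M.x S ω i t - y)
        + γ₀ * M.viol S t i ω ^ 2 + 2 * 0 * γ₀ * M.viol S t i ω
        + 2 * S.α t * inner ℝ (M.noise S t i ω) (M.x S ω i t - (1 - S.α t) • y))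
      = 2 * S.α t * (∑ j, inner ℝ (M.grad S t j ω) (M.x S ω j t - y)
        - ∑ j, ((1 - S.α t) * inner ℝ (M.noise S t j ω) y
          - inner ℝ (M.noise S t j ω) (M.x S ω j t) - S.γ t / 2 * M.viol S t j ω ^ 2)) := by
    rw [← Finset.sum_sub_distrib, Finset.mul_sum]
    refine Finset.sum_congr rfl fun i _ => ?_
    rw [inner_sub_right (M.noise S t i ω), inner_smul_right, h.coupled.γ_eq t ht]
    field_simp
    ring
  rw [hsum] at hd
  set A := ∑ j, inner ℝ (M.grad S t j ω) (M.x S ω j t - y)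
  set N := ∑ j, ((1 - S.α t) * inner ℝ (M.noise S t j ω) y
          - inner ℝ (M.noise S t j ω) (M.x S ω j t) - S.γ t / 2 * M.viol S t j ω ^ 2)
  have hD : ∀ t, ∑ i, ‖(M.state S ω t).z i - (1 - S.α t) • y‖ ^ 2 = M.potential S y t ω :=
    fun _ => rfl
  rw [hD, hD] at hd
  set D := M.potential S y t ω
  set D' := M.potential S y (t + 1) ω
  have h1 : 2 * S.α t * (A - N) ≤ 2 * S.α t * (1 / (2 * S.α t) * ((D + n * (4 * R ^ 2) * S.α t)
        - (D' + n * (4 * R ^ 2) * S.α (t + 1))) + n * (c * S.α t) + n * (e / S.α t)) := by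
    have e1 : 2 * S.α t * (1 / (2 * S.α t) * ((D + n * (4 * R ^ 2) * S.α t)
        - (D' + n * (4 * R ^ 2) * S.α (t + 1))) + n * (c * S.α t) + n * (e / S.α t))
        = ((D + n * (4 * R ^ 2) * S.α t) - (D' + n * (4 * R ^ 2) * S.α (t + 1)))
          + 2 * (n * c * S.α t ^ 2) + 2 * n * e := by
      field_simp
    rw [e1]
    have e2 : 0 ≤ n * c * S.α t ^ 2 := by positivity
    have e3 : e ≤ 2 * n * e := by nlinarith
    linarith
  have h2 := mul_le_mul_of_nonneg_left (le_of_mul_le_mul_left h1 (by positivity))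
    (by positivity : 0 ≤ 1 / (n : ℝ))
  have e4 : 1 / (n : ℝ) * (n * (c * S.α t)) = c * S.α t := by field_simp
  have e5 : 1 / (n : ℝ) * (n * (e / S.α t)) = e / S.α t := by field_simp
  rw [mul_sub, mul_add, mul_add, e4, e5] at h2
  linarith

/-- Against a feasible comparator, every agent's linearized regret is at most the majorant. -/
theorem TunedRun.sum_inner_globalLoss_le (h : M.TunedRun S μ r R G₁ G₂ L w B C γ₀) {ω : Ω}
    (hω : M.IsRegular S G₁ G₂ ω) (i : Fin n) {T : ℕ} (hT : 1 ≤ T) {y : Vec p}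
    (hy : y ∈ M.feasible T) :
    ∑ t ∈ Finset.Icc 1 T,
        inner ℝ (gradientWithin (M.globalLoss t) M.dom (M.x S ω i t)) (M.x S ω i t - y)
    ≤ M.regretMajorant S ((G₁ + 2 * R * L) * (2 * R * B / w ^ (n * B)) + 8 * R ^ 2)
      (2 * p ^ 2 * G₁ ^ 2 + 2 * γ₀ * (G₂ * (R + 2 * r)) ^ 2 + 2 * G₁ * R
        + 4 * p * L * r * R + (G₁ + 2 * R * L) * (4 * B / w ^ (n * B)) * (n * p * G₁)
        + n ^ 2 * ((G₁ + 2 * R * L) * (4 * B / w ^ (n * B)) * p * G₂) ^ 2 * γ₀)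
      (4 * R + 2 * p * L * r + (G₁ + 2 * R * L) * (4 * B / w ^ (n * B))
        + 2 * (G₁ + 2 * R * L) + 2 * G₁) T ω := by
  have hyX : y ∈ M.X := hy.1
  have hyg : ∀ t ∈ Finset.Icc 1 T, ∀ i k, M.g i t y k ≤ 0 := fun t ht i k => hy.2 t ht ⟨i, k⟩
  have hαT := h.coupled.α_pos T hT
  have hαT1 := h.coupled.α_lt_one T hT
  have hn1 : (1 : ℝ) ≤ n := by exact_mod_cast h.one_le_n
  have hn : (0 : ℝ) < n := by linarith
  have hR := h.R_nonneg
  have hG₁ := h.G₁_nonneg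
  have hL := h.L_nonneg
  have hw := h.w_pos
  have hγ₀ := h.γ₀_pos
  set c : ℝ := 2 * p ^ 2 * G₁ ^ 2 + 2 * γ₀ * (G₂ * (R + 2 * r)) ^ 2 + 2 * G₁ * R
          + 4 * p * L * r * R
  set Γ : ℝ := G₁ + 2 * R * L with hΓ
  have hΓ0 : 0 ≤ Γ := by positivity
  set Λ : ℝ := 4 * B / w ^ (n * B) with hΛ
  have hΛ0 : 0 ≤ Λ := by positivity
  set b : ℝ := 2 * R * B / w ^ (n * B) with hb
  have hb0 : 0 ≤ b := by positivity
  set k : ℝ := 4 * R + 2 * p * L * r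
  -- the summands with the disagreement of the agents kept apart
  have hterm : ∀ t ∈ Finset.Icc 1 T,
      inner ℝ (gradientWithin (M.globalLoss t) M.dom (M.x S ω i t)) (M.x S ω i t - y)
      ≤ 1 / (n : ℝ) * (1 / (2 * S.α t) * ((M.potential S y t ω + n * (4 * R ^ 2) * S.α t)
        - (M.potential S y (t + 1) ω + n * (4 * R ^ 2) * S.α (t + 1))))
      + c * S.α t + (k * M.errSum S t ω + M.errSqSum S t ω) / S.α t
      + 1 / (n : ℝ) * ∑ j, ((1 - S.α t) * inner ℝ (M.noise S t j ω) y
        - inner ℝ (M.noise S t j ω) (M.x S ω j t) - S.γ t / 2 * M.viol S t j ω ^ 2)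
      + Γ * spread (M.state S ω t).z + (2 * Γ + 2 * G₁) * (M.errSum S t ω) := by
    intro t ht
    have ht1 := (Finset.mem_Icc.1 ht).1
    have h1 := h.inner_globalLoss_le hω i ht1 hyX
    have h2 := h.average_inner_grad_le hω ht1 hyX (hyg t ht)
    linarith
  have habel : ∑ t ∈ Finset.Icc 1 T, 1 / (2 * S.α t)
        * ((M.potential S y t ω + n * (4 * R ^ 2) * S.α t)
        - (M.potential S y (t + 1) ω + n * (4 * R ^ 2) * S.α (t + 1)))
      ≤ n * (8 * R ^ 2) * (1 / (2 * S.α T)) := by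
    refine sum_mul_sub_succ_le (a := fun t => 1 / (2 * S.α t))
      (D := fun t => M.potential S y t ω + n * (4 * R ^ 2) * S.α t) ?_ ?_ ?_ ?_ hT
    · intro t ht
      have := h.coupled.α_pos t ht
      positivity
    · intro t ht
      have := h.coupled.α_pos (t + 1) (by omega)
      have := h.coupled.α_anti t ht
      gcongr
    · intro t ht
      have h1 := h.potential_le hyX ht ω
      have h2 := mul_le_mul_of_nonneg_left (h.coupled.α_lt_one t ht).le
        (by positivity : (0 : ℝ) ≤ n * (4 * R ^ 2))
      linarith
    · intro t ht
      have := h.coupled.α_pos t ht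
      have := potential_nonneg (M := M) (S := S) y t ω
      positivity
  have hspread := mul_le_mul_of_nonneg_left (h.sum_spread_le' hω T) hΓ0
  have hnoise : ∀ j, ∑ t ∈ Finset.Icc 1 T, (1 - S.α t) * inner ℝ (M.noise S t j ω) y
      ≤ 4 * R ^ 2 / S.α T + S.α T / 16 * ‖M.noiseSum S j T ω‖ ^ 2 := by
    intro j
    have e : ∑ t ∈ Finset.Icc 1 T, (1 - S.α t) * inner ℝ (M.noise S t j ω) y
        = inner ℝ (M.noiseSum S j T ω) y := by
      simp only [noiseSum, sum_inner, inner_smul_left, conj_trivial]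
    rw [e]
    have h1 : inner ℝ (M.noiseSum S j T ω) y ≤ ‖M.noiseSum S j T ω‖ * R :=
      (real_inner_le_norm _ _).trans
        (mul_le_mul_of_nonneg_left (h.admissible.set.norm_le hyX) (norm_nonneg _))
    refine h1.trans ?_
    set s := ‖M.noiseSum S j T ω‖
    have h2 : 4 * R ^ 2 / S.α T + S.α T / 16 * s ^ 2 - s * R
        = (8 * R - S.α T * s) ^ 2 / (16 * S.α T) := by
      field_simp
      ring
    have h3 : 0 ≤ (8 * R - S.α T * s) ^ 2 / (16 * S.α T) := by positivity
    linarith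
  -- half of the quadratic penalty absorbs the violations in the disagreement bound
  have hyoung : ∀ t ∈ Finset.Icc 1 T, Γ * Λ * (p * G₂ * γ₀) * ∑ j, M.viol S t j ω
      ≤ 1 / (n : ℝ) * ∑ j, S.γ t / 4 * M.viol S t j ω ^ 2
        + n ^ 2 * (Γ * Λ * p * G₂) ^ 2 * γ₀ * S.α t := by
    intro t ht
    have ht1 := (Finset.mem_Icc.1 ht).1
    have hα := h.coupled.α_pos t ht1
    rw [Finset.mul_sum, Finset.mul_sum]
    calc _ ≤ ∑ j, (1 / (n : ℝ) * (S.γ t / 4 * M.viol S t j ω ^ 2)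
          + n * (Γ * Λ * p * G₂) ^ 2 * γ₀ * S.α t) := Finset.sum_le_sum fun j _ => ?_
      _ = _ := by
          rw [Finset.sum_add_distrib]
          simp only [Finset.sum_const, Finset.card_univ, Fintype.card_fin, nsmul_eq_mul]
          ring
    set v := M.viol S t j ω
    set q := Γ * Λ * p * G₂ with hq
    have e0 : Γ * Λ * (p * G₂ * γ₀) = q * γ₀ := by rw [hq]; ring
    rw [e0, h.coupled.γ_eq t ht1]
    have e1 : 1 / (n : ℝ) * (γ₀ / S.α t / 4 * v ^ 2) + n * q ^ 2 * γ₀ * S.α t - q * γ₀ * v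
        = γ₀ * (v - 2 * n * q * S.α t) ^ 2 / (4 * n * S.α t) := by
      field_simp
      ring
    have e2 : 0 ≤ γ₀ * (v - 2 * n * q * S.α t) ^ 2 / (4 * n * S.α t) := by positivity
    linarith
  have herr : ∀ t ∈ Finset.Icc 1 T, (k * M.errSum S t ω + M.errSqSum S t ω) / S.α t
      + (2 * Γ + 2 * G₁) * M.errSum S t ω + Γ * Λ * M.errSum S t ω
      ≤ ((k + Γ * Λ + 2 * Γ + 2 * G₁) * M.errSum S t ω + M.errSqSum S t ω) / S.α t := by
    intro t ht
    have ht1 := (Finset.mem_Icc.1 ht).1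
    have hα := h.coupled.α_pos t ht1
    have he := errSum_nonneg (M := M) (S := S) t ω
    have h1 : (2 * Γ + 2 * G₁ + Γ * Λ) * M.errSum S t ω
        ≤ (2 * Γ + 2 * G₁ + Γ * Λ) * M.errSum S t ω / S.α t :=
      le_div_self (by positivity) hα (h.coupled.α_lt_one t ht1).le
    have h2 : ((k + Γ * Λ + 2 * Γ + 2 * G₁) * M.errSum S t ω + M.errSqSum S t ω) / S.α t
        = (k * M.errSum S t ω + M.errSqSum S t ω) / S.α t
          + (2 * Γ + 2 * G₁ + Γ * Λ) * M.errSum S t ω / S.α t := by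
      rw [← add_div]
      ring
    linarith
  have hΓb : Γ * b ≤ Γ * b / S.α T := le_div_self (by positivity) hαT hαT1.le
  have s1 := Finset.sum_le_sum hterm
  have s2 := Finset.sum_le_sum hyoung
  have s3 := Finset.sum_le_sum herr
  have s4 := mul_le_mul_of_nonneg_left (Finset.sum_le_sum fun j (_ : j ∈ Finset.univ) => hnoise j)
    (by positivity : 0 ≤ 1 / (n : ℝ))
  have s5 := mul_le_mul_of_nonneg_left habel (by positivity : 0 ≤ 1 / (n : ℝ))
  have e5 : 1 / (n : ℝ) * (n * (8 * R ^ 2) * (1 / (2 * S.α T))) = 4 * R ^ 2 / S.α T := by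
    field_simp
    ring
  rw [e5] at s5
  -- abbreviate the three kinds of summands indexed by agent and time
  obtain ⟨Q, hQ⟩ : ∃ Q : ℕ → Fin n → ℝ, ∀ t j, S.γ t / 4 * M.viol S t j ω ^ 2 = Q t j :=
    ⟨_, fun _ _ => rfl⟩
  obtain ⟨X, hX⟩ : ∃ X : ℕ → Fin n → ℝ, ∀ t j, inner ℝ (M.noise S t j ω) (M.x S ω j t) = X t j :=
    ⟨_, fun _ _ => rfl⟩
  obtain ⟨Y, hY⟩ : ∃ Y : ℕ → Fin n → ℝ, ∀ t j, (1 - S.α t) * inner ℝ (M.noise S t j ω) y = Y t j :=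
    ⟨_, fun _ _ => rfl⟩
  have hQ' : ∀ t j, S.γ t / 2 * M.viol S t j ω ^ 2 = Q t j + Q t j := fun t j => by
    rw [← hQ]
    ring
  have hswap : ∀ F : ℕ → Fin n → ℝ, ∑ j, ∑ t ∈ Finset.Icc 1 T, F t j
      = ∑ t ∈ Finset.Icc 1 T, ∑ j, F t j := fun F => Finset.sum_comm
  have hconst : 1 / (n : ℝ) * (n * (4 * R ^ 2 / S.α T)) = 4 * R ^ 2 / S.α T := by field_simp
  have e6 : (Γ * b + 8 * R ^ 2) / S.α T
      = Γ * b / S.α T + 4 * R ^ 2 / S.α T + 4 * R ^ 2 / S.α T := by ring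
  unfold regretMajorant
  rw [e6]
  simp only [hQ, hX, hY, hQ', Finset.sum_add_distrib, Finset.sum_sub_distrib, hswap,
    ← Finset.mul_sum, Finset.sum_const, Finset.card_univ, Fintype.card_fin, nsmul_eq_mul]
    at s1 s2 s3 s4 s5 hspread ⊢
  rw [mul_add, hconst] at s4
  linarith

end Model

end BanditCompressed

namespace BanditCompressed

namespace Model

variable {n p : ℕ} {Ω Ξ : Type*} [MeasurableSpace Ξ] [m₀ : MeasurableSpace Ω] {μ : Measure Ω}
  {M : Model n p Ω Ξ} {S : Schedule} {r R G₁ G₂ L w C γ₀ : ℝ} {B : ℕ} [IsProbabilityMeasure μ]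

theorem TunedRun.integrable_errTerm (h : M.TunedRun S μ r R G₁ G₂ L w B C γ₀) (c₁ c₂ : ℝ) {t : ℕ}
    (ht : 1 ≤ t) : Integrable (fun ω =>
      c₁ * S.α t + (c₂ * M.errSum S t ω + M.errSqSum S t ω) / S.α t) μ :=
  (integrable_const _).add
    ((((h.integrable_errSum ht).const_mul _).add (h.integrable_errSqSum ht)).div_const _)

theorem TunedRun.integrable_noiseTerm (h : M.TunedRun S μ r R G₁ G₂ L w B C γ₀) (j : Fin n) {t : ℕ}
    (ht : 1 ≤ t) : Integrable (fun ω => inner ℝ (M.noise S t j ω) (M.x S ω j t)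
        + S.γ t / 4 * M.viol S t j ω ^ 2) μ :=
  (integrable_inner_of_memLp (h.memLp_noise j ht) (h.memLp_x j ht)).add
    ((h.integrable_viol_sq j ht).const_mul _)

theorem TunedRun.integrable_noiseBracket (h : M.TunedRun S μ r R G₁ G₂ L w B C γ₀) (j : Fin n)
    (T : ℕ) : Integrable (fun ω => S.α T / 16 * ‖M.noiseSum S j T ω‖ ^ 2
      - ∑ t ∈ Finset.Icc 1 T, (inner ℝ (M.noise S t j ω) (M.x S ω j t)
        + S.γ t / 4 * M.viol S t j ω ^ 2)) μ :=
  (((h.memLp_noiseSum j T).integrable_norm_pow two_ne_zero).const_mul _).sub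
    (integrable_finsetSum _ fun _ ht => h.integrable_noiseTerm j (Finset.mem_Icc.1 ht).1)

theorem TunedRun.integrable_regretMajorant (h : M.TunedRun S μ r R G₁ G₂ L w B C γ₀)
    (c₀ c₁ c₂ : ℝ) (T : ℕ) : Integrable (M.regretMajorant S c₀ c₁ c₂ T) μ :=
  ((integrable_const _).add (integrable_finsetSum _ fun _ ht =>
    h.integrable_errTerm c₁ c₂ (Finset.mem_Icc.1 ht).1)).add
    ((integrable_finsetSum _ fun j _ => h.integrable_noiseBracket j T).const_mul _)

/-- The variance of the noise sum is paid for by the quadratic penalty: the two-point estimators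
have noise of size `γ_t` times the violation, while the penalty is `γ_t` times its square, and
`α_T γ_t ≤ γ₀` is small. -/
theorem TunedRun.integral_noiseBracket_le (h : M.TunedRun S μ r R G₁ G₂ L w B C γ₀) (j : Fin n)
    {T : ℕ} (hT : 1 ≤ T) : ∫ ω, (S.α T / 16 * ‖M.noiseSum S j T ω‖ ^ 2
      - ∑ t ∈ Finset.Icc 1 T, (inner ℝ (M.noise S t j ω) (M.x S ω j t)
        + S.γ t / 4 * M.viol S t j ω ^ 2)) ∂μ ≤ p ^ 2 * G₁ ^ 2 / 2 * (T * S.α T) := by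
  have hαT := h.coupled.α_pos T hT
  have hsq := ((h.memLp_noiseSum j T).integrable_norm_pow two_ne_zero).const_mul (S.α T / 16)
  have hi : ∀ t ∈ Finset.Icc 1 T, Integrable (fun ω => inner ℝ (M.noise S t j ω) (M.x S ω j t)
        + S.γ t / 4 * M.viol S t j ω ^ 2) μ := fun t ht =>
    h.integrable_noiseTerm j (Finset.mem_Icc.1 ht).1
  rw [integral_sub hsq (integrable_finsetSum _ hi), integral_const_mul, integral_finsetSum _ hi]
  have h1 := mul_le_mul_of_nonneg_left (h.integral_norm_sq_noiseSum_le j T)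
    (by positivity : 0 ≤ S.α T / 16)
  have hterm : ∀ t ∈ Finset.Icc 1 T, S.α T / 16 * ∫ ω, ‖M.noise S t j ω‖ ^ 2 ∂μ
      ≤ p ^ 2 * G₁ ^ 2 / 2 * S.α T + ∫ ω, (inner ℝ (M.noise S t j ω) (M.x S ω j t)
        + S.γ t / 4 * M.viol S t j ω ^ 2) ∂μ := by
    intro t ht
    have ht1 := (Finset.mem_Icc.1 ht).1
    have hα := h.coupled.α_pos t ht1
    have hγ₀ := h.γ₀_pos
    have hx := h.integral_inner_noise_x j ht1 0
    simp only [sub_zero] at hx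
    rw [integral_add (integrable_inner_of_memLp (h.memLp_noise j ht1) (h.memLp_x j ht1))
      ((h.integrable_viol_sq j ht1).const_mul _), hx, integral_const_mul, zero_add]
    have h2 := mul_le_mul_of_nonneg_left (h.integral_norm_sq_noise_le j ht1)
      (by positivity : 0 ≤ S.α T / 16)
    have hv : 0 ≤ ∫ ω, M.viol S t j ω ^ 2 ∂μ := integral_nonneg fun ω => sq_nonneg _
    set v := ∫ ω, M.viol S t j ω ^ 2 ∂μ
    have hγ : 0 < S.γ t := by
      rw [h.coupled.γ_eq t ht1]
      positivity
    have h3 : S.α T * S.γ t ≤ γ₀ := by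
      rw [h.coupled.γ_eq t ht1]
      calc S.α T * (γ₀ / S.α t) ≤ S.α t * (γ₀ / S.α t) := mul_le_mul_of_nonneg_right
            (h.coupled.α_le ht1 (Finset.mem_Icc.1 ht).2) (by positivity)
        _ = γ₀ := by field_simp
    have h4 : γ₀ * ((p : ℝ) ^ 2 * G₂ ^ 2) ≤ 1 / 4 := by
      have h5 := h.γ₀_le
      have h6 : 0 ≤ γ₀ * G₂ ^ 2 := by positivity
      linarith
    have h5 : S.α T * S.γ t * (p ^ 2 * G₂ ^ 2) ≤ 1 / 4 :=
      (mul_le_mul_of_nonneg_right h3 (by positivity)).trans h4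
    have h6 := mul_le_mul_of_nonneg_right h5 (by positivity : 0 ≤ S.γ t * v / 2)
    have h7 : 0 ≤ S.γ t * v := by positivity
    linarith
  have h2 := Finset.sum_le_sum hterm
  rw [← Finset.mul_sum, Finset.sum_add_distrib, Finset.sum_const, Nat.card_Icc, nsmul_eq_mul]
    at h2
  simp only [add_tsub_cancel_right] at h2
  linarith

theorem TunedRun.integral_regretMajorant_le (h : M.TunedRun S μ r R G₁ G₂ L w B C γ₀)
    (c₀ c₁ : ℝ) {c₂ : ℝ} (hc₂ : 0 ≤ c₂) {sm : ℝ} (hsm : ∀ t, 1 ≤ t → S.s t ≤ sm) {T : ℕ}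
    (hT : 1 ≤ T) : ∫ ω, M.regretMajorant S c₀ c₁ c₂ T ω ∂μ
      ≤ c₀ / S.α T + c₁ * ∑ t ∈ Finset.Icc 1 T, S.α t
        + n * (c₂ * (1 + C) + C * sm) * ∑ t ∈ Finset.Icc 1 T, S.s t / S.α t
        + p ^ 2 * G₁ ^ 2 / 2 * (T * S.α T) := by
  have hn : (0 : ℝ) < n := by exact_mod_cast h.one_le_n
  have hC := h.C_nonneg
  have he : ∀ t ∈ Finset.Icc 1 T, Integrable (fun ω =>
      c₁ * S.α t + (c₂ * M.errSum S t ω + M.errSqSum S t ω) / S.α t) μ := fun t ht =>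
    h.integrable_errTerm c₁ c₂ (Finset.mem_Icc.1 ht).1
  have hb := integrable_finsetSum Finset.univ fun j _ => h.integrable_noiseBracket j T
  have i1 : Integrable (fun ω => c₀ / S.α T + ∑ t ∈ Finset.Icc 1 T,
      (c₁ * S.α t + (c₂ * M.errSum S t ω + M.errSqSum S t ω) / S.α t)) μ :=
    (integrable_const _).add (integrable_finsetSum _ he)
  unfold regretMajorant
  rw [integral_add i1 (hb.const_mul _), integral_add (integrable_const _)
    (integrable_finsetSum _ he), integral_const, probReal_univ, one_smul, integral_const_mul,
    integral_finsetSum _ he, integral_finsetSum _ fun j _ => h.integrable_noiseBracket j T]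
  have h1 : 1 / (n : ℝ) * ∑ j, ∫ ω, (S.α T / 16 * ‖M.noiseSum S j T ω‖ ^ 2
      - ∑ t ∈ Finset.Icc 1 T, (inner ℝ (M.noise S t j ω) (M.x S ω j t)
        + S.γ t / 4 * M.viol S t j ω ^ 2)) ∂μ ≤ p ^ 2 * G₁ ^ 2 / 2 * (T * S.α T) := by
    rw [one_div, inv_mul_le_iff₀ hn]
    calc _ ≤ ∑ _j : Fin n, p ^ 2 * G₁ ^ 2 / 2 * (T * S.α T) :=
          Finset.sum_le_sum fun j _ => h.integral_noiseBracket_le j hT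
      _ = _ := by simp
  have h2 : ∀ t ∈ Finset.Icc 1 T,
      ∫ ω, (c₁ * S.α t + (c₂ * M.errSum S t ω + M.errSqSum S t ω) / S.α t) ∂μ
      ≤ c₁ * S.α t + n * (c₂ * (1 + C) + C * sm) * (S.s t / S.α t) := by
    intro t ht
    have ht1 := (Finset.mem_Icc.1 ht).1
    have hα := h.coupled.α_pos t ht1
    have hs := h.coupled.s_pos t ht1
    have i2 : Integrable (fun ω => c₂ * M.errSum S t ω + M.errSqSum S t ω) μ :=
      ((h.integrable_errSum ht1).const_mul _).add (h.integrable_errSqSum ht1)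
    rw [integral_add (integrable_const _) (i2.div_const _), integral_const, probReal_univ,
      one_smul, integral_div, integral_add ((h.integrable_errSum ht1).const_mul _)
      (h.integrable_errSqSum ht1), integral_const_mul, ← mul_div_assoc]
    have h3 := mul_le_mul_of_nonneg_left (h.integral_errSum_le ht1) hc₂
    have h4 := h.integral_errSqSum_le ht1
    have h5 : n * (C * S.s t ^ 2) ≤ n * (C * (sm * S.s t)) := by
      rw [sq]
      have := hsm t ht1
      gcongr
    gcongr
    linarith
  have h3 := Finset.sum_le_sum h2
  rw [Finset.sum_add_distrib, ← Finset.mul_sum, ← Finset.mul_sum] at h3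
  linarith

omit [IsProbabilityMeasure μ] in
/-- Each agent's regret is the supremum over the nonempty feasible set, so a bound uniform in the
comparator suffices. -/
theorem TunedRun.netReg_le (h : M.TunedRun S μ r R G₁ G₂ L w B C γ₀) {ω : Ω} {T : ℕ} (hT : 1 ≤ T)
    {V : ℝ} (hV : ∀ i, ∀ y ∈ M.feasible T, ∑ t ∈ Finset.Icc 1 T,
      inner ℝ (gradientWithin (M.globalLoss t) M.dom (M.x S ω i t)) (M.x S ω i t - y) ≤ V) :
    M.netReg T (M.x S ω) ≤ V := by
  have hn : (0 : ℝ) < n := by exact_mod_cast h.one_le_n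
  unfold Problem.netReg
  rw [one_div, inv_mul_le_iff₀ hn]
  calc _ ≤ ∑ _i : Fin n, V := Finset.sum_le_sum fun i _ => ?_
    _ = _ := by simp
  rw [sub_le_comm]
  refine le_csInf ((h.admissible.feasible T hT).image _) ?_
  rintro _ ⟨y, hy, rfl⟩
  have h1 := hV i y hy
  simp only [inner_sub_right, Finset.sum_sub_distrib] at h1
  simp only [sum_inner]
  linarith

/-- The gradient of the global loss at the decision of agent `i`, as a random variable. -/
theorem TunedRun.aestronglyMeasurable_globalGrad (h : M.TunedRun S μ r R G₁ G₂ L w B C γ₀)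
    (i : Fin n) {t : ℕ} (ht : 1 ≤ t) : AEStronglyMeasurable
      (fun ω => gradientWithin (M.globalLoss t) M.dom (M.x S ω i t)) μ :=
  aestronglyMeasurable_comp_of_continuousOn (φ := gradientWithin (M.globalLoss t) M.dom)
    (X := fun ω => M.x S ω i t) h.admissible.domain.isClosed
    (Problem.continuousOn_gradientWithin_globalLoss h.admissible.set h.r_pos h.admissible.domain
      h.admissible.gradient h.admissible.smooth ht) (h.memLp_x i ht).aestronglyMeasurable
    (h.ae_isRegular.mono fun _ hω => hω.mem_dom i t ht)

theorem TunedRun.memLp_globalGrad (h : M.TunedRun S μ r R G₁ G₂ L w B C γ₀)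
    (i : Fin n) {t : ℕ} (ht : 1 ≤ t) : MemLp
      (fun ω => gradientWithin (M.globalLoss t) M.dom (M.x S ω i t)) 2 μ :=
  MemLp.of_bound (h.aestronglyMeasurable_globalGrad i ht) G₁ (h.ae_isRegular.mono fun _ hω =>
    Problem.norm_gradientWithin_globalLoss_le h.admissible.set h.r_pos h.one_le_n
      h.admissible.domain h.admissible.gradient ht (hω.mem_dom i t ht))

theorem TunedRun.integrable_netReg (h : M.TunedRun S μ r R G₁ G₂ L w B C γ₀) {T : ℕ}
    (hT : 1 ≤ T) : Integrable (fun ω => M.netReg T (M.x S ω)) μ := by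
  unfold Problem.netReg
  refine Integrable.const_mul (integrable_finsetSum _ fun i _ => Integrable.sub
    (integrable_finsetSum _ fun t ht => integrable_inner_of_memLp
      (h.memLp_globalGrad i (Finset.mem_Icc.1 ht).1) (h.memLp_x i (Finset.mem_Icc.1 ht).1)) ?_) _
  have hlip := lipschitzWith_sInf_inner (R := R.toNNReal) (h.admissible.feasible T hT) fun y hy =>
    (h.admissible.set.norm_le hy.1).trans (Real.le_coe_toNNReal R)
  have hs : Integrable (fun ω => ∑ t ∈ Finset.Icc 1 T,
      gradientWithin (M.globalLoss t) M.dom (M.x S ω i t)) μ :=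
    integrable_finsetSum _ fun t ht =>
      (h.memLp_globalGrad i (Finset.mem_Icc.1 ht).1).integrable one_le_two
  refine (hs.norm.const_mul (R.toNNReal : ℝ)).mono'
    (hlip.continuous.comp_aestronglyMeasurable hs.aestronglyMeasurable) (.of_forall fun ω => ?_)
  set s := ∑ t ∈ Finset.Icc 1 T, gradientWithin (M.globalLoss t) M.dom (M.x S ω i t)
  have h0 : sInf ((fun y : Vec p => inner ℝ (0 : Vec p) y) '' M.feasible T) = 0 := by
    simp [Set.Nonempty.image_const (h.admissible.feasible T hT)]
  have h1 := hlip.dist_le_mul s 0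
  rwa [h0, dist_zero_right, dist_zero_right] at h1

/-- Expected network regret in terms of the parameter sequences. -/
theorem TunedRun.integral_netReg_le (h : M.TunedRun S μ r R G₁ G₂ L w B C γ₀) {sm : ℝ}
    (hsm : ∀ t, 1 ≤ t → S.s t ≤ sm) {T : ℕ} (hT : 1 ≤ T) :
    ∫ ω, M.netReg T (M.x S ω) ∂μ
      ≤ ((G₁ + 2 * R * L) * (2 * R * B / w ^ (n * B)) + 8 * R ^ 2) / S.α T
        + (2 * p ^ 2 * G₁ ^ 2 + 2 * γ₀ * (G₂ * (R + 2 * r)) ^ 2 + 2 * G₁ * R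
          + 4 * p * L * r * R + (G₁ + 2 * R * L) * (4 * B / w ^ (n * B)) * (n * p * G₁)
          + n ^ 2 * ((G₁ + 2 * R * L) * (4 * B / w ^ (n * B)) * p * G₂) ^ 2 * γ₀)
          * ∑ t ∈ Finset.Icc 1 T, S.α t
        + n * ((4 * R + 2 * p * L * r + (G₁ + 2 * R * L) * (4 * B / w ^ (n * B))
          + 2 * (G₁ + 2 * R * L) + 2 * G₁) * (1 + C) + C * sm)
          * ∑ t ∈ Finset.Icc 1 T, S.s t / S.α t
        + p ^ 2 * G₁ ^ 2 / 2 * (T * S.α T) := by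
  have hR := h.R_nonneg
  have hG₁ := h.G₁_nonneg
  have hL := h.L_nonneg
  have hw := h.w_pos
  have hr := h.r_pos
  refine (integral_mono_ae (h.integrable_netReg hT) (h.integrable_regretMajorant _ _ _ T) ?_).trans
    (h.integral_regretMajorant_le _ _ (by positivity) hsm hT)
  filter_upwards [h.ae_isRegular] with ω hω
  exact h.netReg_le hT fun i y hy => h.sum_inner_globalLoss_le hω i hT hy

end Model

end BanditCompressed

namespace BanditCompressed

/-! ### The power schedule -/

/-- The induction step is Bernoulli's inequality. -/
theorem sum_rpow_neg_le {a : ℝ} (ha : 0 < a) (ha1 : a < 1) (T : ℕ) :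
    ∑ t ∈ Finset.Icc 1 T, (t : ℝ) ^ (-a) ≤ (T : ℝ) ^ (1 - a) / (1 - a) := by
  have hb : 0 < 1 - a := by linarith
  induction T with
  | zero => simp [Real.zero_rpow hb.ne']
  | succ T ih =>
    rw [Finset.sum_Icc_succ_top (by omega)]
    refine (add_le_add ih le_rfl).trans ?_
    rw [div_add' _ _ _ hb.ne']
    refine div_le_div_of_nonneg_right ?_ hb.le
    set m : ℝ := ((T + 1 : ℕ) : ℝ) with hm
    have hm0 : 0 < m := by rw [hm]; positivity
    have hT : (T : ℝ) = m * (1 + -1 / m) := by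
      rw [hm]
      push_cast
      field_simp
      ring
    have hm1 : -1 ≤ -1 / m := by
      rw [le_div_iff₀ hm0, hm]
      push_cast
      have : (0 : ℝ) ≤ T := by positivity
      linarith
    have h1 := rpow_one_add_le_one_add_mul_self hm1 hb.le (by linarith : 1 - a ≤ 1)
    rw [hT, Real.mul_rpow hm0.le (by linarith)]
    have h2 := mul_le_mul_of_nonneg_left h1 (Real.rpow_nonneg hm0.le (1 - a))
    have h3 : m ^ (1 - a) = m ^ (-a) * m := by
      rw [← Real.rpow_add_one hm0.ne']
      ring_nf
    have h4 : m ^ (1 - a) * (1 + (1 - a) * (-1 / m)) = m ^ (1 - a) - m ^ (-a) * (1 - a) := by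
      rw [h3]
      field_simp
      ring
    linarith

section

variable {r α₀ γ₀ s₀ θ₁ θ₂ : ℝ}

theorem powerSchedule_α (t : ℕ) :
    (powerSchedule r α₀ γ₀ s₀ θ₁ θ₂).α t = α₀ * (t : ℝ) ^ (-θ₁) := by
  rw [Real.rpow_neg (by positivity), ← div_eq_mul_inv]
  rfl

theorem powerSchedule_s (t : ℕ) :
    (powerSchedule r α₀ γ₀ s₀ θ₁ θ₂).s t = s₀ * (t : ℝ) ^ (-θ₂) := by
  rw [Real.rpow_neg (by positivity), ← div_eq_mul_inv]
  rfl

theorem powerSchedule_isCoupled (hα₀ : 0 < α₀) (hα₁ : α₀ < 1) (hθ₁ : 0 < θ₁) (hs₀ : 0 < s₀) :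
    (powerSchedule r α₀ γ₀ s₀ θ₁ θ₂).IsCoupled r γ₀ where
  α_pos t ht := by
    rw [powerSchedule_α]
    positivity
  α_lt_one t ht := by
    rw [powerSchedule_α]
    have h1 : (t : ℝ) ^ (-θ₁) ≤ 1 :=
      Real.rpow_le_one_of_one_le_of_nonpos (by exact_mod_cast ht) (by linarith)
    have := mul_le_mul_of_nonneg_left h1 hα₀.le
    linarith
  α_anti t ht := by
    rw [powerSchedule_α, powerSchedule_α]
    have ht' : (0 : ℝ) < t := by exact_mod_cast ht
    have h1 : ((t + 1 : ℕ) : ℝ) ^ (-θ₁) ≤ (t : ℝ) ^ (-θ₁) :=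
      Real.rpow_le_rpow_of_nonpos ht' (by push_cast; linarith) (by linarith)
    exact mul_le_mul_of_nonneg_left h1 hα₀.le
  γ_eq _ _ := rfl
  ξ_eq _ _ := rfl
  δ_eq _ _ := rfl
  s_pos t ht := by
    rw [powerSchedule_s]
    positivity

theorem powerSchedule_s_le (hs₀ : 0 < s₀) (hθ₂ : 0 ≤ θ₂) {t : ℕ} (ht : 1 ≤ t) :
    (powerSchedule r α₀ γ₀ s₀ θ₁ θ₂).s t ≤ s₀ := by
  rw [powerSchedule_s]
  have h1 : (t : ℝ) ^ (-θ₂) ≤ 1 :=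
    Real.rpow_le_one_of_one_le_of_nonpos (by exact_mod_cast ht) (by linarith)
  have := mul_le_mul_of_nonneg_left h1 hs₀.le
  linarith

theorem sum_powerSchedule_α_le (hα₀ : 0 < α₀) (hθ₁ : 0 < θ₁) (hθ₁' : θ₁ < 1) (T : ℕ) :
    ∑ t ∈ Finset.Icc 1 T, (powerSchedule r α₀ γ₀ s₀ θ₁ θ₂).α t
      ≤ α₀ / (1 - θ₁) * (T : ℝ) ^ (1 - θ₁) := by
  simp only [powerSchedule_α, ← Finset.mul_sum]
  rw [div_mul_eq_mul_div, mul_div_assoc]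
  exact mul_le_mul_of_nonneg_left (sum_rpow_neg_le hθ₁ hθ₁' T) hα₀.le

theorem sum_powerSchedule_s_le (hs₀ : 0 < s₀) (hθ₁ : 0 < θ₁) (hθ₁' : θ₁ < 1) (hθ₂ : 1 ≤ θ₂)
    (T : ℕ) : ∑ t ∈ Finset.Icc 1 T, (powerSchedule r α₀ γ₀ s₀ θ₁ θ₂).s t
      ≤ s₀ / (1 - θ₁) * (T : ℝ) ^ (1 - θ₁) := by
  simp only [powerSchedule_s, ← Finset.mul_sum]
  rw [div_mul_eq_mul_div, mul_div_assoc]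
  refine mul_le_mul_of_nonneg_left ((Finset.sum_le_sum fun t ht => ?_).trans
    (sum_rpow_neg_le hθ₁ hθ₁' T)) hs₀.le
  exact Real.rpow_le_rpow_of_exponent_le (by exact_mod_cast (Finset.mem_Icc.1 ht).1) (by linarith)

theorem sum_powerSchedule_s_div_α_le (hα₀ : 0 < α₀) (hs₀ : 0 < s₀) (hθ₁ : 0 < θ₁) (hθ₁' : θ₁ < 1)
    (hθ₂ : 1 ≤ θ₂) (T : ℕ) : ∑ t ∈ Finset.Icc 1 T, (powerSchedule r α₀ γ₀ s₀ θ₁ θ₂).s t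
        / (powerSchedule r α₀ γ₀ s₀ θ₁ θ₂).α t
      ≤ s₀ / α₀ / θ₁ * (T : ℝ) ^ θ₁ := by
  have h1 : ∀ t ∈ Finset.Icc 1 T, (powerSchedule r α₀ γ₀ s₀ θ₁ θ₂).s t
        / (powerSchedule r α₀ γ₀ s₀ θ₁ θ₂).α t ≤ s₀ / α₀ * (t : ℝ) ^ (-(1 - θ₁)) := by
    intro t ht
    have ht1 : (1 : ℝ) ≤ t := by exact_mod_cast (Finset.mem_Icc.1 ht).1
    have ht0 : (0 : ℝ) < t := by linarith
    rw [powerSchedule_s, powerSchedule_α, mul_div_mul_comm, ← Real.rpow_sub ht0]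
    exact mul_le_mul_of_nonneg_left (Real.rpow_le_rpow_of_exponent_le ht1 (by linarith))
      (by positivity)
  refine (Finset.sum_le_sum h1).trans ?_
  rw [← Finset.mul_sum, div_mul_eq_mul_div _ θ₁, mul_div_assoc]
  have h2 := sum_rpow_neg_le (a := 1 - θ₁) (by linarith) (by linarith) T
  rw [sub_sub_cancel] at h2
  exact mul_le_mul_of_nonneg_left h2 (by positivity)

theorem one_le_rpow_natCast {T : ℕ} (hT : 1 ≤ T) {a : ℝ} (ha : 0 ≤ a) : 1 ≤ (T : ℝ) ^ a :=
  Real.one_le_rpow (by exact_mod_cast hT) ha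

end

namespace Model

variable {n p : ℕ} {Ω Ξ : Type*} [MeasurableSpace Ξ] [m₀ : MeasurableSpace Ω] {μ : Measure Ω}
  {M : Model n p Ω Ξ} {S : Schedule} {r R G₁ G₂ L w C α₀ γ₀ s₀ θ₁ θ₂ : ℝ} {B : ℕ}

/-- The assumptions force the constants to be nonnegative: they bound norms at points of the ball
of radius `r`. -/
theorem Admissible.tunedRun (h : M.Admissible S μ r R G₁ G₂ L w B C) (hn : 1 ≤ n) (hp : 1 ≤ p)
    (hr : 0 < r) (hw : 0 < w) (hC : 0 ≤ C) (hγ₀ : 0 < γ₀)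
    (hγ₀' : γ₀ * (4 * ((p : ℝ) ^ 2 + 1) * G₂ ^ 2) ≤ 1) (hS : S.IsCoupled r γ₀) :
    M.TunedRun S μ r R G₁ G₂ L w B C γ₀ := by
  have hball : ∀ x : Vec p, ‖x‖ ≤ r → x ∈ M.dom := fun x hx =>
    h.domain.X_subset (h.set.ball_subset (mem_closedBall_zero_iff.2 hx))
  have h0 : (0 : Vec p) ∈ M.dom := hball 0 (by simpa using hr.le)
  have hR : 0 ≤ R := by
    have h1 : (0 : Vec p) ∈ Metric.closedBall 0 R :=
      h.set.subset_ball (h.set.ball_subset (Metric.mem_closedBall_self hr.le))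
    exact (norm_nonneg _).trans (mem_closedBall_zero_iff.1 h1)
  let i₀ : Fin n := ⟨0, hn⟩
  let e : Vec p := EuclideanSpace.single ⟨0, hp⟩ r
  have he : ‖e‖ = r := by simp [e, hr.le]
  refine ⟨h, hS, hn, hp, hr, hw, hγ₀, hγ₀', hR,
    (norm_nonneg _).trans (h.gradient.f_bound i₀ 1 le_rfl 0 h0), ?_, ?_, hC⟩
  · obtain ⟨J, -, hJ⟩ := h.gradient.g_bound i₀ 1 le_rfl 0 h0
    exact (norm_nonneg _).trans hJ
  · have h1 := (norm_nonneg _).trans (h.smooth i₀ 1 le_rfl e (hball e he.le) 0 h0)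
    rw [sub_zero, he] at h1
    exact nonneg_of_mul_nonneg_left h1 hr

end Model

/-! ### Rates -/

section Rates

universe u v

open Model

variable (n p : ℕ) (r R G₁ G₂ L w : ℝ) (B : ℕ) (C α₀ γ₀ s₀ θ₁ θ₂ ς : ℝ)

/-- The regret majorant has leading terms `1 / α_T`, `∑ α_t`, `∑ s_t / α_t` and `T α_T`. -/
theorem exists_integral_netReg_le (hα₀ : 0 < α₀) (hs₀ : 0 < s₀) (hθ₁ : 0 < θ₁) (hθ₁' : θ₁ < 1)
    (hθ₂ : 1 ≤ θ₂) :
    ∃ K : ℝ, ∀ (Ω : Type u) (Ξ : Type v) [MeasurableSpace Ω] [MeasurableSpace Ξ]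
      (μ : Measure Ω) [IsProbabilityMeasure μ] (M : Model n p Ω Ξ),
      M.TunedRun (powerSchedule r α₀ γ₀ s₀ θ₁ θ₂) μ r R G₁ G₂ L w B C γ₀ → ∀ T : ℕ, 1 ≤ T →
        ∫ ω, M.netReg T (M.x (powerSchedule r α₀ γ₀ s₀ θ₁ θ₂) ω) ∂μ
          ≤ K * (T : ℝ) ^ max (1 - θ₁) θ₁ := by
  obtain ⟨c₀, hc₀⟩ : ∃ c₀ : ℝ, c₀ =
    (G₁ + 2 * R * L) * (2 * R * B / w ^ (n * B)) + 8 * R ^ 2 := ⟨_, rfl⟩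
  obtain ⟨c₁, hc₁⟩ : ∃ c₁ : ℝ, c₁ =
    2 * p ^ 2 * G₁ ^ 2 + 2 * γ₀ * (G₂ * (R + 2 * r)) ^ 2 + 2 * G₁ * R
          + 4 * p * L * r * R + (G₁ + 2 * R * L) * (4 * B / w ^ (n * B)) * (n * p * G₁)
          + n ^ 2 * ((G₁ + 2 * R * L) * (4 * B / w ^ (n * B)) * p * G₂) ^ 2 * γ₀ := ⟨_, rfl⟩
  obtain ⟨c₂, hc₂⟩ : ∃ c₂ : ℝ, c₂ =
    n * ((4 * R + 2 * p * L * r + (G₁ + 2 * R * L) * (4 * B / w ^ (n * B))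
          + 2 * (G₁ + 2 * R * L) + 2 * G₁) * (1 + C) + C * s₀) := ⟨_, rfl⟩
  refine ⟨c₀ / α₀ + c₁ * (α₀ / (1 - θ₁)) + c₂ * (s₀ / α₀ / θ₁) + p ^ 2 * G₁ ^ 2 / 2 * α₀, ?_⟩
  intro Ω Ξ _ _ μ _ M h T hT
  have hR := h.R_nonneg
  have hG₁ := h.G₁_nonneg
  have hL := h.L_nonneg
  have hw := h.w_pos
  have hr := h.r_pos
  have hC := h.C_nonneg
  have hγ₀ := h.γ₀_pos
  have hT1 : (1 : ℝ) ≤ T := by exact_mod_cast hT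
  have hT0 : (0 : ℝ) < T := by linarith
  have h1 := h.integral_netReg_le (sm := s₀)
    (fun t ht => powerSchedule_s_le hs₀ (by linarith) ht) hT
  rw [← hc₀, ← hc₁, ← hc₂] at h1
  set x := (T : ℝ) ^ max (1 - θ₁) θ₁ with hx
  have hx1 : (T : ℝ) ^ (1 - θ₁) ≤ x := Real.rpow_le_rpow_of_exponent_le hT1 (le_max_left _ _)
  have hx2 : (T : ℝ) ^ θ₁ ≤ x := Real.rpow_le_rpow_of_exponent_le hT1 (le_max_right _ _)
  have hθ : 0 < 1 - θ₁ := by linarith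
  have hc₀0 : 0 ≤ c₀ := by rw [hc₀]; positivity
  have hc₁0 : 0 ≤ c₁ := by rw [hc₁]; positivity
  have hc₂0 : 0 ≤ c₂ := by rw [hc₂]; positivity
  have e1 : c₀ / (powerSchedule r α₀ γ₀ s₀ θ₁ θ₂).α T ≤ c₀ / α₀ * x := by
    have : c₀ / (powerSchedule r α₀ γ₀ s₀ θ₁ θ₂).α T = c₀ / α₀ * (T : ℝ) ^ θ₁ := by
      rw [powerSchedule_α, Real.rpow_neg hT0.le]
      field_simp
    rw [this]
    gcongr
  have e2 : c₁ * ∑ t ∈ Finset.Icc 1 T, (powerSchedule r α₀ γ₀ s₀ θ₁ θ₂).α t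
      ≤ c₁ * (α₀ / (1 - θ₁) * x) := by
    refine mul_le_mul_of_nonneg_left ((sum_powerSchedule_α_le hα₀ hθ₁ hθ₁' T).trans ?_) hc₁0
    gcongr
  have e3 : c₂ * ∑ t ∈ Finset.Icc 1 T, (powerSchedule r α₀ γ₀ s₀ θ₁ θ₂).s t
        / (powerSchedule r α₀ γ₀ s₀ θ₁ θ₂).α t ≤ c₂ * (s₀ / α₀ / θ₁ * x) := by
    refine mul_le_mul_of_nonneg_left
      ((sum_powerSchedule_s_div_α_le hα₀ hs₀ hθ₁ hθ₁' hθ₂ T).trans ?_) hc₂0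
    gcongr
  have e4 : p ^ 2 * G₁ ^ 2 / 2 * (T * (powerSchedule r α₀ γ₀ s₀ θ₁ θ₂).α T)
      ≤ p ^ 2 * G₁ ^ 2 / 2 * (α₀ * x) := by
    have : T * (powerSchedule r α₀ γ₀ s₀ θ₁ θ₂).α T = α₀ * (T : ℝ) ^ (1 - θ₁) := by
      rw [powerSchedule_α, sub_eq_add_neg, Real.rpow_add hT0, Real.rpow_one]
      ring
    rw [this]
    gcongr
  linarith

/-- A bound for the expected local penalties relative to a comparator with margin `ς ≥ 0`. -/
theorem exists_sum_integral_penalty_le (hα₀ : 0 < α₀) (hs₀ : 0 < s₀) (hθ₁ : 0 < θ₁)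
    (hθ₁' : θ₁ < 1) (hθ₂ : 1 ≤ θ₂) (hς : 0 ≤ ς) :
    ∃ K : ℝ, ∀ (Ω : Type u) (Ξ : Type v) [MeasurableSpace Ω] [MeasurableSpace Ξ]
      (μ : Measure Ω) [IsProbabilityMeasure μ] (M : Model n p Ω Ξ),
      M.TunedRun (powerSchedule r α₀ γ₀ s₀ θ₁ θ₂) μ r R G₁ G₂ L w B C γ₀ → ∀ T : ℕ, 1 ≤ T →
        ∀ y ∈ M.X, (∀ t ∈ Finset.Icc 1 T, ∀ i k, M.g i t y k ≤ -ς) →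
        ∑ t ∈ Finset.Icc 1 T, ∑ i,
          (γ₀ * ∫ ω, M.viol (powerSchedule r α₀ γ₀ s₀ θ₁ θ₂) t i ω ^ 2 ∂μ
            + 2 * ς * γ₀ * ∫ ω, M.viol (powerSchedule r α₀ γ₀ s₀ θ₁ θ₂) t i ω ∂μ)
          ≤ K * (T : ℝ) ^ (1 - θ₁) := by
  obtain ⟨c₁, hc₁⟩ : ∃ c₁ : ℝ, c₁ =
    n * (2 * p ^ 2 * G₁ ^ 2 + 2 * γ₀ * (G₂ * (R + 2 * r)) ^ 2 + 2 * G₁ * R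
          + 4 * p * L * r * R + 4 * G₁ * R) := ⟨_, rfl⟩
  obtain ⟨c₂, hc₂⟩ : ∃ c₂ : ℝ, c₂ =
    n * ((4 * R + 2 * p * L * r + 2 * G₁) * (1 + C) + C * s₀) := ⟨_, rfl⟩
  refine ⟨n * (8 * R ^ 2) + c₁ * (α₀ / (1 - θ₁)) + c₂ * (s₀ / (1 - θ₁)), ?_⟩
  intro Ω Ξ _ _ μ _ M h T hT y hy hyς
  have hR := h.R_nonneg
  have hG₁ := h.G₁_nonneg
  have hL := h.L_nonneg
  have hr := h.r_pos
  have hC := h.C_nonneg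
  have hγ₀ := h.γ₀_pos
  have h1 := h.sum_integral_viol_le hT (sm := s₀)
    (fun t ht => powerSchedule_s_le hs₀ (by linarith) ht) hy hς hyς
  rw [← hc₁, ← hc₂] at h1
  have hc₁0 : 0 ≤ c₁ := by rw [hc₁]; positivity
  have hc₂0 : 0 ≤ c₂ := by rw [hc₂]; positivity
  have e1 : n * (8 * R ^ 2) * 1 ≤ n * (8 * R ^ 2) * (T : ℝ) ^ (1 - θ₁) :=
    mul_le_mul_of_nonneg_left (one_le_rpow_natCast hT (by linarith)) (by positivity)
  have e2 := mul_le_mul_of_nonneg_left (sum_powerSchedule_α_le (r := r) (γ₀ := γ₀) (s₀ := s₀)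
    (θ₂ := θ₂) hα₀ hθ₁ hθ₁' T) hc₁0
  have e3 := mul_le_mul_of_nonneg_left (sum_powerSchedule_s_le (r := r) (γ₀ := γ₀) (α₀ := α₀)
    hs₀ hθ₁ hθ₁' hθ₂ T) hc₂0
  linarith

/-- A bound for the sum of the expected local violations carries over to the network. -/
theorem exists_integral_netCCV_le (hα₀ : 0 < α₀) (hs₀ : 0 < s₀) (hθ₁ : 0 < θ₁)
    (hθ₁' : θ₁ < 1) (hθ₂ : 1 ≤ θ₂) (K₀ : ℝ) {a : ℝ} (ha : 1 - θ₁ ≤ a) :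
    ∃ K : ℝ, ∀ (Ω : Type u) (Ξ : Type v) [MeasurableSpace Ω] [MeasurableSpace Ξ]
      (μ : Measure Ω) [IsProbabilityMeasure μ] (M : Model n p Ω Ξ),
      M.TunedRun (powerSchedule r α₀ γ₀ s₀ θ₁ θ₂) μ r R G₁ G₂ L w B C γ₀ → ∀ T : ℕ, 1 ≤ T →
        ∑ t ∈ Finset.Icc 1 T, ∑ i, ∫ ω, M.viol (powerSchedule r α₀ γ₀ s₀ θ₁ θ₂) t i ω ∂μ
          ≤ K₀ * (T : ℝ) ^ a →
        ∫ ω, M.netCCV T (M.x (powerSchedule r α₀ γ₀ s₀ θ₁ θ₂) ω) ∂μ ≤ K * (T : ℝ) ^ a := by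
  obtain ⟨c₀, hc₀⟩ : ∃ c₀ : ℝ, c₀ = n * G₂ * (2 * R * B / w ^ (n * B)) := ⟨_, rfl⟩
  obtain ⟨c₁, hc₁⟩ : ∃ c₁ : ℝ, c₁ =
    n * G₂ * (4 * B / w ^ (n * B)) * (n * p * G₁) := ⟨_, rfl⟩
  obtain ⟨c₂, hc₂⟩ : ∃ c₂ : ℝ, c₂ =
    1 + n * G₂ * (4 * B / w ^ (n * B)) * (p * G₂ * γ₀) := ⟨_, rfl⟩
  obtain ⟨c₃, hc₃⟩ : ∃ c₃ : ℝ, c₃ =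
    (2 * n * G₂ + n * G₂ * (4 * B / w ^ (n * B))) * (n * (1 + C)) := ⟨_, rfl⟩
  refine ⟨c₀ + c₁ * (α₀ / (1 - θ₁)) + c₂ * K₀ + c₃ * (s₀ / (1 - θ₁)), ?_⟩
  intro Ω Ξ _ _ μ _ M h T hT hv
  have hR := h.R_nonneg
  have hG₁ := h.G₁_nonneg
  have hG₂ := h.G₂_nonneg
  have hw := h.w_pos
  have hC := h.C_nonneg
  have hγ₀ := h.γ₀_pos
  have h1 := h.integral_netCCV_le T
  rw [← hc₀, ← hc₁, ← hc₂, ← hc₃] at h1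
  have hc₀0 : 0 ≤ c₀ := by rw [hc₀]; positivity
  have hc₁0 : 0 ≤ c₁ := by rw [hc₁]; positivity
  have hc₂0 : 0 ≤ c₂ := by rw [hc₂]; positivity
  have hc₃0 : 0 ≤ c₃ := by rw [hc₃]; positivity
  have hθ : 0 < 1 - θ₁ := by linarith
  have hTa : (T : ℝ) ^ (1 - θ₁) ≤ (T : ℝ) ^ a :=
    Real.rpow_le_rpow_of_exponent_le (by exact_mod_cast hT) ha
  have e0 : c₀ * 1 ≤ c₀ * (T : ℝ) ^ a :=
    mul_le_mul_of_nonneg_left (one_le_rpow_natCast hT (by linarith)) hc₀0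
  have e1 := mul_le_mul_of_nonneg_left ((sum_powerSchedule_α_le (r := r) (γ₀ := γ₀) (s₀ := s₀)
    (θ₂ := θ₂) hα₀ hθ₁ hθ₁' T).trans (mul_le_mul_of_nonneg_left hTa
      (by positivity : 0 ≤ α₀ / (1 - θ₁)))) hc₁0
  have e2 := mul_le_mul_of_nonneg_left hv hc₂0
  have e3 := mul_le_mul_of_nonneg_left ((sum_powerSchedule_s_le (r := r) (γ₀ := γ₀) (α₀ := α₀)
    hs₀ hθ₁ hθ₁' hθ₂ T).trans (mul_le_mul_of_nonneg_left hTa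
      (by positivity : 0 ≤ s₀ / (1 - θ₁)))) hc₃0
  linarith

/-- A feasible comparator bounds the squared local violations; balancing them against the linear
ones loses a factor `T ^ (θ₁ / 2)`. -/
theorem exists_integral_netCCV_le_of_feasible (hα₀ : 0 < α₀) (hs₀ : 0 < s₀) (hθ₁ : 0 < θ₁)
    (hθ₁' : θ₁ < 1) (hθ₂ : 1 ≤ θ₂) :
    ∃ K : ℝ, ∀ (Ω : Type u) (Ξ : Type v) [MeasurableSpace Ω] [MeasurableSpace Ξ]
      (μ : Measure Ω) [IsProbabilityMeasure μ] (M : Model n p Ω Ξ),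
      M.TunedRun (powerSchedule r α₀ γ₀ s₀ θ₁ θ₂) μ r R G₁ G₂ L w B C γ₀ → ∀ T : ℕ, 1 ≤ T →
        ∫ ω, M.netCCV T (M.x (powerSchedule r α₀ γ₀ s₀ θ₁ θ₂) ω) ∂μ
          ≤ K * (T : ℝ) ^ (1 - θ₁ / 2) := by
  obtain ⟨K₁, hK₁⟩ := exists_sum_integral_penalty_le.{u, v} n p r R G₁ G₂ L w B C α₀ γ₀ s₀ θ₁ θ₂ 0
    hα₀ hs₀ hθ₁ hθ₁' hθ₂ le_rfl
  obtain ⟨K, hK⟩ := exists_integral_netCCV_le.{u, v} n p r R G₁ G₂ L w B C α₀ γ₀ s₀ θ₁ θ₂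
    hα₀ hs₀ hθ₁ hθ₁' hθ₂ (n / 2 + K₁ / (2 * γ₀)) (a := 1 - θ₁ / 2) (by linarith)
  refine ⟨K, ?_⟩
  intro Ω Ξ _ _ μ _ M h T hT
  refine hK Ω Ξ μ M h T hT ?_
  set S := powerSchedule r α₀ γ₀ s₀ θ₁ θ₂
  obtain ⟨y, hy⟩ := h.admissible.feasible T hT
  have hT0 : (0 : ℝ) < T := by exact_mod_cast hT
  have hγ₀ := h.γ₀_pos
  have h1 := hK₁ Ω Ξ μ M h T hT y hy.1 fun t ht i k => by
    rw [neg_zero]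
    exact hy.2 t ht ⟨i, k⟩
  simp only [mul_zero, zero_mul, add_zero, ← Finset.mul_sum] at h1
  -- balance the linear and the quadratic violation at the scale `τ = T ^ (-θ₁ / 2)`
  set τ : ℝ := (T : ℝ) ^ (-(θ₁ / 2)) with hτ
  have hτ0 : 0 < τ := Real.rpow_pos_of_pos hT0 _
  have h2 : ∀ t ∈ Finset.Icc 1 T, ∀ i : Fin n, ∫ ω, M.viol S t i ω ∂μ
      ≤ τ / 2 + 1 / (2 * τ) * ∫ ω, M.viol S t i ω ^ 2 ∂μ := by
    intro t ht i
    have ht1 := (Finset.mem_Icc.1 ht).1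
    have i2 := (h.integrable_viol_sq i ht1).const_mul (1 / (2 * τ))
    have h3 : ∫ ω, M.viol S t i ω ∂μ ≤ ∫ ω, (τ / 2 + 1 / (2 * τ) * M.viol S t i ω ^ 2) ∂μ := by
      refine integral_mono (h.integrable_viol i ht1) ((integrable_const _).add i2) fun ω => ?_
      have e : τ / 2 + 1 / (2 * τ) * M.viol S t i ω ^ 2 - M.viol S t i ω
          = (τ - M.viol S t i ω) ^ 2 / (2 * τ) := by
        field_simp
        ring
      have : 0 ≤ (τ - M.viol S t i ω) ^ 2 / (2 * τ) := by positivity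
      show M.viol S t i ω ≤ τ / 2 + 1 / (2 * τ) * M.viol S t i ω ^ 2
      linarith
    rwa [integral_add (integrable_const _) i2, integral_const, probReal_univ, one_smul,
      integral_const_mul] at h3
  have h3 := Finset.sum_le_sum fun t ht =>
    Finset.sum_le_sum fun i (_ : i ∈ Finset.univ) => h2 t ht i
  refine h3.trans ?_
  simp only [Finset.sum_add_distrib, ← Finset.mul_sum, Finset.sum_const, Finset.card_univ,
    Fintype.card_fin, nsmul_eq_mul, Nat.card_Icc, add_tsub_cancel_right]
  set Q := ∑ t ∈ Finset.Icc 1 T, ∑ i, ∫ ω, M.viol S t i ω ^ 2 ∂μ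
  have e1 : T * τ = (T : ℝ) ^ (1 - θ₁ / 2) := by
    rw [hτ, sub_eq_add_neg, Real.rpow_add hT0, Real.rpow_one]
  have e2 : (T : ℝ) ^ (1 - θ₁) = τ * (T : ℝ) ^ (1 - θ₁ / 2) := by
    rw [hτ, ← Real.rpow_add hT0]
    ring_nf
  rw [e2] at h1
  have h4 : 1 / (2 * τ) * Q ≤ K₁ / (2 * γ₀) * (T : ℝ) ^ (1 - θ₁ / 2) := by
    have h5 := mul_le_mul_of_nonneg_left h1 (by positivity : 0 ≤ 1 / (2 * γ₀ * τ))
    have e3 : 1 / (2 * γ₀ * τ) * (γ₀ * Q) = 1 / (2 * τ) * Q := by field_simp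
    have e4 : 1 / (2 * γ₀ * τ) * (K₁ * (τ * (T : ℝ) ^ (1 - θ₁ / 2)))
        = K₁ / (2 * γ₀) * (T : ℝ) ^ (1 - θ₁ / 2) := by field_simp
    rwa [e3, e4] at h5
  have e5 : (T : ℝ) * (n * (τ / 2)) = n / 2 * (T : ℝ) ^ (1 - θ₁ / 2) := by
    rw [← e1]
    ring
  linarith

/-- A Slater point bounds the local violations themselves, without loss. -/
theorem exists_integral_netCCV_le_of_slater (hα₀ : 0 < α₀) (hs₀ : 0 < s₀) (hθ₁ : 0 < θ₁)
    (hθ₁' : θ₁ < 1) (hθ₂ : 1 ≤ θ₂) (hς : 0 < ς) :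
    ∃ K : ℝ, ∀ (Ω : Type u) (Ξ : Type v) [MeasurableSpace Ω] [MeasurableSpace Ξ]
      (μ : Measure Ω) [IsProbabilityMeasure μ] (M : Model n p Ω Ξ),
      M.TunedRun (powerSchedule r α₀ γ₀ s₀ θ₁ θ₂) μ r R G₁ G₂ L w B C γ₀ → M.Slater ς →
      ∀ T : ℕ, 1 ≤ T →
        ∫ ω, M.netCCV T (M.x (powerSchedule r α₀ γ₀ s₀ θ₁ θ₂) ω) ∂μ ≤ K * (T : ℝ) ^ (1 - θ₁) := by
  obtain ⟨K₁, hK₁⟩ := exists_sum_integral_penalty_le.{u, v} n p r R G₁ G₂ L w B C α₀ γ₀ s₀ θ₁ θ₂ ς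
    hα₀ hs₀ hθ₁ hθ₁' hθ₂ hς.le
  obtain ⟨K, hK⟩ := exists_integral_netCCV_le.{u, v} n p r R G₁ G₂ L w B C α₀ γ₀ s₀ θ₁ θ₂
    hα₀ hs₀ hθ₁ hθ₁' hθ₂ (K₁ / (2 * ς * γ₀)) (a := 1 - θ₁) le_rfl
  refine ⟨K, ?_⟩
  intro Ω Ξ _ _ μ _ M h hsl T hT
  refine hK Ω Ξ μ M h T hT ?_
  obtain ⟨y, hy, hyς⟩ := hsl
  have hγ₀ := h.γ₀_pos
  have h1 := hK₁ Ω Ξ μ M h T hT y hy fun t ht i k => hyς t (Finset.mem_Icc.1 ht).1 ⟨i, k⟩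
  rw [div_mul_eq_mul_div, le_div_iff₀ (by positivity), mul_comm, Finset.mul_sum]
  refine le_trans (Finset.sum_le_sum fun t ht => ?_) h1
  rw [Finset.mul_sum]
  refine Finset.sum_le_sum fun i _ => le_add_of_nonneg_left ?_
  exact mul_nonneg hγ₀.le (integral_nonneg fun ω => sq_nonneg _)

end Rates

end BanditCompressed

theorem theorem2 (n p : ℕ) (hn : 1 ≤ n) (hp : 1 ≤ p)
    (r R G₁ G₂ L w : ℝ) (B : ℕ) (C α₀ γ₀ s₀ θ₁ θ₂ : ℝ)
    (hr : 0 < r) (hw : 0 < w ∧ w < 1) (hB : 0 < B) (hC : 0 ≤ C)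
    (hα₀ : 0 < α₀ ∧ α₀ < 1) (hθ₁ : 0 < θ₁ ∧ θ₁ < 1)
    (hγ₀ : 0 < γ₀ ∧ γ₀ * (4 * ((p : ℝ) ^ 2 + 1) * G₂ ^ 2) ≤ 1)
    (hs₀ : 0 < s₀) (hθ₂ : 1 ≤ θ₂)
    (S : BanditCompressed.Schedule)
    (hS : S = BanditCompressed.powerSchedule r α₀ γ₀ s₀ θ₁ θ₂) :
    -- regret and violation bounds without Slater's condition
    (∃ K : ℝ, 0 < K ∧
      ∀ (Ω : Type*) (Ξ : Type*) [MeasurableSpace Ω] [MeasurableSpace Ξ]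
        (μ : Measure Ω) [IsProbabilityMeasure μ] (M : BanditCompressed.Model n p Ω Ξ),
        M.Admissible S μ r R G₁ G₂ L w B C →
        ∀ T : ℕ, 1 ≤ T →
          (Integrable (fun ω => M.netReg T (M.x S ω)) μ ∧
            ∫ ω, M.netReg T (M.x S ω) ∂μ ≤ K * (T : ℝ) ^ max (1 - θ₁) θ₁) ∧
          (Integrable (fun ω => M.netCCV T (M.x S ω)) μ ∧
            ∫ ω, M.netCCV T (M.x S ω) ∂μ ≤ K * (T : ℝ) ^ (1 - θ₁ / 2))) ∧
    -- improved violation bound under Slater's condition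
    (∀ ς : ℝ, 0 < ς → ∃ K : ℝ, 0 < K ∧
      ∀ (Ω : Type*) (Ξ : Type*) [MeasurableSpace Ω] [MeasurableSpace Ξ]
        (μ : Measure Ω) [IsProbabilityMeasure μ] (M : BanditCompressed.Model n p Ω Ξ),
        M.Admissible S μ r R G₁ G₂ L w B C → M.Slater ς →
        ∀ T : ℕ, 1 ≤ T →
          ∫ ω, M.netCCV T (M.x S ω) ∂μ ≤ K * (T : ℝ) ^ (1 - θ₁)) := by
  subst hS
  have hcoup := BanditCompressed.powerSchedule_isCoupled (r := r) (γ₀ := γ₀) (θ₂ := θ₂)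
    hα₀.1 hα₀.2 hθ₁.1 hs₀
  refine ⟨?_, fun ς hς => ?_⟩
  · obtain ⟨K₁, hK₁⟩ := BanditCompressed.exists_integral_netReg_le n p r R G₁ G₂ L w B C α₀ γ₀ s₀
      θ₁ θ₂ hα₀.1 hs₀ hθ₁.1 hθ₁.2 hθ₂
    obtain ⟨K₂, hK₂⟩ := BanditCompressed.exists_integral_netCCV_le_of_feasible n p r R G₁ G₂ L w B C
      α₀ γ₀ s₀ θ₁ θ₂ hα₀.1 hs₀ hθ₁.1 hθ₁.2 hθ₂
    refine ⟨|K₁| + |K₂| + 1, by positivity, ?_⟩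
    intro Ω Ξ _ _ μ _ M hM T hT
    have h := hM.tunedRun hn hp hr hw.1 hC hγ₀.1 hγ₀.2 hcoup
    refine ⟨⟨h.integrable_netReg hT, ?_⟩, h.integrable_netCCV T, ?_⟩
    · refine (hK₁ Ω Ξ μ M h T hT).trans (mul_le_mul_of_nonneg_right ?_ (by positivity))
      linarith [le_abs_self K₁, abs_nonneg K₂]
    · refine (hK₂ Ω Ξ μ M h T hT).trans (mul_le_mul_of_nonneg_right ?_ (by positivity))
      linarith [le_abs_self K₂, abs_nonneg K₁]
  · obtain ⟨K, hK⟩ := BanditCompressed.exists_integral_netCCV_le_of_slater n p r R G₁ G₂ L w B C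
      α₀ γ₀ s₀ θ₁ θ₂ ς hα₀.1 hs₀ hθ₁.1 hθ₁.2 hθ₂ hς
    refine ⟨|K| + 1, by positivity, ?_⟩
    intro Ω Ξ _ _ μ _ M hM hsl T hT
    have h := hM.tunedRun hn hp hr hw.1 hC hγ₀.1 hγ₀.2 hcoup
    refine (hK Ω Ξ μ M h hsl T hT).trans (mul_le_mul_of_nonneg_right ?_ (by positivity))
    linarith [le_abs_self K]
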